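/- **Setting.** Let $B$ be a box $[0,a]\times[0,b]\times[0,c]$ with positive integers $a,b,c$, whose surface is divided into unit squares. Two squares are *adjacent* if they share an edge. A *polyomino* $P$ is a finite connected induced subgraph of the grid graph on $\mathbb Z^2$ (two cells are adjacent iff they are at $\ell^1$-distance $1$); holes are not excluded. $P$ *folds into* $B$ if each cell of $P$ can be carried isometrically onto a unit square of the surface of $B$ so that every square of $B$ is covered by exactly one cell and cells adjacent in $P$ stay attached along their common edge. Let $F:P\to B$ be the resulting bijection from cells to squares, and let $$C_P=\{\{s_1,s_2\} : s_1,s_2\text{ adjacent squares of }B,\ \{F^{-1}(s_1),F^{-1}(s_2)\}\notin E(P)\}$$ be the induced set of cut edges. Place a dot in each square of $B$ at its corner farthest from the origin. A square laid out in the plane, with its outer side up, has orientation $o\in\mathbb Z_4$ if its dot is at the $o$-th corner of its cell, the corners being counted counterclockwise from the top right one. For adjacent squares $s_1,s_2$ let $r_{s_1}(s_2)\in\mathbb Z_4$ be the orientation of $s_2$ when $s_1$ is laid out with orientation $0$ and $s_2$ is unfolded about the common edge. **Theorem.** Suppose that a polyomino $P$ folds into $B$, with induced cut edges $C_P$, and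 let $s^\star$ be any square of $B$. Then there are Boolean values $e_{s,t}=e_{t,s}$ and $d_{s,t}$ (for adjacent squares $s,t$) and $o_{s,k}$ (for squares $s$ and $k\in\mathbb Z_4$) such that $e_{s,t}$ is true if and only if $\{s,t\}\notin C_P$, and all of the following constraints hold. 1. *Cuts.* If $s_0,s_1,s_2$ are the three squares at a corner of $B$, then $e_{s_0,s_1},e_{s_1,s_2},e_{s_2,s_0}$ are not all true. If $s_0,s_1,s_2,s_3$ are, in cyclic order, four squares around a lattice point of the surface (a *block*), then $e_{s_0,s_1}\wedge e_{s_1,s_2}\wedge e_{s_2,s_3}\to e_{s_3,s_0}$. 2. *Square orientations.* For each square $s$ exactly one of the $o_{s,k}$, $k\in\mathbb Z_4$, is true; and $e_{s,t}\wedge o_{s,k}\to o_{t,\,r_s(t)+k}$ for all adjacent $s,t$ and all $k\in\mathbb Z_4$. 3. *Edge directions.* For all adjacent $s,t$: $d_{s,t}$ and $d_{t,s}$ are not both true, $e_{s,t}\to d_{s,t}\vee d_{t,s}$, and $d_{s,t}\to e_{s,t}$. 4. *Unique sink.* $d_{s^\star,u}$ is false for every neighbour $u$ of $s^\star$, and every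 square $v\ne s^\star$ has a neighbour $u$ with $d_{v,u}$ true. 5. *Forbidden patterns.* - If $u,w$ are the neighbours of $s$ across two opposite edges of $s$, then $d_{s,u},d_{s,w}$ are not both true. - For every block $s_0,s_1,s_2,s_3$ (in either cyclic order, starting at any of its squares), neither $d_{s_0,s_1}\wedge d_{s_2,s_3}\wedge e_{s_1,s_2}$ nor $d_{s_0,s_1}\wedge d_{s_2,s_3}\wedge e_{s_3,s_0}$ holds. - For every such block, $d_{s_0,s_1}\wedge d_{s_0,s_3}\to e_{s_1,s_2}\wedge e_{s_3,s_2}$. If $s_0,s_1,s_2$ are the three squares at a corner of $B$, in any order, then $d_{s_0,s_1},d_{s_0,s_2}$ are not both true. Hence no genuine unfolding of $B$ by a polyomino is excluded by the SAT encoding of a single box. -/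

import Mathlib

namespace BoxUnfolding

/-! ### Polyominoes -/

/-- The grid graph on `ℤ²`: two cells are adjacent iff their `ℓ¹`-distance is one. The cell
`(x, y)` stands for the unit square `[x, x+1] × [y, y+1]`. -/
def gridGraph : SimpleGraph (ℤ × ℤ) where
  Adj u v := |u.1 - v.1| + |u.2 - v.2| = 1
  symm := ⟨fun u v h => by
    rw [abs_sub_comm v.1, abs_sub_comm v.2]; exact h⟩
  loopless := ⟨fun u h => by simp at h⟩

/-- A polyomino: a finite set of cells inducing a connected subgraph of the grid. The edge set
of the polyomino consists of all grid edges between its cells. Holes are not excluded. -/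
def IsPolyomino (P : Finset (ℤ × ℤ)) : Prop :=
  (gridGraph.induce (P : Set (ℤ × ℤ))).Connected

/-- The corners of a unit square are numbered by `ℤ/4`, counterclockwise, starting from the
corner with offset `(1, 1)`: the offsets are `(1, 1), (0, 1), (0, 0), (1, 0)`.
This is the first coordinate of the offset. -/
def offX (k : ZMod 4) : ℤ := if k = 0 ∨ k = 3 then 1 else 0

/-- The second coordinate of the offset of corner `k`. -/
def offY (k : ZMod 4) : ℤ := if k = 0 ∨ k = 1 then 1 else 0

/-- The `k`-th corner of a cell in the plane. -/
def cellCorner (p : ℤ × ℤ) (k : ZMod 4) : ℤ × ℤ := (p.1 + offX k, p.2 + offY k)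

/-! ### The unit squares on the surface of a box -/

/-- A unit square on the surface of the box `[0, D 0] × [0, D 1] × [0, D 2]`. It lies in the face
that is normal to the coordinate axis `axis`, on the side `x_axis = D axis` if `high` is true and
on the side `x_axis = 0` otherwise; `pos` is its corner nearest to the origin. -/
@[ext]
structure BoxSquare (D : Fin 3 → ℕ) where
  axis : Fin 3
  high : Bool
  pos : Fin 3 → ℤ
  pos_axis : pos axis = if high then (D axis : ℤ) else 0
  pos_mem : ∀ j, j ≠ axis → 0 ≤ pos j ∧ pos j < (D j : ℤ)

variable {D : Fin 3 → ℕ}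

/-- The corners of a square of the box, numbered counterclockwise as seen from outside the box.
Corner `0` is the one farthest from the origin; it carries the dot that labels the square.
(The basis vectors `axis`, `axis + 1`, `axis + 2` are positively oriented, so on a high face
the offsets are used in the tangent directions `axis + 1`, `axis + 2`, while on a low face,
which is seen from the other side, the two directions are exchanged.) -/
def BoxSquare.corner (s : BoxSquare D) (k : ZMod 4) : Fin 3 → ℤ := fun j =>
  s.pos j +
    if j = s.axis + 1 then (if s.high then offX k else offY k)
    else if j = s.axis + 2 then (if s.high then offY k else offX k)
    else 0

/-- The `k`-th edge of `s` (from corner `k` to corner `k + 1`) is the `m`-th edge of `t`.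
Both boundaries are traversed counterclockwise, so the common edge is traversed in opposite
directions. -/
def BoxSquare.Glued (s : BoxSquare D) (k : ZMod 4) (t : BoxSquare D) (m : ZMod 4) : Prop :=
  s.corner k = t.corner (m + 1) ∧ s.corner (k + 1) = t.corner m

/-- Two squares of the box are adjacent if they share an edge. -/
def BoxSquare.Adj (s t : BoxSquare D) : Prop := ∃ k m, s.Glued k t m

/-- `RelOrient s t r`: the relative orientation of `t` with respect to `s` is `r`. A square that
is laid out in the plane has orientation `o` if its dot is at the `o`-th corner of its cell, so
that its `k`-th edge becomes the edge with number `k + o` of the cell. If `s` has orientation `0`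
and its `k`-th edge is the `m`-th edge of `t`, then, when `t` is unfolded about this edge, its
`m`-th edge becomes the edge with number `k + 2` of its cell, so the orientation of `t` is
`r = k + 2 - m`. -/
def BoxSquare.RelOrient (s t : BoxSquare D) (r : ZMod 4) : Prop :=
  ∃ k m, s.Glued k t m ∧ r = k + 2 - m

/-- `u` and `w` are the neighbours of `s` across two opposite edges of `s`. -/
def BoxSquare.Collinear (u s w : BoxSquare D) : Prop :=
  ∃ k m n, s.Glued k u m ∧ s.Glued (k + 2) w n

/-- Four squares around a lattice point at which four squares of the box meet, in cyclic order
(a `2 × 2` block, possibly bent along an edge of the box). The diagonal pairs are `s₀, s₂` and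
`s₁, s₃`. -/
def BoxSquare.Block (s₀ s₁ s₂ s₃ : BoxSquare D) : Prop :=
  (s₀ ≠ s₂ ∧ s₁ ≠ s₃) ∧ (s₀.Adj s₁ ∧ s₁.Adj s₂ ∧ s₂.Adj s₃ ∧ s₃.Adj s₀) ∧
    ∃ v, (∃ k, s₀.corner k = v) ∧ (∃ k, s₁.corner k = v) ∧ (∃ k, s₂.corner k = v) ∧
      (∃ k, s₃.corner k = v)

/-- The three squares that meet at a corner of the box. -/
def BoxSquare.CornerTriple (s₀ s₁ s₂ : BoxSquare D) : Prop :=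
  (s₀.Adj s₁ ∧ s₁.Adj s₂ ∧ s₂.Adj s₀) ∧
    ∃ v, (∃ k, s₀.corner k = v) ∧ (∃ k, s₁.corner k = v) ∧ (∃ k, s₂.corner k = v)

/-! ### Folding a polyomino into a box -/

/-- A folding of the set of cells `P` into the box, along edges of the unit cells: every cell is
carried isometrically onto a unit square of the surface of the box, each square of the box being
covered by exactly one cell, and cells of `P` with a common edge stay attached along this edge. -/
structure Folding (P : Finset (ℤ × ℤ)) (D : Fin 3 → ℕ) where
  /-- the square of the box covered by a cell -/
  F : P ≃ BoxSquare D
  /-- the point of space to which the `k`-th corner of a cell is carried -/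
  place : P → ZMod 4 → (Fin 3 → ℤ)
  /-- each cell is carried onto its square by an isometry, i.e. by one of the eight
  identifications of the corners of two squares that preserve their cyclic order up to
  reversal -/
  isometric : ∀ p, ∃ a : ZMod 4, (∀ k, place p k = (F p).corner (a + k)) ∨
    (∀ k, place p k = (F p).corner (a - k))
  /-- along a common edge of two cells, the two isometries agree -/
  attached : ∀ p q : P, gridGraph.Adj p q →
    ∀ k m, cellCorner p k = cellCorner q m → place p k = place q m

/-- The cut edges induced by a folding. An edge of the box is represented by the unordered pair of
the squares that it separates; it is cut iff the corresponding cells are not adjacent. -/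
def Folding.cutEdges {P : Finset (ℤ × ℤ)} (φ : Folding P D) : Set (Sym2 (BoxSquare D)) :=
  {z | ∃ s t : BoxSquare D, z = s(s, t) ∧ s.Adj t ∧
    ¬ gridGraph.Adj (φ.F.symm s : ℤ × ℤ) (φ.F.symm t : ℤ × ℤ)}

/-! ### The constraints -/

/-- A truth assignment to the variables of the encoding. (The variables `e` and `d` only matter
for pairs of adjacent squares.) -/
structure Assignment (D : Fin 3 → ℕ) where
  /-- `e_{s,t}`: the common edge of `s` and `t` is not cut -/
  e : Sym2 (BoxSquare D) → Bool
  /-- `o_{s,d}`: the square `s` has orientation `d` -/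
  o : BoxSquare D → ZMod 4 → Bool
  /-- `d_{s,t}`: the common edge of `s` and `t` is directed from `s` to `t` -/
  d : BoxSquare D → BoxSquare D → Bool

namespace Assignment

/-- At each corner of the box some edge is cut, and in each `2 × 2` block it does not happen that
exactly one of its four edges is cut. -/
structure CutConstraints (A : Assignment D) : Prop where
  corners : ∀ s₀ s₁ s₂ : BoxSquare D, s₀.CornerTriple s₁ s₂ →
    ¬ (A.e s(s₀, s₁) ∧ A.e s(s₁, s₂) ∧ A.e s(s₂, s₀))
  necessity : ∀ s₀ s₁ s₂ s₃ : BoxSquare D, s₀.Block s₁ s₂ s₃ →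
    A.e s(s₀, s₁) → A.e s(s₁, s₂) → A.e s(s₂, s₃) → A.e s(s₃, s₀)

/-- Square orientations: every square has exactly one orientation, and relative orientations
are preserved across edges that are not cut. -/
structure OrientationConstraints (A : Assignment D) : Prop where
  unique : ∀ s, ∃! d, A.o s d
  relative : ∀ s t r, s.RelOrient t r → ∀ d, A.e s(s, t) → A.o s d → A.o t (r + d)

/-- Edge directions: the preserved edges, and only these, have a direction, never both, and
`z` is the unique sink. -/
structure DirectionConstraints (A : Assignment D) (z : BoxSquare D) : Prop where
  not_both : ∀ s t, s.Adj t → ¬ (A.d s t ∧ A.d t s)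
  directed : ∀ s t, s.Adj t → A.e s(s, t) → A.d s t ∨ A.d t s
  preserved : ∀ s t, s.Adj t → A.d s t → A.e s(s, t)
  sink : ∀ u, z.Adj u → ¬ A.d z u
  not_sink : ∀ v, v ≠ z → ∃ u, v.Adj u ∧ A.d v u

/-- None of the forbidden patterns occurs. -/
structure PatternConstraints (A : Assignment D) : Prop where
  /-- no square has outgoing edges through two opposite sides -/
  collinear : ∀ u s w : BoxSquare D, u.Collinear s w → ¬ (A.d s u ∧ A.d s w)
  /-- in a `2 × 2` block, two parallel edges with opposite directions do not occur together with
  a preserved edge that joins them; the two clauses are for the two joining edges -/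
  antiparallel : ∀ s₀ s₁ s₂ s₃ : BoxSquare D, s₀.Block s₁ s₂ s₃ →
    ¬ (A.d s₀ s₁ ∧ A.d s₂ s₃ ∧ A.e s(s₁, s₂)) ∧ ¬ (A.d s₀ s₁ ∧ A.d s₂ s₃ ∧ A.e s(s₃, s₀))
  /-- if a square has outgoing edges through two consecutive sides, then the fourth square of the
  `2 × 2` block is attached to both of the neighbours -/
  orthogonal : ∀ s₀ s₁ s₂ s₃ : BoxSquare D, s₀.Block s₁ s₂ s₃ →
    A.d s₀ s₁ → A.d s₀ s₃ → A.e s(s₁, s₂) ∧ A.e s(s₃, s₂)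
  /-- the same pattern at a corner of the box, where there is no fourth square -/
  orthogonal_corner : ∀ s₀ s₁ s₂ : BoxSquare D, s₀.CornerTriple s₁ s₂ →
    ¬ (A.d s₀ s₁ ∧ A.d s₀ s₂)

/-- All constraints of the encoding of a single box, with the square `z` as the designated
sink. -/
structure Satisfies (A : Assignment D) (z : BoxSquare D) : Prop where
  cut : A.CutConstraints
  orientation : A.OrientationConstraints
  direction : A.DirectionConstraints z
  pattern : A.PatternConstraints

end Assignment

end BoxUnfolding

/-! The assignment is read off from the folding. After a reflection of the polyomino, if necessary,
all cells are carried to the box with the same orientation (`Folding.exists_layout`), so each cell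
has a well-defined turn. Let `e` record adjacency of cells, let `o` be minus the turn, and direct
each preserved edge towards the cell that is closer to the sink in the graph distance of `P`. The
cut, orientation and direction constraints are then local: three sides of a planar block force the
fourth, and the grid is bipartite, so it has no triangles and adjacent cells have different
distances.

The forbidden patterns are global. A chord is a maximal straight segment of edges with cells of `P`
on both sides. If `P` has no holes, the indicator of a chord is a coboundary modulo two: some
function on the cells changes exactly across the chord. A path that crosses a chord and returns can
be shortened by walking along the chord on the near side, so every step towards the sink across a
chord ends on the side of the sink (`IsDistance.eq_of_lt`). Antiparallel steps across one chord are
thus impossible. If two different steps from a cell lead towards the sink, the chord of the second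
must reach beyond the chord of the first (`IsDistance.exists_mem_chord`). This cannot happen for
opposite steps, and for consecutive steps it forces the fourth cell of the block.

That `P` has no holes is not assumed; it follows from the folding. Consider the graph of cut edges
on the lattice points of the box, and suppose that a component away from the outer boundary of `P`
contains an edge. Let `V` be its number of vertices, `C` its number of sides of cut edges, `S` the
number of corners of cells at its vertices, and `T` the number of those at points where three
squares meet. The Euler characteristic of the filled holes gives `2C + 4 ≤ S` in the plane
(`card_cut_le`). On the box, `2V ≤ C + 2` since the component is connected, and `12V = 3S + T` since
three or four squares meet at each point. Together these give `T = 0`; but where four squares meet a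
single cut edge is impossible, so `2V ≤ C`, a contradiction. Hence all cut edges lie in one
component (`comp_eq_of_cut`). The 24 corners of squares at the corners of the box then make the
Euler characteristic of `P` at least one, and for connected `P` the first cohomology vanishes
(`exists_primitive`). -/

namespace BoxUnfolding

/-! ### Geometry of the squares of a box -/

section Box

variable {D : Fin 3 → ℕ}

/-- The offset of the corner `k` of a square from the corner nearest to the origin. -/
def boxOff (i : Fin 3) (h : Bool) (k : ZMod 4) (j : Fin 3) : ℤ :=
  if j = i + 1 then (if h then offX k else offY k)
  else if j = i + 2 then (if h then offY k else offX k)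
  else 0

theorem corner_apply (s : BoxSquare D) (k : ZMod 4) (j : Fin 3) :
    s.corner k j = s.pos j + boxOff s.axis s.high k j := rfl

theorem boxOff_mem : ∀ i h k j, boxOff i h k j = 0 ∨ boxOff i h k j = 1 := by decide

theorem boxOff_axis : ∀ i h k, boxOff i h k i = 0 := by decide

theorem boxOff_add_opposite : ∀ i h k j,
    boxOff i h k j + boxOff i h (k + 2) j = if j = i then 0 else 1 := by decide

theorem boxOff_injective : ∀ i h k k', (∀ j, boxOff i h k j = boxOff i h k' j) → k = k' := by
  decide

theorem boxOff_diagonal : ∀ i h k k', (|boxOff i h k 0 - boxOff i h k' 0| +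
    |boxOff i h k 1 - boxOff i h k' 1| + |boxOff i h k 2 - boxOff i h k' 2| = 2 ↔ k' = k + 2) := by
  decide

theorem corner_injective (s : BoxSquare D) : Function.Injective s.corner := by
  intro k k' h
  refine boxOff_injective s.axis s.high k k' fun j => ?_
  have := congrFun h j
  rw [corner_apply, corner_apply] at this
  omega

/-- Oppositeness of two corners depends only on their positions in space, so it can be transferred
from one square to another. -/
theorem corner_diagonal (s : BoxSquare D) (k k' : ZMod 4) :
    |s.corner k 0 - s.corner k' 0| + |s.corner k 1 - s.corner k' 1| +
      |s.corner k 2 - s.corner k' 2| = 2 ↔ k' = k + 2 := by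
  simp only [corner_apply, add_sub_add_left_eq_sub]
  exact boxOff_diagonal _ _ _ _

theorem high_eq_of_pos (hD : ∀ i, 0 < D i) {s t : BoxSquare D} (ha : s.axis = t.axis)
    (hp : s.pos s.axis = t.pos s.axis) : s.high = t.high := by
  have h1 := s.pos_axis
  have h2 := t.pos_axis
  have := hD s.axis
  rw [← ha] at h2
  rw [h1, h2] at hp
  cases hs : s.high <;> cases ht : t.high <;> rw [hs, ht] at hp <;> simp at hp ⊢ <;> omega

/-- A square is determined by its centre. -/
theorem eq_of_center (hD : ∀ i, 0 < D i) {s t : BoxSquare D} {k m : ZMod 4}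
    (h0 : s.corner k = t.corner m) (h2 : s.corner (k + 2) = t.corner (m + 2)) : s = t := by
  -- The sum of two opposite corners is twice the centre. Its coordinates are even along the axis,
  -- up to multiples of two, and odd along the other directions only by the added unit, so parity
  -- recovers the axis.
  have key : ∀ j, 2 * s.pos j + (if j = s.axis then 0 else 1) =
      2 * t.pos j + (if j = t.axis then 0 else 1) := by
    intro j
    have e0 := congrFun h0 j
    have e2 := congrFun h2 j
    rw [corner_apply, corner_apply] at e0 e2
    have := boxOff_add_opposite s.axis s.high k j
    have := boxOff_add_opposite t.axis t.high m j
    omega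
  have ha : s.axis = t.axis := by
    by_contra hne
    have := key s.axis
    rw [if_pos rfl, if_neg hne] at this
    omega
  have hp : s.pos = t.pos := by
    funext j
    have := key j
    rw [ha] at this
    omega
  exact BoxSquare.ext ha (high_eq_of_pos hD ha (congrFun hp _)) hp

/-- The hypotheses place the edge on the line where two faces of the box meet. Both squares are
oriented from outside, so they traverse it in opposite directions. -/
theorem edge_orientation : ∀ (i i' : Fin 3) (h h' : Bool) (k k' : ZMod 4), i ≠ i' →
    (boxOff i h k i' = if h' then 1 else 0) → (boxOff i h (k + 1) i' = if h' then 1 else 0) →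
    (boxOff i' h' k' i = if h then 1 else 0) → (boxOff i' h' (k' + 1) i = if h then 1 else 0) →
    ∃ j, boxOff i h (k + 1) j - boxOff i h k j ≠ boxOff i' h' (k' + 1) j - boxOff i' h' k' j := by
  decide

theorem boxOff_edge : ∀ (i : Fin 3) (h : Bool) (k k' : ZMod 4),
    (∀ j, boxOff i h (k + 1) j - boxOff i h k j = boxOff i h (k' + 1) j - boxOff i h k' j) →
    k = k' := by decide

/-- The plane of `t` bounds the box, while `s` has unit extent in that direction; a corner of `s` in
this plane must have the extreme offset. -/
theorem boxOff_of_corner (s t : BoxSquare D) {k m : ZMod 4} (hne : s.axis ≠ t.axis)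
    (h : s.corner k = t.corner m) :
    boxOff s.axis s.high k t.axis = if t.high then 1 else 0 := by
  have e := congrFun h t.axis
  rw [corner_apply, corner_apply, boxOff_axis, t.pos_axis] at e
  have hp := s.pos_mem t.axis hne.symm
  have := boxOff_mem s.axis s.high k t.axis
  split_ifs at e ⊢ <;> omega

/-- A directed edge is traversed counterclockwise by at most one square. -/
theorem eq_of_edge (hD : ∀ i, 0 < D i) {s t : BoxSquare D} {k m : ZMod 4}
    (h0 : s.corner k = t.corner m) (h1 : s.corner (k + 1) = t.corner (m + 1)) :
    s = t ∧ k = m := by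
  have hd : ∀ j, boxOff s.axis s.high (k + 1) j - boxOff s.axis s.high k j =
      boxOff t.axis t.high (m + 1) j - boxOff t.axis t.high m j := by
    intro j
    have e0 := congrFun h0 j
    have e1 := congrFun h1 j
    rw [corner_apply, corner_apply] at e0 e1
    omega
  by_cases ha : s.axis = t.axis
  · have hh : s.high = t.high := by
      refine high_eq_of_pos hD ha ?_
      have e0 := congrFun h0 s.axis
      rw [corner_apply, corner_apply, boxOff_axis] at e0
      nth_rw 3 [ha] at e0
      rw [boxOff_axis] at e0
      omega
    rw [ha, hh] at hd
    have hk := boxOff_edge _ _ _ _ hd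
    refine ⟨BoxSquare.ext ha hh ?_, hk⟩
    funext j
    have e0 := congrFun h0 j
    rw [corner_apply, corner_apply, ha, hh, hk] at e0
    omega
  · obtain ⟨j, hj⟩ := edge_orientation s.axis t.axis s.high t.high k m ha
      (boxOff_of_corner s t ha h0) (boxOff_of_corner s t ha h1)
      (boxOff_of_corner t s (Ne.symm ha) h0.symm) (boxOff_of_corner t s (Ne.symm ha) h1.symm)
    exact absurd (hd j) hj

theorem BoxSquare.Glued.symm {s t : BoxSquare D} {k m : ZMod 4} (h : s.Glued k t m) :
    t.Glued m s k := ⟨h.2.symm, h.1.symm⟩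

theorem BoxSquare.Glued.unique (hD : ∀ i, 0 < D i) {s t t' : BoxSquare D} {k m m' : ZMod 4}
    (h : s.Glued k t m) (h' : s.Glued k t' m') : t = t' ∧ m = m' :=
  eq_of_edge hD (h.2.symm.trans h'.2) (h.1.symm.trans h'.1)

theorem BoxSquare.Glued.ne {s t : BoxSquare D} {k m : ZMod 4} (h : s.Glued k t m) : s ≠ t := by
  rintro rfl
  have h1 := corner_injective s h.1
  have h2 := corner_injective s h.2
  rw [h1] at h2
  clear h h1
  revert h2
  decide +revert

theorem BoxSquare.Adj.ne {s t : BoxSquare D} (h : s.Adj t) : s ≠ t := by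
  obtain ⟨k, m, h⟩ := h
  exact h.ne

/-- A common corner of two adjacent squares lies on their common edge. -/
theorem BoxSquare.Glued.corner_eq (hD : ∀ i, 0 < D i) {s t : BoxSquare D} {k m i j : ZMod 4}
    (h : s.Glued k t m) (hv : s.corner i = t.corner j) :
    (i = k ∧ j = m + 1) ∨ (i = k + 1 ∧ j = m) := by
  have hi : i = k ∨ i = k + 1 ∨ i = k + 2 ∨ i = k + 1 + 2 := by
    clear h hv
    decide +revert
  rcases hi with rfl | rfl | rfl | rfl
  · exact Or.inl ⟨rfl, corner_injective t (hv.symm.trans h.1)⟩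
  · exact Or.inr ⟨rfl, corner_injective t (hv.symm.trans h.2)⟩
  -- If the common corner were off the common edge, the two squares would share a pair of opposite
  -- corners, hence their centre.
  · have hd := (corner_diagonal s k (k + 2)).2 rfl
    rw [h.1, hv, corner_diagonal] at hd
    subst hd
    exact absurd (eq_of_center hD h.1 hv) h.ne
  · have hd := (corner_diagonal s (k + 1) (k + 1 + 2)).2 rfl
    rw [h.2, hv, corner_diagonal] at hd
    subst hd
    exact absurd (eq_of_center hD h.2 hv) h.ne

/-- Two squares have at most one edge in common. -/
theorem BoxSquare.Glued.unique_edge (hD : ∀ i, 0 < D i) {s t : BoxSquare D} {k m k' m' : ZMod 4}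
    (h : s.Glued k t m) (h' : s.Glued k' t m') : k = k' ∧ m = m' := by
  have h1 := h.corner_eq hD h'.1
  have h2 := h.corner_eq hD h'.2
  clear h h'
  decide +revert

/-- The pair `(j, b)` is the direction in which the edge `k` is crossed within the plane of the
square. The next two lemmas treat the neighbour in the same face and the one around an edge of the
box. -/
theorem exists_outward : ∀ (i : Fin 3) (h : Bool) (k : ZMod 4), ∃ (j : Fin 3) (b : Bool), j ≠ i ∧
    boxOff i h k j = (if b then 1 else 0) ∧ boxOff i h (k + 1) j = if b then 1 else 0 := by
  decide

theorem boxOff_flat : ∀ (i : Fin 3) (h : Bool) (k : ZMod 4) (j : Fin 3) (b : Bool),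
    boxOff i h k j = (if b then 1 else 0) → boxOff i h (k + 1) j = (if b then 1 else 0) → j ≠ i →
    ∀ l, boxOff i h k l = (if l = j then if b then 1 else -1 else 0) + boxOff i h (k + 2 + 1) l ∧
      boxOff i h (k + 1) l = (if l = j then if b then 1 else -1 else 0) + boxOff i h (k + 2) l := by
  decide

theorem boxOff_bent : ∀ (i : Fin 3) (h : Bool) (k : ZMod 4) (j : Fin 3) (b : Bool),
    boxOff i h k j = (if b then 1 else 0) → boxOff i h (k + 1) j = (if b then 1 else 0) → j ≠ i →
    ∃ m, boxOff j b (m + 1) i = (if h then 1 else 0) ∧ boxOff j b m i = (if h then 1 else 0) ∧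
      ∀ l, l ≠ i → l ≠ j → boxOff i h k l = boxOff j b (m + 1) l ∧
        boxOff i h (k + 1) l = boxOff j b m l := by
  decide

/-- There is a square across each edge. -/
theorem exists_glued (hD : ∀ i, 0 < D i) (s : BoxSquare D) (k : ZMod 4) :
    ∃ t m, s.Glued k t m := by
  obtain ⟨j, b, hj, h0, h1⟩ := exists_outward s.axis s.high k
  have hmem := s.pos_mem
  have hax := s.pos_axis
  -- Either the translate by one unit still lies in the face, or the edge `k` lies on an edge of the
  -- box and the neighbour is in the face given by `(j, b)`.
  by_cases hin : 0 ≤ s.pos j + (if b then 1 else -1) ∧ s.pos j + (if b then 1 else -1) < (D j : ℤ)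
  · refine ⟨⟨s.axis, s.high, fun l => s.pos l + if l = j then if b then 1 else -1 else 0, ?_, ?_⟩,
      k + 2, ?_, ?_⟩
    · rw [if_neg hj.symm, add_zero, hax]
    · intro l hl
      by_cases hlj : l = j
      · subst hlj; simpa using hin
      · simpa [hlj] using hmem l hl
    · funext l
      have := (boxOff_flat _ _ _ _ _ h0 h1 hj l).1
      rw [corner_apply, corner_apply]
      simp only
      omega
    · funext l
      have := (boxOff_flat _ _ _ _ _ h0 h1 hj l).2
      rw [corner_apply, corner_apply]
      simp only
      omega
  · obtain ⟨m, hm1, hm0, hm⟩ := boxOff_bent _ _ _ _ _ h0 h1 hj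
    have hjm := hmem j hj
    have hpj : s.pos j + (if b then 1 else 0) = if b then (D j : ℤ) else 0 := by
      cases b <;> simp at hin ⊢ <;> omega
    have hDi := hD s.axis
    -- Along the old axis, the neighbour occupies the unit layer next to the old face, which starts
    -- at `D - 1` on a high face.
    refine ⟨⟨j, b, fun l => if l = j then (if b then (D j : ℤ) else 0) else
      if l = s.axis then (if s.high then (D s.axis : ℤ) - 1 else 0) else s.pos l, ?_, ?_⟩,
      m, ?_, ?_⟩
    · simp
    · intro l hl
      rw [if_neg hl]
      split_ifs with h2 h3
      · subst h2; omega
      · subst h2; omega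
      · exact hmem l h2
    all_goals
      funext l
      rw [corner_apply, corner_apply]
      simp only
      by_cases hlj : l = j
      · subst hlj
        first | rw [h0] | rw [h1]
        rw [hpj, if_pos rfl, boxOff_axis, add_zero]
      · by_cases hli : l = s.axis
        · subst hli
          rw [boxOff_axis, if_neg hlj, if_pos rfl, hax]
          first | rw [hm1] | rw [hm0]
          split_ifs <;> omega
        · rw [if_neg hlj, if_neg hli]
          first | rw [(hm l hli hlj).1] | rw [(hm l hli hlj).2]

/-- The square across the edge `k` of `s`, together with the number of the common edge. -/
noncomputable def glue (hD : ∀ i, 0 < D i) (f : BoxSquare D × ZMod 4) : BoxSquare D × ZMod 4 :=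
  ((exists_glued hD f.1 f.2).choose, (exists_glued hD f.1 f.2).choose_spec.choose)

theorem glue_spec (hD : ∀ i, 0 < D i) (f : BoxSquare D × ZMod 4) :
    f.1.Glued f.2 (glue hD f).1 (glue hD f).2 :=
  (exists_glued hD f.1 f.2).choose_spec.choose_spec

theorem glue_eq (hD : ∀ i, 0 < D i) {s t : BoxSquare D} {k m : ZMod 4} (h : s.Glued k t m) :
    glue hD (s, k) = (t, m) := by
  obtain ⟨h1, h2⟩ := (glue_spec hD (s, k)).unique hD h
  exact Prod.ext h1 h2

theorem glue_glue (hD : ∀ i, 0 < D i) (f : BoxSquare D × ZMod 4) : glue hD (glue hD f) = f :=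
  glue_eq hD (glue_spec hD f).symm

/-- Rotation about the corners of the squares: a pair `(s, k)` stands for the corner `k` of `s`, and
crossing the edge `k` leads to the next square around this corner. -/
noncomputable def rotate (hD : ∀ i, 0 < D i) : Equiv.Perm (BoxSquare D × ZMod 4) where
  toFun f := ((glue hD f).1, (glue hD f).2 + 1)
  invFun f := glue hD (f.1, f.2 - 1)
  left_inv f := by simp [glue_glue]
  right_inv f := by simp [glue_glue]

theorem rotate_eq (hD : ∀ i, 0 < D i) {s t : BoxSquare D} {k m : ZMod 4} (h : s.Glued k t m) :
    rotate hD (s, k) = (t, m + 1) := by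
  simp [rotate, glue_eq hD h]

theorem corner_rotate (hD : ∀ i, 0 < D i) (f : BoxSquare D × ZMod 4) :
    (rotate hD f).1.corner (rotate hD f).2 = f.1.corner f.2 :=
  (glue_spec hD f).1.symm

theorem corner_rotate_pow (hD : ∀ i, 0 < D i) (f : BoxSquare D × ZMod 4) (n : ℕ) :
    ((rotate hD ^ n) f).1.corner ((rotate hD ^ n) f).2 = f.1.corner f.2 := by
  induction n with
  | zero => rfl
  | succ n ih => rw [pow_succ', Equiv.Perm.mul_apply, corner_rotate, ih]

theorem rotate_fst_eq (hD : ∀ i, 0 < D i) (f : BoxSquare D × ZMod 4) :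
    (rotate hD f).1 = (glue hD f).1 := rfl

theorem rotate_fst_ne (hD : ∀ i, 0 < D i) (f : BoxSquare D × ZMod 4) : (rotate hD f).1 ≠ f.1 :=
  (glue_spec hD f).ne.symm

theorem rotate_ne (hD : ∀ i, 0 < D i) (f : BoxSquare D × ZMod 4) : rotate hD f ≠ f :=
  fun h => rotate_fst_ne hD f (congrArg Prod.fst h)

/-- Returning after two steps would mean that two squares share two consecutive edges, against
`unique_edge`. -/
theorem rotate_rotate_ne (hD : ∀ i, 0 < D i) (f : BoxSquare D × ZMod 4) :
    (rotate hD ^ 2) f ≠ f := by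
  intro h
  have h1 := glue_spec hD f
  have h2 := glue_spec hD (rotate hD f)
  have e1 : (glue hD (rotate hD f)).1 = f.1 := rotate_fst_eq hD (rotate hD f) |>.symm.trans (congrArg Prod.fst h)
  rw [e1] at h2
  have h3 := (h1.symm.unique_edge hD h2).1
  have h4 : (rotate hD f).2 = (glue hD f).2 + 1 := rfl
  rw [h4] at h3
  revert h3
  generalize (glue hD f).2 = m
  decide +revert

/-- The direction of the edge `k` of `s`, as a coordinate axis and a sign. -/
theorem exists_direction : ∀ (i : Fin 3) (h : Bool) (k : ZMod 4), ∃ (d : Fin 3 × Bool), d.1 ≠ i ∧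
    ∀ j, boxOff i h (k + 1) j - boxOff i h k j =
      if j = d.1 then (if d.2 then 1 else -1) else 0 := by
  decide

/-- The direction of the edge of a square that starts at a given corner. -/
noncomputable def direction (f : BoxSquare D × ZMod 4) : Fin 3 × Bool :=
  (exists_direction f.1.axis f.1.high f.2).choose

theorem direction_ne_axis (f : BoxSquare D × ZMod 4) : (direction f).1 ≠ f.1.axis :=
  (exists_direction f.1.axis f.1.high f.2).choose_spec.1

theorem corner_succ (f : BoxSquare D × ZMod 4) (j : Fin 3) :
    f.1.corner (f.2 + 1) j = f.1.corner f.2 j +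
      if j = (direction f).1 then (if (direction f).2 then 1 else -1) else 0 := by
  have : boxOff f.1.axis f.1.high (f.2 + 1) j - boxOff f.1.axis f.1.high f.2 j =
      if j = (direction f).1 then (if (direction f).2 then 1 else -1) else 0 :=
    (exists_direction f.1.axis f.1.high f.2).choose_spec.2 j
  rw [corner_apply, corner_apply]
  omega

/-- A directed edge is traversed counterclockwise by only one square, so the squares at a lattice
point are bounded in number by the directions available there. -/
theorem direction_injective (hD : ∀ i, 0 < D i) {f g : BoxSquare D × ZMod 4}
    (h0 : f.1.corner f.2 = g.1.corner g.2) (hd : direction f = direction g) : f = g := by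
  refine Prod.ext_iff.2 (eq_of_edge hD h0 ?_)
  funext j
  rw [corner_succ, corner_succ, h0, hd]

theorem corner_mem (s : BoxSquare D) (k : ZMod 4) (j : Fin 3) :
    0 ≤ s.corner k j ∧ s.corner k j ≤ D j := by
  rw [corner_apply]
  by_cases hj : j = s.axis
  · subst hj
    rw [boxOff_axis, s.pos_axis]
    split_ifs <;> omega
  · have := s.pos_mem j hj
    have := boxOff_mem s.axis s.high k j
    omega

theorem corner_axis (s : BoxSquare D) (k : ZMod 4) :
    s.corner k s.axis = if s.high then (D s.axis : ℤ) else 0 := by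
  rw [corner_apply, boxOff_axis, s.pos_axis, add_zero]

theorem direction_ne_outward (f : BoxSquare D × ZMod 4) (i : Fin 3) (b : Bool)
    (h : f.1.corner f.2 i = if b then (D i : ℤ) else 0) : direction f ≠ (i, b) := by
  intro hd
  have h1 := corner_succ f i
  have h2 := corner_mem f.1 (f.2 + 1) i
  rw [hd, h] at h1
  simp only [if_true] at h1
  cases b <;> simp at h1 <;> omega

/-- At most four squares meet at a lattice point. -/
theorem exists_directions (f : BoxSquare D × ZMod 4) : ∃ S : Finset (Fin 3 × Bool), S.card ≤ 4 ∧
    ∀ g : BoxSquare D × ZMod 4, g.1.corner g.2 = f.1.corner f.2 → direction g ∈ S := by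
  have h1 := corner_axis f.1 f.2
  set i := f.1.axis
  set b := f.1.high
  -- Two of the six directions must be excluded. On a second face, two outward normals are;
  -- otherwise all squares at the point lie in one face and both of its normal directions are.
  by_cases hex : ∃ (j : Fin 3) (c : Bool), j ≠ i ∧ f.1.corner f.2 j = if c then (D j : ℤ) else 0
  · obtain ⟨j, c, hj, hc⟩ := hex
    refine ⟨(Finset.univ.erase (i, b)).erase (j, c), ?_, fun g hg => ?_⟩
    · rw [Finset.card_erase_of_mem (by simp [hj]), Finset.card_erase_of_mem (by simp)]
      simp
    · simp only [Finset.mem_erase, Finset.mem_univ, and_true]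
      exact ⟨direction_ne_outward g j c (hg ▸ hc), direction_ne_outward g i b (hg ▸ h1)⟩
  · refine ⟨(Finset.univ.erase (i, b)).erase (i, !b), ?_, fun g hg => ?_⟩
    · rw [Finset.card_erase_of_mem (by simp), Finset.card_erase_of_mem (by simp)]
      simp
    · simp only [Finset.mem_erase, Finset.mem_univ, and_true]
      refine ⟨fun h => ?_, direction_ne_outward g i b (hg ▸ h1)⟩
      have h2 := direction_ne_axis g
      rw [h] at h2
      exact hex ⟨g.1.axis, g.1.high, Ne.symm h2, hg ▸ corner_axis g.1 g.2⟩

/-- Pigeonhole along the orbit: two of the first `S.card + 1` points have the same image, hence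
coincide, and invertibility of `ρ` moves the coincidence back to `f`. -/
theorem exists_pow_apply_eq {α β : Type*} [DecidableEq β] (ρ : Equiv.Perm α) (f : α) (φ : α → β)
    (S : Finset β) (hS : ∀ n : ℕ, φ ((ρ ^ n) f) ∈ S)
    (hφ : ∀ m n : ℕ, φ ((ρ ^ m) f) = φ ((ρ ^ n) f) → (ρ ^ m) f = (ρ ^ n) f) :
    ∃ n, 0 < n ∧ n ≤ S.card ∧ (ρ ^ n) f = f := by
  obtain ⟨a, ha, b, hb, hab, h⟩ := Finset.exists_ne_map_eq_of_card_lt_of_maps_to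
    (s := Finset.range (S.card + 1)) (t := S) (by simp) (f := fun n => φ ((ρ ^ n) f))
    (fun n _ => hS n)
  have key : ∀ a b : ℕ, a < b → b < S.card + 1 → (ρ ^ a) f = (ρ ^ b) f →
      ∃ n, 0 < n ∧ n ≤ S.card ∧ (ρ ^ n) f = f := by
    intro a b hab hb h
    refine ⟨b - a, by omega, by omega, ?_⟩
    have : b = a + (b - a) := by omega
    rw [this, pow_add, Equiv.Perm.mul_apply] at h
    exact ((ρ ^ a).injective h).symm
  rw [Finset.mem_range] at ha hb
  rcases lt_or_gt_of_ne hab with hlt | hlt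
  · exact key a b hlt hb (hφ _ _ h)
  · exact key b a hlt ha (hφ _ _ h.symm)

theorem rotate_pow_eq_of_directions (hD : ∀ i, 0 < D i) (f : BoxSquare D × ZMod 4)
    (S : Finset (Fin 3 × Bool))
    (hS : ∀ g : BoxSquare D × ZMod 4, g.1.corner g.2 = f.1.corner f.2 → direction g ∈ S) :
    ∃ n, 2 < n ∧ n ≤ S.card ∧ (rotate hD ^ n) f = f := by
  obtain ⟨n, h0, hn, h⟩ := exists_pow_apply_eq (rotate hD) f direction S
    (fun n => hS _ (corner_rotate_pow hD f n))
    (fun m n => direction_injective hD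
      ((corner_rotate_pow hD f m).trans (corner_rotate_pow hD f n).symm))
  refine ⟨n, ?_, hn, h⟩
  by_contra hlt
  interval_cases n
  · exact rotate_ne hD f h
  · exact rotate_rotate_ne hD f h

/-- Three or four squares meet at each lattice point. -/
theorem rotate_pow_eq (hD : ∀ i, 0 < D i) (f : BoxSquare D × ZMod 4) :
    (rotate hD ^ 3) f = f ∨ (rotate hD ^ 4) f = f := by
  obtain ⟨S, hS, h⟩ := exists_directions f
  obtain ⟨n, h2, hn, h⟩ := rotate_pow_eq_of_directions hD f S h
  have : n = 3 ∨ n = 4 := by omega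
  rcases this with rfl | rfl
  · exact Or.inl h
  · exact Or.inr h

/-- At a corner of the box three of the six directions point outwards, which leaves an orbit of
length at most three; lengths one and two are excluded in general. -/
theorem rotate_pow_three_of_corner (hD : ∀ i, 0 < D i) (f : BoxSquare D × ZMod 4) (c : Fin 3 → Bool)
    (hc : ∀ i, f.1.corner f.2 i = if c i then (D i : ℤ) else 0) : (rotate hD ^ 3) f = f := by
  obtain ⟨n, h2, hn, h⟩ := rotate_pow_eq_of_directions hD f
    (Finset.univ.filter fun d => d.2 ≠ c d.1) (fun g hg => by
      simp only [Finset.mem_filter, Finset.mem_univ, true_and]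
      intro h
      exact direction_ne_outward g (direction g).1 (direction g).2 (by rw [hg, hc, h]) rfl)
  have hcard : (Finset.univ.filter fun d : Fin 3 × Bool => d.2 ≠ c d.1).card = 3 := by
    clear hc h hn
    decide +revert
  have : n = 3 := by omega
  rwa [this] at h

theorem exists_boxOff : ∀ (i : Fin 3) (c : Fin 3 → Bool), ∃ k, ∀ j, j ≠ i →
    boxOff i (c i) k j = if c j then 1 else 0 := by decide

/-- At each corner of the box, there is a square in each of the three faces. -/
theorem exists_square_at_corner (hD : ∀ i, 0 < D i) (x : Fin 3 × (Fin 3 → Bool)) :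
    ∃ f : BoxSquare D × ZMod 4, f.1.axis = x.1 ∧
      ∀ i, f.1.corner f.2 i = if x.2 i then (D i : ℤ) else 0 := by
  obtain ⟨i, c⟩ := x
  obtain ⟨k, hk⟩ := exists_boxOff i c
  refine ⟨(⟨i, c i, fun j => if c j then (if j = i then (D j : ℤ) else D j - 1) else 0, by simp,
    fun j hj => ?_⟩, k), rfl, fun j => ?_⟩
  · have := hD j
    rw [if_neg hj]
    split_ifs <;> omega
  · rw [corner_apply]
    by_cases hj : j = i
    · subst hj
      rw [boxOff_axis]
      simp
    · simp only [hk j hj, if_neg hj]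
      split_ifs <;> omega

/-- There are `24` pairs of a corner of the box and a square at this corner. -/
theorem exists_injective_corner (hD : ∀ i, 0 < D i) :
    ∃ φ : Fin 3 × (Fin 3 → Bool) → BoxSquare D × ZMod 4, Function.Injective φ ∧
      ∀ x, (rotate hD ^ 3) (φ x) = φ x := by
  choose φ hφ hc using exists_square_at_corner hD
  refine ⟨φ, fun x y h => ?_, fun x => rotate_pow_three_of_corner hD _ _ (hc x)⟩
  refine Prod.ext (by rw [← hφ, ← hφ, h]) (funext fun i => ?_)
  have h1 := hc x i
  rw [h, hc y i] at h1
  have := hD i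
  cases hx : x.2 i <;> cases hy : y.2 i <;> simp [hx, hy] at h1 ⊢ <;> omega

/-- Adjacent squares with a common corner are related by a rotation about this corner. -/
theorem BoxSquare.Adj.rotate_eq_or (hD : ∀ i, 0 < D i) {s t : BoxSquare D} (h : s.Adj t)
    {i j : ZMod 4} (hv : s.corner i = t.corner j) :
    rotate hD (s, i) = (t, j) ∨ rotate hD (t, j) = (s, i) := by
  obtain ⟨k, m, hg⟩ := h
  rcases hg.corner_eq hD hv with ⟨rfl, rfl⟩ | ⟨rfl, rfl⟩
  · exact Or.inl (rotate_eq hD hg)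
  · exact Or.inr (rotate_eq hD hg.symm)

/-- The squares of a block follow each other in the rotation about its centre. -/
theorem BoxSquare.Block.exists_rotate (hD : ∀ i, 0 < D i) {s₀ s₁ s₂ s₃ : BoxSquare D}
    (h : s₀.Block s₁ s₂ s₃) : ∃ f₀ f₁ f₂ f₃ : BoxSquare D × ZMod 4,
      (f₀.1 = s₀ ∧ f₁.1 = s₁ ∧ f₂.1 = s₂ ∧ f₃.1 = s₃) ∧
      ((rotate hD f₀ = f₁ ∧ rotate hD f₁ = f₂ ∧ rotate hD f₂ = f₃ ∧ rotate hD f₃ = f₀) ∨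
        (rotate hD f₁ = f₀ ∧ rotate hD f₂ = f₁ ∧ rotate hD f₃ = f₂ ∧ rotate hD f₀ = f₃)) := by
  obtain ⟨⟨h02, h13⟩, ⟨h01, h12, h23, h30⟩, v, ⟨k0, hk0⟩, ⟨k1, hk1⟩, ⟨k2, hk2⟩, ⟨k3, hk3⟩⟩ := h
  refine ⟨(s₀, k0), (s₁, k1), (s₂, k2), (s₃, k3), ⟨rfl, rfl, rfl, rfl⟩, ?_⟩
  have e01 := h01.rotate_eq_or hD (hk0.trans hk1.symm)
  have e12 := h12.rotate_eq_or hD (hk1.trans hk2.symm)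
  have e23 := h23.rotate_eq_or hD (hk2.trans hk3.symm)
  have e30 := h30.rotate_eq_or hD (hk3.trans hk0.symm)
  have n02 : ((s₀, k0) : BoxSquare D × ZMod 4) ≠ (s₂, k2) := fun h => h02 (congrArg Prod.fst h)
  have n13 : ((s₁, k1) : BoxSquare D × ZMod 4) ≠ (s₃, k3) := fun h => h13 (congrArg Prod.fst h)
  generalize ((s₀, k0) : BoxSquare D × ZMod 4) = f0 at *
  generalize ((s₁, k1) : BoxSquare D × ZMod 4) = f1 at *
  generalize ((s₂, k2) : BoxSquare D × ZMod 4) = f2 at *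
  generalize ((s₃, k3) : BoxSquare D × ZMod 4) = f3 at *
  have inj : ∀ {x y z : BoxSquare D × ZMod 4}, rotate hD x = z → rotate hD y = z → x = y :=
    fun hx hy => (rotate hD).injective (hx.trans hy.symm)
  -- Each adjacency is a rotation in one of two senses. A change of sense between consecutive
  -- squares would identify a diagonal pair.
  rcases e01 with a | a <;> rcases e12 with b | b
  · rcases e23 with c | c
    · rcases e30 with d | d
      · exact Or.inl ⟨a, b, c, d⟩
      · exact absurd (a.symm.trans d) n13
    · exact absurd (inj b c) n13
  · exact absurd (inj a b) n02
  · exact absurd (a.symm.trans b) n02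
  · rcases e23 with c | c
    · exact absurd (b.symm.trans c) n13
    · rcases e30 with d | d
      · exact absurd (inj a d) n13
      · exact Or.inr ⟨a, b, c, d⟩

/-- The squares at a corner of the box follow each other in the rotation about it. -/
theorem BoxSquare.CornerTriple.exists_rotate (hD : ∀ i, 0 < D i) {s₀ s₁ s₂ : BoxSquare D}
    (h : s₀.CornerTriple s₁ s₂) : ∃ f₀ f₁ f₂ : BoxSquare D × ZMod 4,
      (f₀.1 = s₀ ∧ f₁.1 = s₁ ∧ f₂.1 = s₂) ∧
      ((rotate hD f₀ = f₁ ∧ rotate hD f₁ = f₂ ∧ rotate hD f₂ = f₀) ∨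
        (rotate hD f₁ = f₀ ∧ rotate hD f₂ = f₁ ∧ rotate hD f₀ = f₂)) := by
  obtain ⟨⟨h01, h12, h20⟩, v, ⟨k0, hk0⟩, ⟨k1, hk1⟩, ⟨k2, hk2⟩⟩ := h
  refine ⟨(s₀, k0), (s₁, k1), (s₂, k2), ⟨rfl, rfl, rfl⟩, ?_⟩
  have e01 := h01.rotate_eq_or hD (hk0.trans hk1.symm)
  have e12 := h12.rotate_eq_or hD (hk1.trans hk2.symm)
  have e20 := h20.rotate_eq_or hD (hk2.trans hk0.symm)
  have n01 : ((s₀, k0) : BoxSquare D × ZMod 4) ≠ (s₁, k1) := fun h => h01.ne (congrArg Prod.fst h)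
  have n12 : ((s₁, k1) : BoxSquare D × ZMod 4) ≠ (s₂, k2) := fun h => h12.ne (congrArg Prod.fst h)
  have n20 : ((s₂, k2) : BoxSquare D × ZMod 4) ≠ (s₀, k0) := fun h => h20.ne (congrArg Prod.fst h)
  generalize ((s₀, k0) : BoxSquare D × ZMod 4) = f0 at *
  generalize ((s₁, k1) : BoxSquare D × ZMod 4) = f1 at *
  generalize ((s₂, k2) : BoxSquare D × ZMod 4) = f2 at *
  have inj : ∀ {x y z : BoxSquare D × ZMod 4}, rotate hD x = z → rotate hD y = z → x = y :=
    fun hx hy => (rotate hD).injective (hx.trans hy.symm)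
  rcases e01 with a | a <;> rcases e12 with b | b
  · rcases e20 with c | c
    · exact Or.inl ⟨a, b, c⟩
    · exact absurd (a.symm.trans c) n12
  · exact absurd (inj a b).symm n20
  · exact absurd (b.symm.trans a) n20
  · rcases e20 with c | c
    · exact absurd (b.symm.trans c).symm n01
    · exact Or.inr ⟨a, b, c⟩

end Box

/-! ### Cochains on the grid -/

section Grid

/-- The difference of a function on the cells across vertical and horizontal edges, modulo two. -/
def gridD0 : (ℤ × ℤ → ZMod 2) →ₗ[ZMod 2] (ℤ × ℤ → ZMod 2) × (ℤ × ℤ → ZMod 2) where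
  toFun A := (fun p => A p + A (p + (1, 0)), fun p => A p + A (p + (0, 1)))
  map_add' A B := by
    refine Prod.ext (funext fun p => ?_) (funext fun p => ?_) <;> simp <;> ring
  map_smul' c A := by
    refine Prod.ext (funext fun p => ?_) (funext fun p => ?_) <;> simp <;> ring

/-- The sum of a cochain around the upper right corner of a cell, modulo two. -/
def gridD1 : (ℤ × ℤ → ZMod 2) × (ℤ × ℤ → ZMod 2) →ₗ[ZMod 2] (ℤ × ℤ → ZMod 2) where
  toFun c p := c.1 p + c.1 (p + (0, 1)) + c.2 p + c.2 (p + (1, 0))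
  map_add' c d := by
    funext p; simp; ring
  map_smul' r c := by
    funext p; simp; ring

/-- Extension of a function by zero. -/
def extendZero (s : Finset (ℤ × ℤ)) : (s → ZMod 2) →ₗ[ZMod 2] (ℤ × ℤ → ZMod 2) where
  toFun a p := if h : p ∈ s then a ⟨p, h⟩ else 0
  map_add' a b := by funext p; by_cases h : p ∈ s <;> simp [h]
  map_smul' c a := by funext p; by_cases h : p ∈ s <;> simp [h]

/-- Restriction of a function to a finite set. -/
def restrictTo (s : Finset (ℤ × ℤ)) : (ℤ × ℤ → ZMod 2) →ₗ[ZMod 2] (s → ZMod 2) :=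
  LinearMap.funLeft (ZMod 2) (ZMod 2) Subtype.val

theorem extendZero_of_mem {s : Finset (ℤ × ℤ)} (a : s → ZMod 2) {p : ℤ × ℤ} (h : p ∈ s) :
    extendZero s a p = a ⟨p, h⟩ := dif_pos h

theorem extendZero_of_notMem {s : Finset (ℤ × ℤ)} (a : s → ZMod 2) {p : ℤ × ℤ} (h : p ∉ s) :
    extendZero s a p = 0 := dif_neg h

theorem restrictTo_apply {s : Finset (ℤ × ℤ)} (u : ℤ × ℤ → ZMod 2) (p : s) :
    restrictTo s u p = u p := rfl

theorem extendZero_restrictTo {s : Finset (ℤ × ℤ)} {u : ℤ × ℤ → ZMod 2} (h : ∀ p, p ∉ s → u p = 0) :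
    extendZero s (restrictTo s u) = u := by
  funext p
  by_cases hp : p ∈ s
  · rw [extendZero_of_mem _ hp, restrictTo_apply]
  · rw [extendZero_of_notMem _ hp, h p hp]

theorem gridD1_gridD0 (A : ℤ × ℤ → ZMod 2) : gridD1 (gridD0 A) = 0 := by
  funext p
  have : p + (0, 1) + (1, 0) = p + (1, 0) + ((0, 1) : ℤ × ℤ) := add_right_comm _ _ _
  simp only [gridD1, gridD0, LinearMap.coe_mk, AddHom.coe_mk, this, Pi.zero_apply]
  linear_combination (A p + A (p + (1, 0)) + A (p + (0, 1)) + A (p + (1, 0) + (0, 1))) *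
    (CharTwo.two_eq_zero (R := ZMod 2))

theorem eq_of_forall_add_one_eq {α : Type*} {f : ℤ → α} (h : ∀ x, f (x + 1) = f x) (x y : ℤ) :
    f x = f y := by
  have : ∀ x, f x = f 0 := fun x => by
    induction x using Int.induction_on with
    | zero => rfl
    | succ n ih => rw [h, ih]
    | pred n ih => rw [← ih, ← h (-(n : ℤ) - 1), sub_add_cancel]
  rw [this x, this y]

/-- A closed cochain with bounded support is the coboundary of a function with bounded support. -/
theorem exists_gridD0_eq {N : ℤ} {a b : ℤ × ℤ → ZMod 2} (hc : gridD1 (a, b) = 0)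
    (ha : ∀ p, a p ≠ 0 → |p.1| ≤ N ∧ |p.2| ≤ N) (hb : ∀ p, b p ≠ 0 → |p.1| ≤ N ∧ |p.2| ≤ N) :
    ∃ A : ℤ × ℤ → ZMod 2, gridD0 A = (a, b) ∧ ∀ p, A p ≠ 0 → |p.1| ≤ N + 1 ∧ |p.2| ≤ N + 1 := by
  -- Integration of `a` along the rows; the sum may start at `-N` because `a` vanishes further to
  -- the left.
  let A : ℤ × ℤ → ZMod 2 := fun p => ∑ x ∈ Finset.Ico (-N) p.1, a (x, p.2)
  have hA : ∀ x y, A (x, y) + A (x + 1, y) = a (x, y) := by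
    intro x y
    simp only [A]
    rcases le_or_gt (-N) x with hx | hx
    · rw [← Order.succ_eq_add_one, ← Finset.insert_Ico_right_eq_Ico_succ hx, Finset.sum_insert (by simp)]
      linear_combination (∑ x ∈ Finset.Ico (-N) x, a (x, y)) * (CharTwo.two_eq_zero (R := ZMod 2))
    · rw [Finset.Ico_eq_empty (by omega), Finset.Ico_eq_empty (by omega)]
      by_contra hne
      have := (ha (x, y) (Ne.symm (by simpa using hne))).1
      rw [abs_le] at this
      simp only at this
      omega
  have hB : ∀ x y, A (x, y) + A (x, y + 1) + b (x, y) = 0 := by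
    intro x y
    -- By closedness the defect of the vertical equation does not depend on `x`, and it vanishes to
    -- the left of the support.
    rw [eq_of_forall_add_one_eq (f := fun x => A (x, y) + A (x, y + 1) + b (x, y)) ?_ x (-N - 1)]
    · have : b (-N - 1, y) = 0 := by
        by_contra hne
        have := (hb _ hne).1
        rw [abs_le] at this
        simp only at this
        omega
      simp only [A, this]
      rw [Finset.Ico_eq_empty (by omega)]
      simp
    · intro x
      have h := congrFun hc (x, y)
      simp only [gridD1, LinearMap.coe_mk, AddHom.coe_mk, Prod.mk_add_mk, add_zero,
        Pi.zero_apply] at h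
      have h1 := hA x y
      have h2 := hA x (y + 1)
      linear_combination h + h1 + h2 - (A (x, y) + A (x, y + 1) + b (x, y)) * (CharTwo.two_eq_zero (R := ZMod 2))
  refine ⟨A, ?_, ?_⟩
  · refine Prod.ext (funext fun ⟨x, y⟩ => ?_) (funext fun ⟨x, y⟩ => ?_)
    · simpa [gridD0] using hA x y
    · have := hB x y
      simp only [gridD0, LinearMap.coe_mk, AddHom.coe_mk]
      rw [CharTwo.add_eq_zero] at this
      simpa using this
  · have hout : ∀ x y, N < |y| → A (x, y) = 0 := by
      intro x y hy
      simp only [A]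
      refine Finset.sum_eq_zero fun x _ => ?_
      by_contra hne
      have := (ha _ hne).2
      simp only at this
      omega
    intro p hp
    obtain ⟨x, y⟩ := p
    simp only
    constructor
    · by_contra hx
      rcases le_or_gt x 0 with h0 | h0
      · rw [abs_of_nonpos h0] at hx
        apply hp
        simp only [A]
        rw [Finset.Ico_eq_empty (by omega)]
        simp
      · rw [abs_of_pos h0] at hx
        apply hp
        -- To the right of the support `b` vanishes, so `A` is constant on each column there, and it
        -- is zero high up.
        rw [← hout x (|N| + 1) (by rw [abs_of_nonneg (by positivity)]; have := le_abs_self N; omega)]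
        refine eq_of_forall_add_one_eq (f := fun y => A (x, y)) (fun y => ?_) _ _
        have := hB x y
        have hb0 : b (x, y) = 0 := by
          by_contra hne
          have := (hb _ hne).1
          rw [abs_of_pos h0] at this
          omega
        rw [hb0, add_zero, CharTwo.add_eq_zero] at this
        exact this.symm
    · by_contra hy
      exact hp (hout x y (by omega))

theorem sum_shift_eq {u : ℤ × ℤ → ZMod 2} {s V : Finset (ℤ × ℤ)} (hu : ∀ p, p ∉ s → u p = 0)
    (t : ℤ × ℤ) (ht : ∀ p ∈ s, p - t ∈ V) : ∑ v ∈ V, u (v + t) = ∑ p ∈ s, u p := by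
  have : ∑ p ∈ s, u p = ∑ v ∈ s.map (Equiv.subRight t).toEmbedding, u (v + t) := by
    simp [Finset.sum_map]
  rw [this]
  symm
  refine Finset.sum_subset ?_ ?_
  · intro v hv
    obtain ⟨p, hp, rfl⟩ := Finset.mem_map.1 hv
    exact ht p hp
  · intro v _ hv
    refine hu _ fun hmem => hv ?_
    exact Finset.mem_map.2 ⟨v + t, hmem, by simp⟩

/-- The union of finitely many cells has Euler characteristic at least one if its complement is
connected. -/
theorem card_edges_lt_of_complement_connected {N : ℤ} (H Ex Ey V : Finset (ℤ × ℤ))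
    (hV : V.Nonempty)
    (hEx : ∀ p, p ∈ Ex ↔ p ∈ H ∨ p + (1, 0) ∈ H) (hEy : ∀ p, p ∈ Ey ↔ p ∈ H ∨ p + (0, 1) ∈ H)
    (hN : ∀ p ∈ Ex ∪ Ey, |p.1| ≤ N ∧ |p.2| ≤ N)
    (hHV : ∀ p ∈ H, p ∈ V ∧ p - (1, 0) ∈ V ∧ p - (0, 1) ∈ V ∧ p - (1, 0) - (0, 1) ∈ V)
    (hconn : ∀ A : ℤ × ℤ → ZMod 2, (∃ M, ∀ p, A p ≠ 0 → |p.1| ≤ M ∧ |p.2| ≤ M) →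
      (∀ p, p ∉ Ex → A p = A (p + (1, 0))) → (∀ p, p ∉ Ey → A p = A (p + (0, 1))) →
      ∀ p, p ∉ H → A p = 0) :
    Ex.card + Ey.card < H.card + V.card := by
  -- The chain complex of cells, edges and vertices modulo two, with augmentation `σ`. The image of
  -- `f` lies in the kernel of `σ`, so its rank is at most `V.card - 1`; every cycle bounds, so the
  -- kernel of `f` has dimension at most `H.card`. Adding the two gives the claim.
  let f : (Ex → ZMod 2) × (Ey → ZMod 2) →ₗ[ZMod 2] (V → ZMod 2) :=
    restrictTo V ∘ₗ gridD1 ∘ₗ (extendZero Ex).prodMap (extendZero Ey)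
  let g : (H → ZMod 2) →ₗ[ZMod 2] (Ex → ZMod 2) × (Ey → ZMod 2) :=
    (restrictTo Ex).prodMap (restrictTo Ey) ∘ₗ gridD0 ∘ₗ extendZero H
  let σ : (V → ZMod 2) →ₗ[ZMod 2] ZMod 2 := ∑ v : V, LinearMap.proj v
  have hσ : ∀ u, σ u = ∑ v, u v := fun u => by simp [σ]
  have hExV : ∀ p ∈ Ex, p ∈ V ∧ p - (0, 1) ∈ V := by
    intro p hp
    rcases (hEx p).1 hp with h | h
    · exact ⟨(hHV p h).1, (hHV p h).2.2.1⟩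
    · have := hHV _ h
      rw [add_sub_cancel_right] at this
      exact ⟨this.2.1, this.2.2.2⟩
  have hEyV : ∀ p ∈ Ey, p ∈ V ∧ p - (1, 0) ∈ V := by
    intro p hp
    rcases (hEy p).1 hp with h | h
    · exact ⟨(hHV p h).1, (hHV p h).2.1⟩
    · have := hHV _ h
      rw [sub_right_comm, add_sub_cancel_right] at this
      exact ⟨this.2.2.1, this.2.2.2⟩
  -- Each edge has two endpoints in `V`, so it contributes zero modulo two.
  have hfσ : LinearMap.range f ≤ LinearMap.ker σ := by
    rintro _ ⟨⟨a, b⟩, rfl⟩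
    rw [LinearMap.mem_ker, hσ]
    have e1 := sum_shift_eq (V := V) (fun p h => extendZero_of_notMem a h) 0
      (fun p hp => by simpa using (hExV p hp).1)
    have e2 := sum_shift_eq (V := V) (fun p h => extendZero_of_notMem a h) (0, 1)
      (fun p hp => (hExV p hp).2)
    have e3 := sum_shift_eq (V := V) (fun p h => extendZero_of_notMem b h) 0
      (fun p hp => by simpa using (hEyV p hp).1)
    have e4 := sum_shift_eq (V := V) (fun p h => extendZero_of_notMem b h) (1, 0)
      (fun p hp => (hEyV p hp).2)
    simp only [add_zero] at e1 e3
    have : ∑ v : V, f (a, b) v = ∑ v ∈ V, (extendZero Ex a v + extendZero Ex a (v + (0, 1)) +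
        extendZero Ey b v + extendZero Ey b (v + (1, 0))) := by
      rw [← Finset.sum_coe_sort V]
      rfl
    rw [this, Finset.sum_add_distrib, Finset.sum_add_distrib, Finset.sum_add_distrib, e1, e2, e3, e4]
    linear_combination (∑ p ∈ Ex, extendZero Ex a p + ∑ p ∈ Ey, extendZero Ey b p) *
      (CharTwo.two_eq_zero (R := ZMod 2))
  -- A cycle, extended by zero, is the coboundary in the plane of a function with bounded support,
  -- and `hconn` makes this function vanish off `H`.
  have hker : LinearMap.ker f ≤ LinearMap.range g := by
    rintro ⟨a, b⟩ hab
    rw [LinearMap.mem_ker] at hab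
    have hclosed : gridD1 (extendZero Ex a, extendZero Ey b) = 0 := by
      funext v
      by_cases hv : v ∈ V
      · exact congrFun hab ⟨v, hv⟩
      · have h1 : v ∉ Ex := fun h => hv (hExV v h).1
        have h2 : v + (0, 1) ∉ Ex := fun h => hv (by simpa using (hExV _ h).2)
        have h3 : v ∉ Ey := fun h => hv (hEyV v h).1
        have h4 : v + (1, 0) ∉ Ey := fun h => hv (by simpa using (hEyV _ h).2)
        simp only [gridD1, LinearMap.coe_mk, AddHom.coe_mk, extendZero_of_notMem _ h1,
          extendZero_of_notMem _ h2, extendZero_of_notMem _ h3, extendZero_of_notMem _ h4]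
        rfl
    obtain ⟨A, hA, hAN⟩ := exists_gridD0_eq (N := N) hclosed
      (fun p hp => hN p (Finset.mem_union_left _
        (by by_contra h; exact hp (extendZero_of_notMem a h))))
      (fun p hp => hN p (Finset.mem_union_right _
        (by by_contra h; exact hp (extendZero_of_notMem b h))))
    have hAx : ∀ p, A p + A (p + (1, 0)) = extendZero Ex a p := fun p =>
      congrFun (congrArg Prod.fst hA) p
    have hAy : ∀ p, A p + A (p + (0, 1)) = extendZero Ey b p := fun p =>
      congrFun (congrArg Prod.snd hA) p
    have hzero : ∀ p, p ∉ H → A p = 0 := by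
      refine hconn A ⟨N + 1, hAN⟩ (fun p hp => ?_) (fun p hp => ?_)
      · have := hAx p
        rwa [extendZero_of_notMem _ hp, CharTwo.add_eq_zero] at this
      · have := hAy p
        rwa [extendZero_of_notMem _ hp, CharTwo.add_eq_zero] at this
    refine ⟨restrictTo H A, ?_⟩
    refine Prod.ext (funext fun p => ?_) (funext fun p => ?_)
    · have := hAx p
      rw [extendZero_of_mem _ p.2] at this
      simp only [g, LinearMap.comp_apply, extendZero_restrictTo hzero]
      exact this
    · have := hAy p
      rw [extendZero_of_mem _ p.2] at this
      simp only [g, LinearMap.comp_apply, extendZero_restrictTo hzero]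
      exact this
  have h1 := LinearMap.finrank_range_add_finrank_ker f
  have h2 := LinearMap.finrank_range_add_finrank_ker σ
  have h3 := Submodule.finrank_mono hfσ
  have h4 := (Submodule.finrank_mono hker).trans (LinearMap.finrank_range_le g)
  have h5 : Module.finrank (ZMod 2) (LinearMap.range σ) = 1 := by
    have : LinearMap.range σ = ⊤ := by
      rw [LinearMap.range_eq_top]
      intro c
      obtain ⟨v, hv⟩ := hV
      exact ⟨Pi.single ⟨v, hv⟩ c, by rw [hσ]; simp⟩
    rw [this, finrank_top, Module.finrank_self]
  simp only [Module.finrank_prod, Module.finrank_fintype_fun_eq_card, Fintype.card_coe] at h1 h2 h4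
  omega

/-- On a connected set of cells of Euler characteristic at least one, every closed cochain is a
coboundary. -/
theorem exists_primitive_of_card_edges_lt (P Ex Ey Q : Finset (ℤ × ℤ))
    (hEx : ∀ p, p ∈ Ex ↔ p ∈ P ∧ p + (1, 0) ∈ P) (hEy : ∀ p, p ∈ Ey ↔ p ∈ P ∧ p + (0, 1) ∈ P)
    (hQ : ∀ p, p ∈ Q ↔ p ∈ P ∧ p + (1, 0) ∈ P ∧ p + (0, 1) ∈ P ∧ p + (1, 0) + (0, 1) ∈ P)
    (hconn : ∀ A : ℤ × ℤ → ZMod 2, (∀ p ∈ Ex, A p = A (p + (1, 0))) →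
      (∀ p ∈ Ey, A p = A (p + (0, 1))) → ∀ p ∈ P, ∀ q ∈ P, A p = A q)
    (hcard : Ex.card + Ey.card < P.card + Q.card)
    (a b : ℤ × ℤ → ZMod 2) (hab : ∀ p ∈ Q, gridD1 (a, b) p = 0) :
    ∃ A : ℤ × ℤ → ZMod 2, (∀ p ∈ Ex, A p + A (p + (1, 0)) = a p) ∧
      ∀ p ∈ Ey, A p + A (p + (0, 1)) = b p := by
  -- The dual complex: cells, adjacencies, blocks. Surjectivity of `f` gives its kernel dimension
  -- `Ex.card + Ey.card - Q.card`; connectedness gives `g` rank at least `P.card - 1`, which by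
  -- `hcard` is no smaller. Hence the inclusion of the range of `g` in the kernel of `f` is an
  -- equality.
  let f : (Ex → ZMod 2) × (Ey → ZMod 2) →ₗ[ZMod 2] (Q → ZMod 2) :=
    restrictTo Q ∘ₗ gridD1 ∘ₗ (extendZero Ex).prodMap (extendZero Ey)
  let g : (P → ZMod 2) →ₗ[ZMod 2] (Ex → ZMod 2) × (Ey → ZMod 2) :=
    (restrictTo Ex).prodMap (restrictTo Ey) ∘ₗ gridD0 ∘ₗ extendZero P
  have hQE : ∀ p ∈ Q, p ∈ Ex ∧ p + (0, 1) ∈ Ex ∧ p ∈ Ey ∧ p + (1, 0) ∈ Ey := by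
    intro p hp
    obtain ⟨h1, h2, h3, h4⟩ := (hQ p).1 hp
    rw [hEx, hEx, hEy, hEy]
    exact ⟨⟨h1, h2⟩, ⟨h3, by rwa [add_right_comm]⟩, ⟨h1, h3⟩, ⟨h2, h4⟩⟩
  have hf : ∀ u v, ∀ p : Q, f (restrictTo Ex u, restrictTo Ey v) p = gridD1 (u, v) p := by
    intro u v p
    obtain ⟨h1, h2, h3, h4⟩ := hQE p p.2
    simp only [f, gridD1, LinearMap.comp_apply, LinearMap.prodMap_apply, restrictTo_apply,
      LinearMap.coe_mk, AddHom.coe_mk, extendZero_of_mem _ h1, extendZero_of_mem _ h2,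
      extendZero_of_mem _ h3, extendZero_of_mem _ h4]
  have hfsurj : LinearMap.range f = ⊤ := by
    rw [LinearMap.range_eq_top]
    intro c
    -- Sums of `c` over the part of a column strictly below `p`: the difference of `u` between `p`
    -- and the cell above is `c p`, so the second component can be zero.
    let u : ℤ × ℤ → ZMod 2 := fun p => ∑ q ∈ Q.filter (fun q => q.1 = p.1 ∧ q.2 < p.2),
      extendZero Q c q
    refine ⟨(restrictTo Ex u, restrictTo Ey 0), funext fun p => ?_⟩
    rw [hf]
    obtain ⟨⟨x, y⟩, hp⟩ := p
    have hins : Q.filter (fun q => q.1 = x ∧ q.2 < y + 1) =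
        insert (x, y) (Q.filter (fun q => q.1 = x ∧ q.2 < y)) := by
      ext ⟨q1, q2⟩
      simp only [Finset.mem_filter, Finset.mem_insert, Prod.mk.injEq]
      constructor
      · rintro ⟨h1, h2, h3⟩
        by_cases h : q2 = y
        · exact Or.inl ⟨h2, h⟩
        · exact Or.inr ⟨h1, h2, by omega⟩
      · rintro (⟨rfl, rfl⟩ | ⟨h1, h2, h3⟩)
        · exact ⟨hp, rfl, by omega⟩
        · exact ⟨h1, h2, by omega⟩
    simp only [gridD1, LinearMap.coe_mk, AddHom.coe_mk, Pi.zero_apply, add_zero, u,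
      Prod.mk_add_mk, hins]
    rw [Finset.sum_insert (by simp), extendZero_of_mem _ hp]
    linear_combination (∑ q ∈ Q with q.1 = x ∧ q.2 < y, extendZero Q c q) *
      (CharTwo.two_eq_zero (R := ZMod 2))
  have hgf : LinearMap.range g ≤ LinearMap.ker f := by
    rintro _ ⟨u, rfl⟩
    rw [LinearMap.mem_ker]
    funext p
    have : g u = (restrictTo Ex (gridD0 (extendZero P u)).1,
      restrictTo Ey (gridD0 (extendZero P u)).2) := rfl
    rw [this, hf, Prod.mk.eta, gridD1_gridD0]
    rfl
  have hkg : Module.finrank (ZMod 2) (LinearMap.ker g) ≤ 1 := by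
    refine finrank_le_one_iff.2 ?_
    by_cases hne : ∃ u : LinearMap.ker g, u ≠ 0
    · obtain ⟨u, hu⟩ := hne
      have hconst : ∀ w : LinearMap.ker g, ∀ p q : P, (w : P → ZMod 2) p = (w : P → ZMod 2) q := by
        intro w p q
        have hw : g w = 0 := w.2
        have := hconn (extendZero P w) (fun p hp => by
          have := congrFun (congrArg Prod.fst hw) ⟨p, hp⟩
          exact CharTwo.add_eq_zero.1 this) (fun p hp => by
          have := congrFun (congrArg Prod.snd hw) ⟨p, hp⟩
          exact CharTwo.add_eq_zero.1 this) p p.2 q q.2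
        rwa [extendZero_of_mem _ p.2, extendZero_of_mem _ q.2] at this
      have : ∃ p, (u : P → ZMod 2) p ≠ 0 := by
        by_contra h
        push Not at h
        exact hu (Subtype.ext (funext h))
      obtain ⟨p, hp⟩ := this
      have hp1 : (u : P → ZMod 2) p = 1 := by
        revert hp
        generalize (u : P → ZMod 2) p = x
        decide +revert
      refine ⟨u, fun w => ⟨(w : P → ZMod 2) p, Subtype.ext (funext fun q => ?_)⟩⟩
      change (w : P → ZMod 2) p * (u : P → ZMod 2) q = (w : P → ZMod 2) q
      rw [hconst u q p, hp1, mul_one, hconst w p q]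
    · push Not at hne
      exact ⟨0, fun w => ⟨0, by rw [hne w]; simp⟩⟩
  have h1 := LinearMap.finrank_range_add_finrank_ker f
  have h2 := LinearMap.finrank_range_add_finrank_ker g
  rw [hfsurj, finrank_top] at h1
  simp only [Module.finrank_prod, Module.finrank_fintype_fun_eq_card, Fintype.card_coe] at h1 h2
  have heq : LinearMap.range g = LinearMap.ker f :=
    Submodule.eq_of_le_of_finrank_le hgf (by omega)
  have hmem : ((restrictTo Ex a, restrictTo Ey b) : (Ex → ZMod 2) × (Ey → ZMod 2)) ∈
      LinearMap.ker f := by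
    rw [LinearMap.mem_ker]
    funext p
    rw [hf, hab p p.2]
    rfl
  rw [← heq] at hmem
  obtain ⟨u, hu⟩ := hmem
  refine ⟨extendZero P u, fun p hp => ?_, fun p hp => ?_⟩
  · exact congrFun (congrArg Prod.fst hu) ⟨p, hp⟩
  · exact congrFun (congrArg Prod.snd hu) ⟨p, hp⟩

end Grid

/-! ### Corners of cells in the plane -/

/-- The direction from a cell to its neighbour across the edge `k`. -/
def dir (k : ZMod 4) : ℤ × ℤ :=
  if k = 0 then (0, 1) else if k = 1 then (-1, 0) else if k = 2 then (0, -1) else (1, 0)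

theorem dir_zero : dir 0 = (0, 1) := rfl
theorem dir_two : dir 2 = (0, -1) := rfl
theorem dir_three : dir 3 = (1, 0) := rfl

theorem dir_add_two : ∀ k, dir (k + 2) = -dir k := by decide

theorem dir_ne_zero : ∀ k, dir k ≠ 0 := by decide

theorem add_dir_add_dir (p : ℤ × ℤ) (k : ZMod 4) : p + dir k + dir (k + 2) = p := by
  rw [dir_add_two, add_neg_cancel_right]

theorem zmod_two_ne_zero {x : ZMod 2} : x ≠ 0 ↔ x = 1 := by
  decide +revert

theorem zmod_four_cases (k : ZMod 4) : k = 0 ∨ k = 1 ∨ k = 2 ∨ k = 3 := by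
  decide +revert

theorem card_eq_sum_four (U : Finset ((ℤ × ℤ) × ZMod 4)) :
    U.card = (U.filter fun f => f.2 = 0).card + (U.filter fun f => f.2 = 1).card +
      (U.filter fun f => f.2 = 2).card + (U.filter fun f => f.2 = 3).card := by
  rw [Finset.card_eq_sum_card_fiberwise (f := Prod.snd) (t := Finset.univ) (by simp)]
  exact Fin.sum_univ_four _

theorem card_filter_snd_eq (U : Finset ((ℤ × ℤ) × ZMod 4)) (k : ZMod 4) (t : ℤ × ℤ)
    (B : Finset (ℤ × ℤ)) (h : ∀ p, (p + t, k) ∈ U ↔ p ∈ B) :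
    (U.filter fun f => f.2 = k).card = B.card := by
  symm
  refine Finset.card_bij (fun p _ => (p + t, k)) (fun p hp => by simpa [h] using hp)
    (fun p _ q _ h => by simpa using h) ?_
  rintro ⟨p, j⟩ hp
  obtain ⟨hp, rfl⟩ := Finset.mem_filter.1 hp
  exact ⟨p - t, (h _).1 (by simpa using hp), by simp⟩

theorem eq_zero_of_constant_upwards {A : ℤ × ℤ → ZMod 2} {M : ℤ}
    (hM : ∀ p, A p ≠ 0 → |p.1| ≤ M ∧ |p.2| ≤ M) (p : ℤ × ℤ)
    (h : ∀ n : ℕ, A (p + (0, (n : ℤ))) = A p) : A p = 0 := by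
  by_contra hne
  have := (hM (p + (0, ((|M| + |p.2| + 1).toNat : ℤ))) (by rwa [h])).2
  simp only [Prod.snd_add] at this
  rw [Int.toNat_of_nonneg (by positivity), abs_le] at this
  have := le_abs_self M
  have := neg_abs_le p.2
  omega

theorem add_zero_cast_succ (p : ℤ × ℤ) (n : ℕ) :
    p + (0, ((n + 1 : ℕ) : ℤ)) = p + (0, (n : ℤ)) + dir 0 := by
  rw [add_assoc, dir_zero]
  simp

/-- Functions on `P` that agree on adjacent cells are constant. -/
def ConnectedCells (P : Finset (ℤ × ℤ)) : Prop :=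
  ∀ A : ℤ × ℤ → ZMod 2, (∀ p k, p ∈ P → p + dir k ∈ P → A p = A (p + dir k)) →
    ∀ p ∈ P, ∀ q ∈ P, A p = A q

/-- The indicator function of a set of corners of cells, modulo two. -/
def cornerIndicator (S : Finset ((ℤ × ℤ) × ZMod 4)) (p : ℤ × ℤ) (k : ZMod 4) : ZMod 2 :=
  if (p, k) ∈ S then 1 else 0

theorem cornerIndicator_eq_one {S : Finset ((ℤ × ℤ) × ZMod 4)} {p : ℤ × ℤ} {k : ZMod 4} :
    cornerIndicator S p k = 1 ↔ (p, k) ∈ S := by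
  simp [cornerIndicator]

/-- Let `S` be a set of corners of cells of `P` that consists of all corners along some components
of the boundary of `P`, other than the outer one. These components bound a set of cells in the
complement of `P`. -/
theorem exists_filling {P : Finset (ℤ × ℤ)} (hconn : ConnectedCells P)
    (S : Finset ((ℤ × ℤ) × ZMod 4)) (hSP : ∀ f ∈ S, f.1 ∈ P)
    (hin : ∀ p k, p ∈ P → p + dir k ∈ P → ((p, k) ∈ S ↔ (p + dir k, k + 3) ∈ S))
    (hcut : ∀ p k, p ∈ P → p + dir k ∉ P → ((p, k) ∈ S ↔ (p, k + 1) ∈ S))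
    {p₀ : ℤ × ℤ} (hp₀ : p₀ ∈ P) (htop : ∀ n : ℕ, p₀ + (0, ((n + 1 : ℕ) : ℤ)) ∉ P)
    (h₀ : (p₀, (0 : ZMod 4)) ∉ S) :
    ∃ A : ℤ × ℤ → ZMod 2, (∃ N, ∀ p, A p ≠ 0 → |p.1| ≤ N ∧ |p.2| ≤ N) ∧ (∀ p ∈ P, A p = 0) ∧
      (∀ p k, A p + A (p + dir k) = cornerIndicator S p k + cornerIndicator S (p + dir k) (k + 3)) ∧
      ∀ n : ℕ, A (p₀ + (0, (n : ℤ))) = 0 := by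
  set ind := cornerIndicator S
  have ind_out : ∀ p k, p ∉ P → ind p k = 0 := fun p k hp => if_neg fun h => hp (hSP _ h)
  have ind_in : ∀ p k, p ∈ P → p + dir k ∈ P → ind p k = ind (p + dir k) (k + 3) :=
    fun p k h1 h2 => if_congr (hin p k h1 h2) rfl rfl
  have ind_cut : ∀ p k, p ∈ P → p + dir k ∉ P → ind p k = ind p (k + 1) :=
    fun p k h1 h2 => if_congr (hcut p k h1 h2) rfl rfl
  -- The jump of the indicator across an edge is the same at both endpoints: it is zero on interior
  -- edges by `hin`, and the indicator is constant along cut edges by `hcut`. Hence the jump is a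
  -- closed cochain.
  have cons : ∀ p k, ind p k + ind (p + dir k) (k + 3) =
      ind p (k + 1) + ind (p + dir k) (k + 2) := by
    intro p k
    have h5 : ∀ k : ZMod 4, k + 2 + 3 = k + 1 := by decide
    have h6 : ∀ k : ZMod 4, k + 2 + 1 = k + 3 := by decide
    by_cases h1 : p ∈ P <;> by_cases h2 : p + dir k ∈ P
    · have h3 := ind_in _ (k + 2) h2 (by rwa [add_dir_add_dir])
      rw [add_dir_add_dir, h5] at h3
      rw [ind_in p k h1 h2, h3, CharTwo.add_self_eq_zero, CharTwo.add_self_eq_zero]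
    · rw [ind_cut p k h1 h2, ind_out _ _ h2, ind_out _ _ h2]
    · have h3 := ind_cut _ (k + 2) h2 (by rwa [add_dir_add_dir])
      rw [h6] at h3
      rw [ind_out _ _ h1, ind_out _ _ h1, h3]
    · rw [ind_out _ _ h1, ind_out _ _ h1, ind_out _ _ h2, ind_out _ _ h2]
  have hind₀ : ind p₀ 0 = 0 := if_neg h₀
  let a : ℤ × ℤ → ZMod 2 := fun p => ind p 3 + ind (p + dir 3) 2
  let b : ℤ × ℤ → ZMod 2 := fun p => ind p 0 + ind (p + dir 0) 3
  have ha : ∀ p, a p = ind p 0 + ind (p + dir 3) 1 := fun p => cons p 3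
  have hb : ∀ p, b p = ind p 1 + ind (p + dir 0) 2 := fun p => cons p 0
  have hclosed : gridD1 (a, b) = 0 := by
    funext p
    change a p + a (p + dir 0) + b p + b (p + dir 3) = 0
    rw [ha p, hb (p + dir 3), add_right_comm p (dir 3) (dir 0)]
    simp only [a, b]
    linear_combination (ind p 0 + ind (p + dir 3) 1 + ind (p + dir 0) 3 +
      ind (p + dir 0 + dir 3) 2) * (CharTwo.two_eq_zero (R := ZMod 2))
  have hbound : ∃ N : ℤ, ∀ p ∈ P, |p.1| + 1 ≤ N ∧ |p.2| + 1 ≤ N := by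
    refine ⟨∑ q ∈ P, (|q.1| + |q.2| + 1), fun p hp => ?_⟩
    have := Finset.single_le_sum (f := fun q : ℤ × ℤ => |q.1| + |q.2| + 1)
      (fun q _ => by positivity) hp
    have h1 := abs_nonneg p.1
    have h2 := abs_nonneg p.2
    constructor <;> linarith
  obtain ⟨N, hN⟩ := hbound
  have hbnd : ∀ p k k' j, ind p k + ind (p + dir j) k' ≠ 0 → (j = 0 ∨ j = 3) →
      |p.1| ≤ N ∧ |p.2| ≤ N := by
    intro p k k' j h hj
    by_cases h1 : p ∈ P
    · have := hN p h1
      constructor <;> linarith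
    · by_cases h2 : p + dir j ∈ P
      · have := hN _ h2
        rcases hj with rfl | rfl <;>
          simp only [dir_zero, dir_three, Prod.fst_add, Prod.snd_add] at this
        all_goals
          obtain ⟨h3, h4⟩ := this
          rw [← le_sub_iff_add_le, abs_le] at h3 h4
          rw [abs_le, abs_le]
          omega
      · rw [ind_out _ _ h1, ind_out _ _ h2] at h
        exact absurd (add_zero 0) h
  obtain ⟨A, hA, hAN⟩ := exists_gridD0_eq (N := N) hclosed
    (fun p hp => hbnd p _ _ 3 hp (Or.inr rfl)) (fun p hp => hbnd p _ _ 0 hp (Or.inl rfl))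
  have hAx : ∀ p, A p + A (p + dir 3) = ind p 3 + ind (p + dir 3) 2 := fun p =>
    congrFun (congrArg Prod.fst hA) p
  have hAy : ∀ p, A p + A (p + dir 0) = ind p 0 + ind (p + dir 0) 3 := fun p =>
    congrFun (congrArg Prod.snd hA) p
  have hAk : ∀ p k, A p + A (p + dir k) = ind p k + ind (p + dir k) (k + 3) := by
    intro p k
    have e3 : (1 : ZMod 4) + 2 = 3 := rfl
    have e0 : (2 : ZMod 4) + 2 = 0 := rfl
    rcases zmod_four_cases k with rfl | rfl | rfl | rfl
    · exact hAy p
    · have h := hAx (p + dir 1)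
      rw [← e3, add_dir_add_dir, e3] at h
      rw [cons, add_comm, h, add_comm]
      rfl
    · have h := hAy (p + dir 2)
      rw [← e0, add_dir_add_dir, e0] at h
      rw [cons, add_comm, h, add_comm]
      rfl
    · exact hAx p
  have hAout : ∀ p k, p ∉ P → p + dir k ∉ P → A p = A (p + dir k) := by
    intro p k h1 h2
    have := hAk p k
    rwa [ind_out _ _ h1, ind_out _ _ h2, add_zero, CharTwo.add_eq_zero] at this
  have hAin : ∀ p k, p ∈ P → p + dir k ∈ P → A p = A (p + dir k) := by
    intro p k h1 h2
    have := hAk p k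
    rwa [ind_in p k h1 h2, CharTwo.add_self_eq_zero, CharTwo.add_eq_zero] at this
  -- The ray above `p₀` meets no further cell of `P` and crosses no edge with a nonzero jump, so `A`
  -- is constant on it.
  have hAtop : ∀ n : ℕ, A (p₀ + (0, (n : ℤ))) = A p₀ := by
    intro n
    induction n with
    | zero => rw [Nat.cast_zero, Prod.mk_zero_zero, add_zero]
    | succ n ih =>
      rw [← ih]
      have h1 := htop n
      rw [add_zero_cast_succ] at h1 ⊢
      cases n with
      | zero =>
        have := hAk p₀ 0
        simp only [Nat.cast_zero, Prod.mk_zero_zero, add_zero] at h1 ⊢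
        rw [ind_out _ _ h1, add_zero, hind₀, CharTwo.add_eq_zero] at this
        exact this.symm
      | succ n => exact (hAout _ _ (htop n) h1).symm
  have hAP : ∀ p ∈ P, A p = 0 := fun p hp =>
    (hconn A hAin p hp p₀ hp₀).trans (eq_zero_of_constant_upwards hAN p₀ hAtop)
  exact ⟨A, ⟨N + 1, hAN⟩, hAP, hAk, fun n => (hAtop n).trans (hAP p₀ hp₀)⟩

/-- Let `S` be a set of corners of cells of `P` that consists of all corners along some components
of the boundary of `P`, other than the outer one. The turning number of these components is at least
one. -/
theorem card_cut_le {P : Finset (ℤ × ℤ)} (hconn : ConnectedCells P)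
    (S : Finset ((ℤ × ℤ) × ZMod 4)) (hSP : ∀ f ∈ S, f.1 ∈ P)
    (hin : ∀ p k, p ∈ P → p + dir k ∈ P → ((p, k) ∈ S ↔ (p + dir k, k + 3) ∈ S))
    (hcut : ∀ p k, p ∈ P → p + dir k ∉ P → ((p, k) ∈ S ↔ (p, k + 1) ∈ S))
    {p₀ : ℤ × ℤ} (hp₀ : p₀ ∈ P) (htop : ∀ n : ℕ, p₀ + (0, ((n + 1 : ℕ) : ℤ)) ∉ P)
    (h₀ : (p₀, (0 : ZMod 4)) ∉ S) (hne : ∃ f ∈ S, f.1 + dir f.2 ∉ P) :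
    2 * (S.filter fun f => f.1 + dir f.2 ∉ P).card + 4 ≤ S.card := by
  obtain ⟨A, ⟨N, hAN⟩, hAP, hAk, hAtop⟩ := exists_filling hconn S hSP hin hcut hp₀ htop h₀
  set ind := cornerIndicator S
  have ind_out : ∀ p k, p ∉ P → ind p k = 0 := fun p k hp => if_neg fun h => hp (hSP _ h)
  have hAout : ∀ p k, p ∉ P → p + dir k ∉ P → A p = A (p + dir k) := by
    intro p k h1 h2
    have := hAk p k
    rwa [ind_out _ _ h1, ind_out _ _ h2, add_zero, CharTwo.add_eq_zero] at this
  have hAcut : ∀ p k, p ∈ P → p + dir k ∉ P → A (p + dir k) = ind p k := by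
    intro p k h1 h2
    have := hAk p k
    rwa [hAP p h1, zero_add, ind_out _ _ h2, add_zero] at this
  -- The cells of the complement of `P` that are enclosed by the boundary components in `S`.
  let H : Finset (ℤ × ℤ) := (Finset.Icc (-N) N ×ˢ Finset.Icc (-N) N).filter fun p => A p = 1
  have hH : ∀ p, p ∈ H ↔ A p = 1 := by
    intro p
    simp only [H, Finset.mem_filter, Finset.mem_product, Finset.mem_Icc, ← abs_le,
      and_iff_right_iff_imp]
    exact fun h => hAN p (by rw [h]; exact one_ne_zero)
  have hHP : ∀ p, p ∈ H → p ∉ P := fun p hp h => by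
    rw [hH, hAP p h] at hp
    exact zero_ne_one hp
  have hnH : ∀ p, p ∉ H ↔ A p = 0 := fun p => by
    rw [hH, ← zmod_two_ne_zero, not_not]
  -- the corners of the cells of `H`, together with the elements of `S`
  let U : Finset ((ℤ × ℤ) × ZMod 4) := (H ×ˢ Finset.univ) ∪ S
  have hU : ∀ p k, (p, k) ∈ U ↔ A p + ind p k = 1 := by
    intro p k
    simp only [U, Finset.mem_union, Finset.mem_product, Finset.mem_univ, and_true]
    by_cases hp : p ∈ P
    · rw [hAP p hp, zero_add, cornerIndicator_eq_one]
      exact or_iff_right fun h => hHP p h hp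
    · rw [ind_out p k hp, add_zero, hH]
      exact or_iff_left fun h => hp (hSP _ h)
  have hUrot : ∀ p k, (p, k) ∈ U ↔ (p + dir k, k + 3) ∈ U := by
    intro p k
    have h : A p + ind p k = A (p + dir k) + ind (p + dir k) (k + 3) := by
      linear_combination hAk p k - (A (p + dir k) - ind p k) * (CharTwo.two_eq_zero (R := ZMod 2))
    rw [hU, hU, h]
  have hUcard : U.card = H.card * 4 + S.card := by
    rw [Finset.card_union_of_disjoint, Finset.card_product]
    · rfl
    · rw [Finset.disjoint_left]
      rintro ⟨p, k⟩ h1 h2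
      exact hHP p (Finset.mem_product.1 h1).1 (hSP _ h2)
  let V : Finset (ℤ × ℤ) := (U.filter fun f => f.2 = 0).image Prod.fst
  have hV : ∀ v, (v, 0) ∈ U ↔ v ∈ V := fun v => by simp [V]
  have hV3 : ∀ v, (v + dir 0, 3) ∈ U ↔ v ∈ V := fun v => (hUrot v 0).symm.trans (hV v)
  have hV2 : ∀ v, (v + (dir 0 + dir 3), 2) ∈ U ↔ v ∈ V := fun v => by
    rw [← add_assoc]
    exact (hUrot _ 3).symm.trans (hV3 v)
  have hV1 : ∀ v, (v + (dir 0 + dir 3 + dir 2), 1) ∈ U ↔ v ∈ V := fun v => by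
    rw [← add_assoc]
    exact (hUrot _ 2).symm.trans (hV2 v)
  have hUV : U.card = 4 * V.card := by
    rw [card_eq_sum_four, card_filter_snd_eq U 0 0 V (by simpa using hV),
      card_filter_snd_eq U 1 _ V hV1, card_filter_snd_eq U 2 _ V hV2, card_filter_snd_eq U 3 _ V hV3]
    ring
  -- the sides of the edges of the cells of `H`
  let C := S.filter fun f => f.1 + dir f.2 ∉ P
  let B : Finset ((ℤ × ℤ) × ZMod 4) := (H ×ˢ Finset.univ) ∪ C
  have hB : ∀ p k, (p, k) ∈ B ↔ p ∈ H ∨ p + dir k ∈ H := by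
    intro p k
    simp only [B, C, Finset.mem_union, Finset.mem_product, Finset.mem_univ, and_true,
      Finset.mem_filter]
    by_cases hpH : p ∈ H
    · simp [hpH]
    · simp only [hpH, false_or]
      constructor
      · rintro ⟨h1, h2⟩
        rw [hH, hAcut p k (hSP _ h1) h2, cornerIndicator_eq_one]
        exact h1
      · intro h
        have hq := hHP _ h
        have hp : p ∈ P := by
          by_contra hp
          rw [hH, ← hAout p k hp hq, ← hH] at h
          exact hpH h
        rw [hH, hAcut p k hp hq, cornerIndicator_eq_one] at h
        exact ⟨h, hq⟩
  have hBcard : B.card = H.card * 4 + C.card := by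
    rw [Finset.card_union_of_disjoint, Finset.card_product]
    · rfl
    · rw [Finset.disjoint_left]
      rintro ⟨p, k⟩ h1 h2
      exact hHP p (Finset.mem_product.1 h1).1 (hSP _ (Finset.mem_filter.1 h2).1)
  let Ex : Finset (ℤ × ℤ) := (B.filter fun f => f.2 = 3).image Prod.fst
  let Ey : Finset (ℤ × ℤ) := (B.filter fun f => f.2 = 0).image Prod.fst
  have hEx : ∀ p, (p, 3) ∈ B ↔ p ∈ Ex := fun p => by simp [Ex]
  have hEy : ∀ p, (p, 0) ∈ B ↔ p ∈ Ey := fun p => by simp [Ey]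
  have hBflip : ∀ p k, (p, k) ∈ B ↔ (p + dir k, k + 2) ∈ B := fun p k => by
    rw [hB, hB, add_dir_add_dir, or_comm]
  have hBE : B.card = 2 * (Ex.card + Ey.card) := by
    rw [card_eq_sum_four, card_filter_snd_eq B 0 0 Ey (by simpa using hEy),
      card_filter_snd_eq B 3 0 Ex (by simpa using hEx),
      card_filter_snd_eq B 1 (dir 3) Ex (fun p => (hBflip p 3).symm.trans (hEx p)),
      card_filter_snd_eq B 2 (dir 0) Ey (fun p => (hBflip p 0).symm.trans (hEy p))]
    ring
  have hEx' : ∀ p, p ∈ Ex ↔ p ∈ H ∨ p + (1, 0) ∈ H := fun p => (hEx p).symm.trans (hB p 3)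
  have hEy' : ∀ p, p ∈ Ey ↔ p ∈ H ∨ p + (0, 1) ∈ H := fun p => (hEy p).symm.trans (hB p 0)
  have hVH : ∀ p ∈ H, ∀ k, (p, k) ∈ U := fun p hp k =>
    Finset.mem_union_left _ (by simpa using hp)
  have hlt : Ex.card + Ey.card < H.card + V.card := by
    refine card_edges_lt_of_complement_connected (N := N + 1) H Ex Ey V ?_ hEx' hEy' ?_ ?_ ?_
    · obtain ⟨⟨p, k⟩, hf, hfk⟩ := hne
      have hmem : (p, k) ∈ U := Finset.mem_union_right _ hf
      have : 0 < U.card := Finset.card_pos.2 ⟨_, hmem⟩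
      exact Finset.card_pos.1 (by omega)
    · have hHN : ∀ q ∈ H, |q.1| ≤ N ∧ |q.2| ≤ N := fun q hq => hAN q (by
        rw [hH] at hq
        rw [hq]
        exact one_ne_zero)
      have hcl : ∀ p q : ℤ × ℤ, q ∈ H → |q.1 - p.1| ≤ 1 → |q.2 - p.2| ≤ 1 →
          |p.1| ≤ N + 1 ∧ |p.2| ≤ N + 1 := by
        intro p q hq h1 h2
        have := hHN q hq
        simp only [abs_le] at *
        omega
      intro p hp
      rw [Finset.mem_union, hEx', hEy'] at hp
      rcases hp with (h | h) | (h | h) <;> exact hcl p _ h (by simp) (by simp)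
    · intro p hp
      refine ⟨(hV p).1 (hVH p hp 0), (hV1 _).1 ?_, (hV3 _).1 ?_, (hV2 _).1 ?_⟩
      · have : p - (1, 0) + (dir 0 + dir 3 + dir 2) = p := by
          rw [dir_zero, dir_two, dir_three]; ext <;> simp
        rw [this]
        exact hVH p hp 1
      · have : p - (0, 1) + dir 0 = p := by rw [dir_zero, sub_add_cancel]
        rw [this]
        exact hVH p hp 3
      · have : p - (1, 0) - (0, 1) + (dir 0 + dir 3) = p := by
          rw [dir_zero, dir_three]; ext <;> simp
        rw [this]
        exact hVH p hp 2
    · rintro A' ⟨M, hM⟩ hAx hAy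
      have hstep : ∀ p k, p ∉ H → p + dir k ∉ H → A' p = A' (p + dir k) := by
        have h3 : ∀ p, p ∉ H → p + dir 3 ∉ H → A' p = A' (p + dir 3) := fun p h1 h2 =>
          hAx p fun h => by rcases (hEx' p).1 h with h | h <;> contradiction
        have h0 : ∀ p, p ∉ H → p + dir 0 ∉ H → A' p = A' (p + dir 0) := fun p h1 h2 =>
          hAy p fun h => by rcases (hEy' p).1 h with h | h <;> contradiction
        intro p k h1 h2
        rcases zmod_four_cases k with rfl | rfl | rfl | rfl
        · exact h0 p h1 h2
        · have h := h3 _ h2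
          rw [show (3 : ZMod 4) = 1 + 2 from rfl, add_dir_add_dir] at h
          exact (h h1).symm
        · have h := h0 _ h2
          rw [show (0 : ZMod 4) = 2 + 2 from rfl, add_dir_add_dir] at h
          exact (h h1).symm
        · exact h3 p h1 h2
      have hPH : ∀ p ∈ P, p ∉ H := fun p hp h => hHP p h hp
      have htop0 : A' p₀ = 0 := by
        refine eq_zero_of_constant_upwards hM p₀ fun n => ?_
        induction n with
        | zero => rw [Nat.cast_zero, Prod.mk_zero_zero, add_zero]
        | succ n ih =>
          rw [← ih, add_zero_cast_succ]
          refine (hstep _ 0 ((hnH _).2 (hAtop n)) ?_).symm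
          rw [← add_zero_cast_succ]
          exact (hnH _).2 (hAtop _)
      have hzP : ∀ p ∈ P, A' p = 0 := fun p hp =>
        (hconn A' (fun p k h1 h2 => hstep p k (hPH _ h1) (hPH _ h2)) p hp p₀ hp₀).trans htop0
      intro p hp
      -- Going upwards from a cell outside `P` and `H`, a cell of `H` cannot come next, since `A` is
      -- constant off `P`. Entering `P` would force the value zero; otherwise the ray goes on to
      -- infinity.
      by_contra hne
      have hup : ∀ n : ℕ, p + (0, (n : ℤ)) ∉ P ∧ p + (0, (n : ℤ)) ∉ H ∧
          A' (p + (0, (n : ℤ))) = A' p := by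
        intro n
        induction n with
        | zero =>
          rw [Nat.cast_zero, Prod.mk_zero_zero, add_zero]
          exact ⟨fun h => hne (hzP p h), hp, rfl⟩
        | succ n ih =>
          rw [add_zero_cast_succ]
          obtain ⟨h1, h2, h3⟩ := ih
          have h4 : p + (0, (n : ℤ)) + dir 0 ∉ H := by
            by_cases h : p + (0, (n : ℤ)) + dir 0 ∈ P
            · exact hPH _ h
            · rw [hnH, ← hAout _ 0 h1 h]
              exact (hnH _).1 h2
          have h5 := (hstep _ 0 h2 h4).symm.trans h3
          exact ⟨fun h => hne (h5.symm.trans (hzP _ h)), h4, h5⟩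
      exact hne (eq_zero_of_constant_upwards hM p fun n => (hup n).2.2)
  -- Four corners at each vertex give `4V = 4H + S`, two sides of each edge give `2E = 4H + C`, and
  -- these turn `E < H + V` into the claim.
  change 2 * C.card + 4 ≤ S.card
  omega

/-! ### Polyominoes that are folded into a closed surface -/

/-- A closed surface obtained by gluing the edges of the cells of `P` in pairs, such that cells of
`P` with a common edge are glued along this edge, and three or four squares meet at each vertex.
It is given by the rotation of the corners of the cells about the vertices: the corner `(p, k)` is
mapped to the next corner of a square at the same vertex, across the edge `k` of `p`. -/
structure CornerRotation (P : Finset (ℤ × ℤ)) where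
  /-- the rotation -/
  rot : Equiv.Perm (P × ZMod 4)
  planar : ∀ (p q : P) k, (q : ℤ × ℤ) = p + dir k → rot (p, k) = (q, k + 3)
  edge : ∀ f, rot ((rot f).1, (rot f).2 - 1) = (f.1, f.2 + 1)
  three_or_four : ∀ f, rot (rot (rot f)) = f ∨ rot (rot (rot (rot f))) = f
  ne : ∀ f, rot f ≠ f
  two_ne : ∀ f, rot (rot f) ≠ f

namespace CornerRotation

open scoped Classical

variable {P : Finset (ℤ × ℤ)} (R : CornerRotation P)

/-- The edge `k` of the cell `p` is on the boundary of `P`. -/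
def Cut (f : P × ZMod 4) : Prop := (f.1 : ℤ × ℤ) + dir f.2 ∉ P

/-- The vertices of the surface. -/
def Vertex : Type := Quotient (Equiv.Perm.SameCycle.setoid R.rot)

noncomputable instance : Fintype R.Vertex :=
  inferInstanceAs (Fintype (Quotient (Equiv.Perm.SameCycle.setoid R.rot)))

/-- The vertex at a corner of a cell. -/
def vert (f : P × ZMod 4) : R.Vertex := Quotient.mk (Equiv.Perm.SameCycle.setoid R.rot) f

theorem vert_surjective (x : R.Vertex) : ∃ f, R.vert f = x := Quotient.exists_rep x

theorem vert_eq_iff_sameCycle {f g : P × ZMod 4} :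
    R.vert f = R.vert g ↔ R.rot.SameCycle f g := Quotient.eq

theorem vert_rot (f : P × ZMod 4) : R.vert (R.rot f) = R.vert f :=
  R.vert_eq_iff_sameCycle.2 (Equiv.Perm.SameCycle.refl _ _).apply_left

theorem vert_eq_iff {f g : P × ZMod 4} : R.vert g = R.vert f ↔
    g = f ∨ g = R.rot f ∨ g = R.rot (R.rot f) ∨ g = R.rot (R.rot (R.rot f)) := by
  constructor
  · intro h
    obtain ⟨n, hn⟩ := (R.vert_eq_iff_sameCycle.1 h.symm).exists_nat_pow_eq
    rw [← hn]
    clear hn h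
    induction n with
    | zero => exact Or.inl rfl
    | succ n ih =>
      rw [pow_succ', Equiv.Perm.mul_apply]
      rcases ih with h | h | h | h <;> rw [h]
      · simp
      · simp
      · simp
      · rcases R.three_or_four f with h | h
        · rw [h]; simp
        · rw [h]; simp
  · rintro (rfl | rfl | rfl | rfl) <;> simp [vert_rot]

/-- Three squares meet at this corner. -/
def Three (f : P × ZMod 4) : Prop := R.rot (R.rot (R.rot f)) = f

/-- The corners at a vertex. -/
noncomputable def fiber (x : R.Vertex) : Finset (P × ZMod 4) := Finset.univ.filter (R.vert · = x)

theorem mem_fiber {x : R.Vertex} {f : P × ZMod 4} : f ∈ R.fiber x ↔ R.vert f = x := by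
  simp [fiber]

theorem fiber_vert (f : P × ZMod 4) :
    R.fiber (R.vert f) = {f, R.rot f, R.rot (R.rot f), R.rot (R.rot (R.rot f))} := by
  ext g
  rw [mem_fiber, vert_eq_iff]
  simp

/-- Three corners of weight four or four corners of weight three: the total is twelve in either
case, so vertices can be counted by corners without division. -/
theorem sum_fiber (x : R.Vertex) : ∑ f ∈ R.fiber x, (3 + if R.Three f then 1 else 0) = 12 := by
  obtain ⟨f, rfl⟩ := R.vert_surjective x
  rw [fiber_vert]
  have h1 := R.ne
  have h2 := R.two_ne
  by_cases h : R.Three f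
  · have h' : R.rot (R.rot (R.rot f)) = f := h
    have h3 : ({f, R.rot f, R.rot (R.rot f), R.rot (R.rot (R.rot f))} : Finset (P × ZMod 4)) =
        {f, R.rot f, R.rot (R.rot f)} := by
      rw [h']
      ext g
      simp only [Finset.mem_insert, Finset.mem_singleton]
      tauto
    rw [h3, Finset.sum_insert, Finset.sum_insert, Finset.sum_singleton]
    · simp [Three, h']
    · simpa using (h1 (R.rot f)).symm
    · simp [(h1 f).symm, (h2 f).symm]
  · have h' : R.rot (R.rot (R.rot f)) ≠ f := h
    rw [Finset.sum_insert, Finset.sum_insert, Finset.sum_insert, Finset.sum_singleton]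
    · simp [Three, h']
    · simpa using (h1 f).symm
    · simp [(h1 f).symm, (h2 f).symm]
    · simp [(h1 f).symm, (h2 f).symm, h'.symm]

theorem card_mul_twelve (c : Finset R.Vertex) : 12 * c.card =
    3 * (Finset.univ.filter fun f => R.vert f ∈ c).card +
      (Finset.univ.filter fun f => R.vert f ∈ c ∧ R.Three f).card := by
  have h1 : ∑ x ∈ c, ∑ f ∈ R.fiber x, (3 + if R.Three f then 1 else 0) = 12 * c.card := by
    rw [Finset.sum_congr rfl fun x _ => R.sum_fiber x, Finset.sum_const, smul_eq_mul, mul_comm]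
  rw [← h1]
  have h2 : ∀ x ∈ c, R.fiber x = (Finset.univ.filter fun f => R.vert f ∈ c).filter
      (R.vert · = x) := by
    intro x hx
    ext f
    simp only [mem_fiber, Finset.mem_filter, Finset.mem_univ, true_and]
    exact ⟨fun h => ⟨h ▸ hx, h⟩, fun h => h.2⟩
  rw [Finset.sum_congr rfl fun x hx => by rw [h2 x hx],
    Finset.sum_fiberwise_of_maps_to (s := Finset.univ.filter fun f => R.vert f ∈ c)
      (fun f hf => (Finset.mem_filter.1 hf).2),
    Finset.sum_add_distrib, Finset.sum_const, smul_eq_mul, mul_comm, ← Finset.card_filter,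
    Finset.filter_filter]

/-! ### Cut edges around a vertex -/

variable {R}

theorem not_cut_iff {f : P × ZMod 4} : ¬ Cut f ↔ ∃ q : P, (q : ℤ × ℤ) = f.1 + dir f.2 :=
  ⟨fun h => ⟨⟨_, not_not.1 h⟩, rfl⟩, fun ⟨q, hq⟩ h => h (hq ▸ q.2)⟩

/-- Three uncut steps are steps around a lattice point of the plane. They end at the cell `p + dir
(k + 3)`, which differs from `p` and is adjacent to it. -/
theorem rot_rot_rot_of_not_cut {f : P × ZMod 4} (h0 : ¬ Cut f) (h1 : ¬ Cut (R.rot f))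
    (h2 : ¬ Cut (R.rot (R.rot f))) : ¬ R.Three f ∧ ¬ Cut (R.rot (R.rot (R.rot f))) := by
  obtain ⟨p, k⟩ := f
  obtain ⟨q, hq⟩ := not_cut_iff.1 h0
  rw [Three]
  rw [R.planar p q k hq] at h1 h2 ⊢
  obtain ⟨r, hr⟩ := not_cut_iff.1 h1
  rw [R.planar q r _ hr] at h2 ⊢
  obtain ⟨s, hs⟩ := not_cut_iff.1 h2
  rw [R.planar r s _ hs]
  simp only at hq hr hs
  have e1 : ∀ k : ZMod 4, k + 3 + 3 = k + 2 := by decide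
  have e2 : ∀ k : ZMod 4, k + 3 + 3 + 3 + 2 = k + 3 := by decide
  have e3 : ∀ k : ZMod 4, k + 3 + 3 + 3 = k + 3 + 2 := by decide
  have hs' : (s : ℤ × ℤ) = p + dir (k + 3) := by
    rw [hs, hr, hq, e1, add_right_comm, add_dir_add_dir]
  constructor
  · intro h
    have := congrArg (fun f => (f.1 : ℤ × ℤ)) h
    simp only at this
    rw [hs'] at this
    exact dir_ne_zero _ (by simpa using this)
  · rw [not_cut_iff]
    refine ⟨p, ?_⟩
    simp only
    rw [hs', e3, add_dir_add_dir]

/-- If only one of the four edges at the vertex were cut, the other three would close up a block in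
the plane and make the fourth uncut. Where three squares meet, a single cut is possible. -/
theorem two_le_card_cut {f : P × ZMod 4} (hf : Cut f) (h3 : ¬ R.Three f) :
    2 ≤ ((R.fiber (R.vert f)).filter Cut).card := by
  by_contra hlt
  have hmem : ∀ g, Cut g → R.vert g = R.vert f → g = f := fun g hg hv =>
    Finset.card_le_one.1 (by omega : ((R.fiber (R.vert f)).filter Cut).card ≤ 1) g
      (by simp [mem_fiber, hv, hg]) f (by simp [mem_fiber, hf])
  have h4 := (R.three_or_four f).resolve_left h3
  have := (rot_rot_rot_of_not_cut (R := R) (f := R.rot f)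
    (fun h => R.ne f (hmem _ h (R.vert_rot f)))
    (fun h => R.two_ne f (hmem _ h (by simp [vert_rot])))
    (fun h => h3 (hmem _ h (by simp [vert_rot])))).2
  rw [h4] at this
  exact this hf

/-- The other side of an edge. -/
def mate (R : CornerRotation P) (f : P × ZMod 4) : P × ZMod 4 := ((R.rot f).1, (R.rot f).2 - 1)

theorem rot_mate (f : P × ZMod 4) : R.rot (R.mate f) = (f.1, f.2 + 1) := R.edge f

theorem vert_mate (f : P × ZMod 4) : R.vert (R.mate f) = R.vert (f.1, f.2 + 1) := by
  rw [← R.vert_rot, rot_mate]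

theorem vert_mate_succ (f : P × ZMod 4) : R.vert ((R.mate f).1, (R.mate f).2 + 1) = R.vert f := by
  rw [← R.vert_rot f]
  simp [mate]

theorem cut_mate {f : P × ZMod 4} (hf : Cut f) : Cut (R.mate f) := by
  by_contra h
  obtain ⟨q, hq⟩ := not_cut_iff.1 h
  have h1 := R.planar _ q _ hq
  rw [Prod.mk.eta, rot_mate] at h1
  obtain ⟨p, k⟩ := f
  rw [Prod.mk.injEq] at h1
  obtain ⟨h1, h2⟩ := h1
  subst h1
  refine hf ?_
  simp only at h2 hq ⊢
  have h3 : ∀ k m : ZMod 4, k + 1 = m + 3 → k = m + 2 := by decide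
  have h4 := h3 _ _ h2
  generalize R.mate (p, k) = g at *
  rw [hq, h4, add_dir_add_dir]
  exact g.1.2

/-! ### The graph of cut edges and its components -/

variable (R)

/-- The graph formed by the cut edges. -/
def cutGraph : SimpleGraph R.Vertex where
  Adj x y := x ≠ y ∧ ∃ f, Cut f ∧ R.vert f = x ∧ R.vert (f.1, f.2 + 1) = y
  symm := ⟨fun _ _ ⟨hne, f, hf, hx, hy⟩ =>
    ⟨hne.symm, R.mate f, cut_mate hf, (vert_mate f).trans hy, (vert_mate_succ f).trans hx⟩⟩
  loopless := ⟨fun _ h => h.1 rfl⟩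

/-- The component of the graph of cut edges at a corner. -/
def comp (f : P × ZMod 4) : R.cutGraph.ConnectedComponent :=
  R.cutGraph.connectedComponentMk (R.vert f)

theorem comp_rot (f : P × ZMod 4) : R.comp (R.rot f) = R.comp f := by
  rw [comp, comp, vert_rot]

theorem comp_succ {f : P × ZMod 4} (hf : Cut f) : R.comp (f.1, f.2 + 1) = R.comp f := by
  by_cases h : R.vert f = R.vert (f.1, f.2 + 1)
  · rw [comp, comp, h]
  · have : R.cutGraph.Adj (R.vert f) (R.vert (f.1, f.2 + 1)) := ⟨h, f, hf, rfl, rfl⟩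
    exact (SimpleGraph.ConnectedComponent.sound this.reachable).symm

/-- The vertices in a component of the graph of cut edges. -/
noncomputable def compVertices (c : R.cutGraph.ConnectedComponent) : Finset R.Vertex :=
  Finset.univ.filter fun x => R.cutGraph.connectedComponentMk x = c

theorem vert_mem_compVertices {c : R.cutGraph.ConnectedComponent} {f : P × ZMod 4} :
    R.vert f ∈ R.compVertices c ↔ R.comp f = c := by
  simp [compVertices, comp]

/-- A connected graph has at most one vertex more than edges. Each dart comes from a side of a cut
edge; loops and multiple edges are lost in the simple graph, which leaves an inequality in the right
direction. -/
theorem two_mul_card_compVertices_le (c : R.cutGraph.ConnectedComponent) :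
    2 * (R.compVertices c).card ≤
      (Finset.univ.filter fun f => R.comp f = c ∧ Cut f).card + 2 := by
  have h1 := c.connected_toSimpleGraph.card_vert_le_card_edgeSet_add_one
  have h2 := c.toSimpleGraph.dart_card_eq_twice_card_edges
  have h3 : Nat.card c = (R.compVertices c).card := by
    rw [Nat.card_eq_fintype_card, Fintype.card_subtype]
    rfl
  rw [h3, Nat.card_eq_fintype_card, ← SimpleGraph.edgeFinset_card] at h1
  have h4 : Fintype.card c.toSimpleGraph.Dart ≤
      (Finset.univ.filter fun f => R.comp f = c ∧ Cut f).card := by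
    rw [← Finset.card_univ]
    have hex : ∀ d : c.toSimpleGraph.Dart, ∃ f, Cut f ∧ R.vert f = d.fst.1 ∧
        R.vert (f.1, f.2 + 1) = d.snd.1 := fun d => d.adj.2
    choose φ hφ using hex
    refine Finset.card_le_card_of_injOn φ (fun d _ => ?_) (fun d _ d' _ h => ?_)
    · simp only [Finset.coe_filter, Finset.mem_univ, true_and, Set.mem_ofPred_eq]
      refine ⟨?_, (hφ d).1⟩
      rw [comp, (hφ d).2.1]
      exact d.fst.2
    · refine SimpleGraph.Dart.ext _ _ (Prod.ext (Subtype.ext ?_) (Subtype.ext ?_))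
      · exact (hφ d).2.1.symm.trans (h ▸ (hφ d').2.1)
      · exact (hφ d).2.2.symm.trans (h ▸ (hφ d').2.2)
  omega

/-- The graph of cut edges has only one component that contains an edge. -/
theorem comp_eq_of_cut (hconn : ConnectedCells P) {p₀ : P}
    (htop : ∀ n : ℕ, (p₀ : ℤ × ℤ) + (0, ((n + 1 : ℕ) : ℤ)) ∉ P) {f : P × ZMod 4} (hf : Cut f) :
    R.comp f = R.comp (p₀, 0) := by
  by_contra hne
  set c := R.comp f with hc
  let ι : P × ZMod 4 ↪ (ℤ × ℤ) × ZMod 4 :=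
    ⟨fun f => (f.1, f.2), fun f g h => by
      rw [Prod.mk.injEq] at h
      exact Prod.ext (Subtype.ext h.1) h.2⟩
  let S := Finset.univ.filter fun f => R.comp f = c
  have hS : ∀ (p : P) k, ((p : ℤ × ℤ), k) ∈ S.map ι ↔ R.comp (p, k) = c := by
    intro p k
    have : ((p : ℤ × ℤ), k) = ι (p, k) := rfl
    rw [this, Finset.mem_map' ι]
    simp [S]
  have hplane := card_cut_le hconn (S.map ι) (fun f hf => by
      obtain ⟨g, -, rfl⟩ := Finset.mem_map.1 hf
      exact g.1.2)
    (fun p k hp hq => by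
      rw [hS ⟨p, hp⟩, hS ⟨p + dir k, hq⟩, ← R.planar ⟨p, hp⟩ ⟨p + dir k, hq⟩ k rfl, comp_rot])
    (fun p k hp hq => by
      rw [hS ⟨p, hp⟩, hS ⟨p, hp⟩, R.comp_succ (f := (⟨p, hp⟩, k)) hq])
    p₀.2 htop (fun h => hne ((hS _ _).1 h).symm)
    ⟨ι f, by simp [S, hc], hf⟩
  have hcard : ((S.map ι).filter fun f => f.1 + dir f.2 ∉ P).card =
      (Finset.univ.filter fun f => R.comp f = c ∧ Cut f).card := by
    rw [Finset.filter_map, Finset.card_map, Finset.filter_filter]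
    exact congrArg _ (Finset.filter_congr fun _ _ => Iff.rfl)
  rw [hcard, Finset.card_map] at hplane
  have h1 := R.two_mul_card_compVertices_le c
  have h2 := R.card_mul_twelve (R.compVertices c)
  simp only [vert_mem_compVertices] at h2
  -- The bounds `hplane`, `h1` and `h2` together leave no corner where three squares meet. So each
  -- vertex of the component carries at least two sides of cut edges, which contradicts `hplane` and
  -- `h2`.
  have h3 : 2 * (R.compVertices c).card ≤
      (Finset.univ.filter fun f => R.comp f = c ∧ Cut f).card := by
    have hnot : ∀ g, R.comp g = c → ¬ R.Three g := by
      intro g hg h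
      have : 0 < (Finset.univ.filter fun f => R.comp f = c ∧ R.Three f).card :=
        Finset.card_pos.2 ⟨g, by simp [hg, h]⟩
      change 2 * _ + 4 ≤ (Finset.univ.filter fun f => R.comp f = c).card at hplane
      omega
    rw [Finset.card_eq_sum_card_fiberwise (f := R.vert) (t := R.compVertices c)
      (fun f hf => by
        simp only [Finset.coe_filter, Finset.mem_univ, true_and, Set.mem_ofPred_eq] at hf
        exact (R.vert_mem_compVertices).2 hf.1), mul_comm, ← smul_eq_mul]
    refine Finset.card_nsmul_le_sum _ _ _ fun x hx => ?_
    have hxc : R.cutGraph.connectedComponentMk x = c := by simpa [compVertices] using hx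
    -- A vertex of the component other than that of `f` has a first edge on a walk to it.
    have hex : ∃ g, Cut g ∧ R.vert g = x := by
      by_cases hxf : x = R.vert f
      · exact ⟨f, hf, hxf.symm⟩
      · obtain ⟨w⟩ := SimpleGraph.ConnectedComponent.exact (hxc.trans hc)
        cases w with
        | nil => exact absurd rfl hxf
        | cons hadj _ =>
          obtain ⟨-, g, hg, hgx, -⟩ := hadj
          exact ⟨g, hg, hgx⟩
    obtain ⟨g, hg, rfl⟩ := hex
    refine (two_le_card_cut (R := R) hg (hnot g hxc)).trans (Finset.card_le_card fun g' hg' => ?_)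
    simp only [Finset.mem_filter, mem_fiber, Finset.mem_univ, true_and] at hg' ⊢
    exact ⟨⟨(congrArg R.cutGraph.connectedComponentMk hg'.1).trans hxc, hg'.2⟩, hg'.1⟩
  change 2 * _ + 4 ≤ (Finset.univ.filter fun f => R.comp f = c).card at hplane
  omega

variable {R}

theorem rot_snd_of_not_cut {f : P × ZMod 4} (h : ¬ Cut f) : (R.rot f).2 = f.2 + 3 := by
  obtain ⟨q, hq⟩ := not_cut_iff.1 h
  rw [← Prod.mk.eta (p := f), R.planar _ q _ hq]

/-- Each uncut step lowers the corner number by one, so every number occurs. Corner `0` selects the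
lower left cell of the block around the vertex. -/
theorem exists_corner_zero {x : R.Vertex} (hx : ∀ f, R.vert f = x → ¬ Cut f) :
    ∃ p : P, R.vert (p, 0) = x := by
  obtain ⟨f, rfl⟩ := R.vert_surjective x
  have h1 := rot_snd_of_not_cut (R := R) (hx f rfl)
  have h2 := rot_snd_of_not_cut (R := R) (hx (R.rot f) (by simp [vert_rot]))
  have h3 := rot_snd_of_not_cut (R := R) (hx (R.rot (R.rot f)) (by simp [vert_rot]))
  have key : ∀ g : P × ZMod 4, g.2 = 0 → R.vert g = R.vert f → ∃ p : P, R.vert (p, 0) = R.vert f := by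
    rintro ⟨p, k⟩ hk h
    subst hk
    exact ⟨p, h⟩
  rcases zmod_four_cases f.2 with h | h | h | h
  · exact key f h rfl
  · exact key (R.rot f) (by rw [h1, h]; rfl) (by simp [vert_rot])
  · exact key (R.rot (R.rot f)) (by rw [h2, h1, h]; rfl) (by simp [vert_rot])
  · exact key (R.rot (R.rot (R.rot f))) (by rw [h3, h2, h1, h]; rfl) (by simp [vert_rot])

theorem square_of_corner_zero {p : P} (hx : ∀ f, R.vert f = R.vert (p, 0) → ¬ Cut f) :
    (p : ℤ × ℤ) + (1, 0) ∈ P ∧ (p : ℤ × ℤ) + (0, 1) ∈ P ∧ (p : ℤ × ℤ) + (1, 0) + (0, 1) ∈ P := by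
  obtain ⟨q, hq⟩ := not_cut_iff.1 (hx (p, 0) rfl)
  have e1 := R.planar p q 0 hq
  obtain ⟨r, hr⟩ := not_cut_iff.1 (hx (R.rot (p, 0)) (R.vert_rot _))
  rw [e1] at hr
  have e2 := R.planar q r _ hr
  obtain ⟨s, hs⟩ := not_cut_iff.1 (hx (R.rot (R.rot (p, 0))) (by simp [vert_rot]))
  rw [e1, e2] at hs
  change (q : ℤ × ℤ) = (p : ℤ × ℤ) + (0, 1) at hq
  change (r : ℤ × ℤ) = (q : ℤ × ℤ) + (1, 0) at hr
  change (s : ℤ × ℤ) = (r : ℤ × ℤ) + (0, -1) at hs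
  refine ⟨?_, hq ▸ q.2, ?_⟩
  · have : (p : ℤ × ℤ) + (1, 0) = (s : ℤ × ℤ) := by
      rw [hs, hr, hq]
      ext <;> simp
    rw [this]
    exact s.2
  · rw [add_right_comm, ← hq, ← hr]
    exact r.2

theorem exists_top {P : Finset (ℤ × ℤ)} (hP : P.Nonempty) :
    ∃ p₀ : P, ∀ n : ℕ, (p₀ : ℤ × ℤ) + (0, ((n + 1 : ℕ) : ℤ)) ∉ P := by
  obtain ⟨p, hp, hmax⟩ := P.exists_max_image Prod.snd hP
  refine ⟨⟨p, hp⟩, fun n hn => ?_⟩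
  have := hmax _ hn
  simp only [Prod.snd_add] at this
  push_cast at this
  omega

variable (R)

/-- A polyomino that is folded onto a surface with at least eight vertices of degree three has no
holes: every closed cochain is a coboundary. -/
theorem exists_primitive (hP : P.Nonempty) (hconn : ConnectedCells P)
    (h24 : 24 ≤ (Finset.univ.filter R.Three).card) (a b : ℤ × ℤ → ZMod 2)
    (hab : ∀ p, p ∈ P → p + (1, 0) ∈ P → p + (0, 1) ∈ P → p + (1, 0) + (0, 1) ∈ P →
      gridD1 (a, b) p = 0) :
    ∃ A : ℤ × ℤ → ZMod 2, (∀ p, p ∈ P → p + (1, 0) ∈ P → A p + A (p + (1, 0)) = a p) ∧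
      ∀ p, p ∈ P → p + (0, 1) ∈ P → A p + A (p + (0, 1)) = b p := by
  obtain ⟨p₀, htop⟩ := exists_top hP
  let Ex := P.filter fun p => p + (1, 0) ∈ P
  let Ey := P.filter fun p => p + (0, 1) ∈ P
  let Q := P.filter fun p => p + (1, 0) ∈ P ∧ p + (0, 1) ∈ P ∧ p + (1, 0) + (0, 1) ∈ P
  have hEx : ∀ p, p ∈ Ex ↔ p ∈ P ∧ p + (1, 0) ∈ P := fun p => by simp [Ex]
  have hEy : ∀ p, p ∈ Ey ↔ p ∈ P ∧ p + (0, 1) ∈ P := fun p => by simp [Ey]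
  have hQ : ∀ p, p ∈ Q ↔ p ∈ P ∧ p + (1, 0) ∈ P ∧ p + (0, 1) ∈ P ∧ p + (1, 0) + (0, 1) ∈ P :=
    fun p => by simp [Q]
  -- the corners on uncut edges
  let ι : P × ZMod 4 ↪ (ℤ × ℤ) × ZMod 4 :=
    ⟨fun f => (f.1, f.2), fun f g h => by
      rw [Prod.mk.injEq] at h
      exact Prod.ext (Subtype.ext h.1) h.2⟩
  let B := (Finset.univ.filter fun f : P × ZMod 4 => ¬ Cut f).map ι
  have hB : ∀ p k, (p, k) ∈ B ↔ p ∈ P ∧ p + dir k ∈ P := by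
    intro p k
    simp only [B, Finset.mem_map, Finset.mem_filter, Finset.mem_univ, true_and]
    constructor
    · rintro ⟨⟨q, j⟩, hf, h⟩
      obtain ⟨rfl, rfl⟩ := Prod.mk.inj h
      exact ⟨q.2, not_not.1 hf⟩
    · rintro ⟨h1, h2⟩
      exact ⟨(⟨p, h1⟩, k), not_not.2 h2, rfl⟩
  have hB3 : ∀ p, (p, 3) ∈ B ↔ p ∈ Ex := fun p => (hB p 3).trans (hEx p).symm
  have hB0 : ∀ p, (p, 0) ∈ B ↔ p ∈ Ey := fun p => (hB p 0).trans (hEy p).symm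
  have hBflip : ∀ p k, (p, k) ∈ B ↔ (p + dir k, k + 2) ∈ B := fun p k => by
    rw [hB, hB, add_dir_add_dir, and_comm]
  have hBcard : (Finset.univ.filter fun f : P × ZMod 4 => ¬ Cut f).card =
      2 * (Ex.card + Ey.card) := by
    rw [← Finset.card_map ι]
    change B.card = _
    rw [card_eq_sum_four, card_filter_snd_eq B 0 0 Ey (by simpa using hB0),
      card_filter_snd_eq B 3 0 Ex (by simpa using hB3),
      card_filter_snd_eq B 1 (dir 3) Ex (fun p => (hBflip p 3).symm.trans (hB3 p)),
      card_filter_snd_eq B 2 (dir 0) Ey (fun p => (hBflip p 0).symm.trans (hB0 p))]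
    ring
  have hall : (Finset.univ : Finset (P × ZMod 4)).card = P.card * 4 := by
    rw [Finset.card_univ, Fintype.card_prod, Fintype.card_coe]
    rfl
  have hsplit : (Finset.univ.filter fun f : P × ZMod 4 => Cut f).card +
      (Finset.univ.filter fun f : P × ZMod 4 => ¬ Cut f).card =
      (Finset.univ : Finset (P × ZMod 4)).card :=
    Finset.card_filter_add_card_filter_not _
  -- the vertices on cut edges form one component
  set c := R.comp (p₀, 0) with hc
  have hcut : ∀ f : P × ZMod 4, Cut f → R.comp f = c := fun f hf => R.comp_eq_of_cut hconn htop hf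
  have h1 := R.two_mul_card_compVertices_le c
  have h2 := R.card_mul_twelve Finset.univ
  simp only [Finset.mem_univ, true_and, Finset.filter_true] at h2
  have h3 : (Finset.univ.filter fun f => R.comp f = c ∧ Cut f).card ≤
      (Finset.univ.filter fun f : P × ZMod 4 => Cut f).card :=
    Finset.card_le_card fun f hf => by
      simp only [Finset.mem_filter, Finset.mem_univ, true_and] at hf ⊢
      exact hf.2
  -- A vertex off the component has no cut edge, so it is the centre of a block of cells of `P`,
  -- determined by its lower left cell.
  have h4 : (R.compVertices c)ᶜ.card ≤ Q.card := by
    have hex : ∀ x : R.Vertex, ∃ p : P, x ∈ (R.compVertices c)ᶜ → R.vert (p, 0) = x ∧ (p : ℤ × ℤ) ∈ Q := by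
      intro x
      by_cases hx : x ∈ (R.compVertices c)ᶜ
      · have huncut : ∀ f, R.vert f = x → ¬ Cut f := by
          rintro f rfl hf
          rw [Finset.mem_compl, vert_mem_compVertices] at hx
          exact hx (hcut f hf)
        obtain ⟨p, rfl⟩ := exists_corner_zero huncut
        exact ⟨p, fun _ => ⟨rfl, (hQ _).2 ⟨p.2, square_of_corner_zero huncut⟩⟩⟩
      · exact ⟨p₀, fun h => absurd h hx⟩
    choose φ hφ using hex
    refine Finset.card_le_card_of_injOn (fun x => (φ x : ℤ × ℤ)) (fun x hx => (hφ x hx).2) ?_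
    intro x hx y hy h
    rw [← (hφ x hx).1, ← (hφ y hy).1, Subtype.ext h]
  have h5 := Finset.card_add_card_compl (R.compVertices c)
  rw [← Finset.card_univ] at h5
  -- With `V` vertices, `W` of them in the component, `C` sides of cut edges and `E` adjacencies: `V
  -- ≥ P + 2` by `h24`, `2W ≤ C + 2`, `V - W ≤ Q` and `2E = 4P - C`. Hence `E < P + Q`.
  obtain ⟨A, hAx, hAy⟩ := exists_primitive_of_card_edges_lt P Ex Ey Q hEx hEy hQ
    (fun A hx hy => hconn A fun p k hp hq => by
      rcases zmod_four_cases k with rfl | rfl | rfl | rfl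
      · exact hy p ((hEy p).2 ⟨hp, hq⟩)
      · have h := add_dir_add_dir p 1
        have := hx _ ((hEx _).2 ⟨hq, by
          change p + dir 1 + dir (1 + 2) ∈ P
          rwa [h]⟩)
        change _ = A (p + dir 1 + dir (1 + 2)) at this
        rw [this, h]
      · have h := add_dir_add_dir p 2
        have := hy _ ((hEy _).2 ⟨hq, by
          change p + dir 2 + dir (2 + 2) ∈ P
          rwa [h]⟩)
        change _ = A (p + dir 2 + dir (2 + 2)) at this
        rw [this, h]
      · exact hx p ((hEx p).2 ⟨hp, hq⟩))
    (by
      change 24 ≤ (Finset.univ.filter fun f => R.Three f).card at h24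
      omega) a b
    (fun p hp => by
      obtain ⟨h1, h2, h3, h4⟩ := (hQ p).1 hp
      exact hab p h1 h2 h3 h4)
  exact ⟨A, fun p hp hq => hAx p ((hEx p).2 ⟨hp, hq⟩), fun p hp hq => hAy p ((hEy p).2 ⟨hp, hq⟩)⟩

end CornerRotation

/-! ### Chords and distances in a polyomino without holes -/

/-- The cells `q` of `P` such that the edge `k` of `q` belongs to the maximal straight segment
through the edge `k` of `p` that has cells of `P` on both sides. -/
def chord (P : Finset (ℤ × ℤ)) (p : ℤ × ℤ) (k : ZMod 4) : Set (ℤ × ℤ) :=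
  {q | ∃ t : ℤ, q = p + t • dir (k + 1) ∧
    ∀ s ∈ Set.uIcc 0 t, p + s • dir (k + 1) ∈ P ∧ p + s • dir (k + 1) + dir k ∈ P}

/-- The edge `j` of the cell `q` belongs to a chord. -/
def InChord (P : Finset (ℤ × ℤ)) (p : ℤ × ℤ) (k : ZMod 4) (q : ℤ × ℤ) (j : ZMod 4) : Prop :=
  (j = k ∧ q ∈ chord P p k) ∨ (j = k + 2 ∧ q + dir j ∈ chord P p k)

/-- For each chord, there is a function on the cells that changes exactly across the chord. -/
def ChordsSeparate (P : Finset (ℤ × ℤ)) : Prop :=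
  ∀ p k, p ∈ P → p + dir k ∈ P → ∃ g : ℤ × ℤ → ZMod 2, ∀ q j, q ∈ P → q + dir j ∈ P →
    (g q = g (q + dir j) ↔ ¬ InChord P p k q j)

section Chord

variable {P : Finset (ℤ × ℤ)} {p q : ℤ × ℤ} {k j : ZMod 4}

theorem self_mem_chord (hp : p ∈ P) (hk : p + dir k ∈ P) : p ∈ chord P p k := by
  refine ⟨0, by simp, fun s hs => ?_⟩
  simp only [Set.uIcc_self, Set.mem_singleton_iff] at hs
  subst hs
  simpa using ⟨hp, hk⟩

theorem mem_of_mem_chord (h : q ∈ chord P p k) : q ∈ P ∧ q + dir k ∈ P := by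
  obtain ⟨t, rfl, h⟩ := h
  exact h t Set.right_mem_uIcc

theorem mem_chord_step {t t' : ℤ} (ht : |t' - t| ≤ 1)
    (h : ∀ s ∈ Set.uIcc 0 t, p + s • dir (k + 1) ∈ P ∧ p + s • dir (k + 1) + dir k ∈ P)
    (hq : p + t' • dir (k + 1) ∈ P) (hqk : p + t' • dir (k + 1) + dir k ∈ P) :
    p + t' • dir (k + 1) ∈ chord P p k := by
  refine ⟨t', rfl, fun s hs => ?_⟩
  by_cases hst : s = t'
  · subst hst
    exact ⟨hq, hqk⟩
  · refine h s ?_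
    rw [Set.mem_uIcc] at hs ⊢
    rw [abs_le] at ht
    omega

theorem add_dir_mem_chord (h : q ∈ chord P p k) (hj : j = k + 1 ∨ j = k + 3)
    (hq : q + dir j ∈ P) (hqk : q + dir j + dir k ∈ P) : q + dir j ∈ chord P p k := by
  obtain ⟨t, rfl, h⟩ := h
  rcases hj with rfl | rfl
  · have : p + t • dir (k + 1) + dir (k + 1) = p + (t + 1) • dir (k + 1) := by
      rw [add_smul, one_smul, add_assoc]
    rw [this] at hq hqk ⊢
    exact mem_chord_step (by simp) h hq hqk
  · have : p + t • dir (k + 1) + dir (k + 3) = p + (t - 1) • dir (k + 1) := by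
      have e : k + 3 = k + 1 + 2 := by
        rw [add_assoc]; rfl
      rw [e, dir_add_two, sub_smul, one_smul, add_assoc, sub_eq_add_neg]
    rw [this] at hq hqk ⊢
    exact mem_chord_step (by simp) h hq hqk

/-- Induction along a chord. -/
theorem chord_induction {Φ : ℤ × ℤ → Prop} (h0 : Φ p)
    (hstep : ∀ q j, (j = k + 1 ∨ j = k + 3) → q ∈ chord P p k → q + dir j ∈ chord P p k → Φ q →
      Φ (q + dir j)) (hq : q ∈ chord P p k) : Φ q := by
  obtain ⟨t, rfl, h⟩ := hq
  have hmem : ∀ s ∈ Set.uIcc 0 t, p + s • dir (k + 1) ∈ chord P p k := fun s hs =>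
    ⟨s, rfl, fun s' hs' => h s' (Set.uIcc_subset_uIcc Set.left_mem_uIcc hs hs')⟩
  have e3 : k + 3 = k + 1 + 2 := by
    rw [add_assoc]; rfl
  induction t using Int.induction_on with
  | zero => simpa using h0
  | succ n ih =>
    have e : p + ((n : ℤ) + 1) • dir (k + 1) = p + (n : ℤ) • dir (k + 1) + dir (k + 1) := by
      rw [add_smul, one_smul, add_assoc]
    have hsub : Set.uIcc 0 (n : ℤ) ⊆ Set.uIcc 0 ((n : ℤ) + 1) := fun s hs => by
      rw [Set.mem_uIcc] at hs ⊢; omega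
    have h1 := hmem _ Set.right_mem_uIcc
    rw [e] at h1 ⊢
    exact hstep _ _ (Or.inl rfl) (hmem _ (hsub Set.right_mem_uIcc)) h1
      (ih (fun s hs => h s (hsub hs)) (fun s hs => hmem s (hsub hs)))
  | pred n ih =>
    have e : p + (-(n : ℤ) - 1) • dir (k + 1) = p + (-(n : ℤ)) • dir (k + 1) + dir (k + 3) := by
      rw [e3, dir_add_two, sub_smul, one_smul, add_assoc, sub_eq_add_neg]
    have hsub : Set.uIcc 0 (-(n : ℤ)) ⊆ Set.uIcc 0 (-(n : ℤ) - 1) := fun s hs => by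
      rw [Set.mem_uIcc] at hs ⊢; omega
    have h1 := hmem _ Set.right_mem_uIcc
    rw [e] at h1 ⊢
    exact hstep _ _ (Or.inr rfl) (hmem _ (hsub Set.right_mem_uIcc)) h1
      (ih (fun s hs => h s (hsub hs)) (fun s hs => hmem s (hsub hs)))

theorem inChord_flip : InChord P p k (q + dir j) (j + 2) ↔ InChord P p k q j := by
  have e1 : ∀ j k : ZMod 4, j + 2 = k ↔ j = k + 2 := by decide
  have e2 : ∀ j k : ZMod 4, j + 2 = k + 2 ↔ j = k := by decide
  rw [InChord, InChord, e1, e2, add_dir_add_dir, or_comm]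

/-- Two collinear edges that meet at the centre of a block belong to the same chords. This is what
makes the indicator of a chord closed. -/
theorem inChord_parallel {i : ZMod 4} (hi : i = j + 1 ∨ i = j + 3)
    (h2 : q + dir j ∈ P) (h3 : q + dir i ∈ P) (h4 : q + dir i + dir j ∈ P)
    (h : InChord P p k q j) : InChord P p k (q + dir i) j := by
  rcases h with ⟨rfl, h⟩ | ⟨rfl, h⟩
  · exact Or.inl ⟨rfl, add_dir_mem_chord h hi h3 h4⟩
  · refine Or.inr ⟨rfl, ?_⟩
    rw [add_right_comm] at h4 ⊢
    refine add_dir_mem_chord h ?_ h4 ?_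
    · have e : ∀ i k : ZMod 4, i = k + 2 + 1 ∨ i = k + 2 + 3 → i = k + 1 ∨ i = k + 3 := by decide
      exact e i k hi
    · have e : k + 2 + 2 = k := by rw [add_assoc]; exact add_zero k
      have := add_dir_add_dir (q + dir i) (k + 2)
      rw [e] at this
      rw [add_right_comm q, this]
      exact h3

theorem inChord_parallel_iff {i : ZMod 4} (hi : i = j + 1 ∨ i = j + 3) (h1 : q ∈ P)
    (h2 : q + dir j ∈ P) (h3 : q + dir i ∈ P) (h4 : q + dir i + dir j ∈ P) :
    InChord P p k (q + dir i) j ↔ InChord P p k q j := by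
  refine ⟨fun h => ?_, inChord_parallel hi h2 h3 h4⟩
  have := inChord_parallel (q := q + dir i) (i := i + 2) (j := j) ?_ h4
    (by rwa [add_dir_add_dir]) (by rwa [add_dir_add_dir]) h
  · rwa [add_dir_add_dir] at this
  · have e : ∀ i j : ZMod 4, i = j + 1 ∨ i = j + 3 → i + 2 = j + 1 ∨ i + 2 = j + 3 := by decide
    exact e i j hi

-- At the centre of a block the indicator of a chord takes equal values on opposite edges, so it is
-- a closed cochain; a primitive of it is the separating function.
open scoped Classical in
theorem CornerRotation.chordsSeparate (R : CornerRotation P) (hP : P.Nonempty)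
    (hconn : ConnectedCells P) (h24 : 24 ≤ (Finset.univ.filter R.Three).card) :
    ChordsSeparate P := by
  intro p k hp hk
  let f : ℤ × ℤ → ZMod 4 → ZMod 2 := fun q j => if InChord P p k q j then 1 else 0
  obtain ⟨g, hx, hy⟩ := R.exists_primitive hP hconn h24 (fun q => f q 3) (fun q => f q 0)
    (fun q h1 h2 h3 h4 => by
      have e1 : f (q + dir 0) 3 = f q 3 :=
        if_congr (inChord_parallel_iff (Or.inl rfl) h1 h2 h3 (by
          change q + (0, 1) + (1, 0) ∈ P
          rwa [add_right_comm])) rfl rfl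
      have e2 : f (q + dir 3) 0 = f q 0 :=
        if_congr (inChord_parallel_iff (Or.inr rfl) h1 h3 h2 h4) rfl rfl
      change f q 3 + f (q + dir 0) 3 + f q 0 + f (q + dir 3) 0 = 0
      rw [e1, e2]
      linear_combination (f q 3 + f q 0) * (CharTwo.two_eq_zero (R := ZMod 2)))
  have key : ∀ q j, q ∈ P → q + dir j ∈ P → g q + g (q + dir j) = f q j := by
    have flip : ∀ q j, f (q + dir j) (j + 2) = f q j := fun q j => if_congr inChord_flip rfl rfl
    intro q j h1 h2
    rcases zmod_four_cases j with rfl | rfl | rfl | rfl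
    · exact hy q h1 h2
    · have h := add_dir_add_dir q 1
      have h3 := hx (q + dir 1) h2 (by
        change q + dir 1 + dir (1 + 2) ∈ P
        rwa [h])
      change _ + g (q + dir 1 + dir (1 + 2)) = f (q + dir 1) (1 + 2) at h3
      rw [h, flip] at h3
      rw [add_comm, h3]
    · have h := add_dir_add_dir q 2
      have h3 := hy (q + dir 2) h2 (by
        change q + dir 2 + dir (2 + 2) ∈ P
        rwa [h])
      change _ + g (q + dir 2 + dir (2 + 2)) = f (q + dir 2) (2 + 2) at h3
      rw [h, flip] at h3
      rw [add_comm, h3]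
    · exact hx q h1 h2
  refine ⟨g, fun q j h1 h2 => ?_⟩
  have h3 := key q j h1 h2
  by_cases h : InChord P p k q j
  · have h4 : f q j = 1 := if_pos h
    rw [h4] at h3
    simp only [h, not_true_eq_false, iff_false]
    intro h5
    rw [h5, CharTwo.add_self_eq_zero] at h3
    exact zero_ne_one h3
  · have h4 : f q j = 0 := if_neg h
    rw [h4, CharTwo.add_eq_zero] at h3
    simp [h, h3]

end Chord

/-- The properties of the distance to the cell `z` in `P` that are used below. -/
structure IsDistance (P : Finset (ℤ × ℤ)) (z : ℤ × ℤ) (D : ℤ × ℤ → ℕ) : Prop where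
  zero : D z = 0
  le : ∀ p k, p ∈ P → p + dir k ∈ P → D p ≤ D (p + dir k) + 1
  ne : ∀ p k, p ∈ P → p + dir k ∈ P → D p ≠ D (p + dir k)
  exists_lt : ∀ p ∈ P, p ≠ z → ∃ k, p + dir k ∈ P ∧ D (p + dir k) < D p

/-- The `ℓ¹`-distance of two cells. -/
def cellDist (u v : ℤ × ℤ) : ℤ := |u.1 - v.1| + |u.2 - v.2|

theorem cellDist_self (u : ℤ × ℤ) : cellDist u u = 0 := by simp [cellDist]

theorem cellDist_add_right (u v o : ℤ × ℤ) : cellDist (u + o) (v + o) = cellDist u v := by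
  simp [cellDist]

theorem abs_dir : ∀ k, |(dir k).1| + |(dir k).2| = 1 := by decide

theorem cellDist_add_dir_le (u v : ℤ × ℤ) (k : ZMod 4) :
    cellDist u v ≤ cellDist (u + dir k) v + 1 := by
  have h1 := abs_sub_abs_le_abs_sub (u.1 - v.1) (u.1 + (dir k).1 - v.1)
  have h2 := abs_sub_abs_le_abs_sub (u.2 - v.2) (u.2 + (dir k).2 - v.2)
  have e1 : u.1 - v.1 - (u.1 + (dir k).1 - v.1) = -(dir k).1 := by ring
  have e2 : u.2 - v.2 - (u.2 + (dir k).2 - v.2) = -(dir k).2 := by ring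
  rw [e1, abs_neg] at h1
  rw [e2, abs_neg] at h2
  have h3 := abs_dir k
  simp only [cellDist, Prod.fst_add, Prod.snd_add]
  linarith

theorem cellDist_smul (p : ℤ × ℤ) (k : ZMod 4) (t t' : ℤ) :
    cellDist (p + t • dir k) (p + t' • dir k) = |t - t'| := by
  simp only [cellDist, Prod.fst_add, Prod.snd_add, Prod.smul_fst, Prod.smul_snd, smul_eq_mul,
    add_sub_add_left_eq_sub, ← sub_mul, abs_mul, ← mul_add, abs_dir, mul_one]

/-! ### Steps towards the sink and chords -/

section Distance

variable {P : Finset (ℤ × ℤ)} {z p : ℤ × ℤ} {k : ZMod 4} {D : ℤ × ℤ → ℕ} {g : ℤ × ℤ → ZMod 2}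

theorem IsDistance.le' (hD : IsDistance P z D) {q : ℤ × ℤ} {j : ZMod 4} (h1 : q ∈ P)
    (h2 : q + dir j ∈ P) : D (q + dir j) ≤ D q + 1 := by
  have := hD.le (q + dir j) (j + 2) h2 (by rwa [add_dir_add_dir])
  rwa [add_dir_add_dir] at this

/-- On the way to `z`, a function that has different values at `u` and `z` changes. -/
theorem IsDistance.exists_cross (hD : IsDistance P z D) (Φ : ℤ × ℤ → Prop)
    (hΦ : ∀ v j, v ∈ P → v + dir j ∈ P → D (v + dir j) < D v → Φ v → Φ (v + dir j))
    {u : ℤ × ℤ} (hu : u ∈ P) (hg : g u ≠ g z) (hΦu : Φ u) :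
    ∃ w j, w ∈ P ∧ w + dir j ∈ P ∧ g w ≠ g z ∧ g (w + dir j) = g z ∧ Φ w ∧
      cellDist u w + 1 + D (w + dir j) ≤ D u := by
  obtain ⟨n, hn⟩ : ∃ n, D u = n := ⟨_, rfl⟩
  induction n using Nat.strong_induction_on generalizing u with
  | _ n ih =>
    obtain ⟨j, hj, hlt⟩ := hD.exists_lt u hu (fun h => hg (h ▸ rfl))
    by_cases hgj : g (u + dir j) = g z
    · refine ⟨u, j, hu, hj, hg, hgj, hΦu, ?_⟩
      rw [cellDist_self]
      omega
    · obtain ⟨w, i, h1, h2, h3, h4, h5, h6⟩ :=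
        ih _ (hn ▸ hlt) hj hgj (hΦ u j hu hj hlt hΦu) rfl
      refine ⟨w, i, h1, h2, h3, h4, h5, ?_⟩
      have := cellDist_add_dir_le u w j
      omega

theorem le_sub_add_of_forall {F : ℤ → ℕ} {a b : ℤ} (hab : a ≤ b)
    (h : ∀ s, a ≤ s → s < b → F s ≤ F (s + 1) + 1 ∧ F (s + 1) ≤ F s + 1) :
    (F a : ℤ) ≤ b - a + F b ∧ (F b : ℤ) ≤ b - a + F a := by
  induction b, hab using Int.leInduction with
  | base => simp
  | succ b hb ih =>
    have h1 := ih fun s h1 h2 => h s h1 (by omega)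
    have h2 := h b hb (by omega)
    omega

/-- The cells along one side of a chord form a straight path in `P`. The offset `o` selects the
side: `0` or `dir k` in the applications. -/
theorem IsDistance.le_of_chord (hD : IsDistance P z D) {o q q' : ℤ × ℤ}
    (ho : ∀ q ∈ chord P p k, q + o ∈ P) (hq : q ∈ chord P p k) (hq' : q' ∈ chord P p k) :
    (D (q + o) : ℤ) ≤ cellDist q q' + D (q' + o) := by
  obtain ⟨t, rfl, ht⟩ := hq
  obtain ⟨t', rfl, ht'⟩ := hq'
  rw [cellDist_smul]
  have hmem : ∀ s, (s ∈ Set.uIcc 0 t ∨ s ∈ Set.uIcc 0 t') → p + s • dir (k + 1) + o ∈ P := by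
    rintro s (hs | hs)
    · exact ho _ ⟨s, rfl, fun r hr => ht r (Set.uIcc_subset_uIcc Set.left_mem_uIcc hs hr)⟩
    · exact ho _ ⟨s, rfl, fun r hr => ht' r (Set.uIcc_subset_uIcc Set.left_mem_uIcc hs hr)⟩
  have hstep : ∀ s, (s ∈ Set.uIcc 0 t ∨ s ∈ Set.uIcc 0 t') →
      (s + 1 ∈ Set.uIcc 0 t ∨ s + 1 ∈ Set.uIcc 0 t') →
      D (p + s • dir (k + 1) + o) ≤ D (p + (s + 1) • dir (k + 1) + o) + 1 ∧
        D (p + (s + 1) • dir (k + 1) + o) ≤ D (p + s • dir (k + 1) + o) + 1 := by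
    intro s h1 h2
    have e : p + (s + 1) • dir (k + 1) + o = p + s • dir (k + 1) + o + dir (k + 1) := by
      rw [add_smul, one_smul, ← add_assoc, add_right_comm]
    have h1 := hmem _ h1
    have h2 := hmem _ h2
    rw [e] at h2 ⊢
    exact ⟨hD.le _ _ h1 h2, hD.le' h1 h2⟩
  simp only [Set.mem_uIcc] at hstep
  rcases le_total t t' with h | h
  · have := (le_sub_add_of_forall (F := fun s => D (p + s • dir (k + 1) + o)) h
      (fun s h1 h2 => hstep s (by omega) (by omega))).1
    rw [abs_sub_comm, abs_of_nonneg (by omega)]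
    exact this
  · have := (le_sub_add_of_forall (F := fun s => D (p + s • dir (k + 1) + o)) h
      (fun s h1 h2 => hstep s (by omega) (by omega))).2
    rw [abs_of_nonneg (by omega)]
    exact this

theorem eq_on_chord (hg : ∀ q j, q ∈ P → q + dir j ∈ P →
    (g q = g (q + dir j) ↔ ¬ InChord P p k q j)) {q : ℤ × ℤ} (hq : q ∈ chord P p k) :
    g q = g p := by
  refine chord_induction (Φ := fun q => g q = g p) rfl (fun q j hj h1 h2 h3 => ?_) hq
  rw [← h3]
  refine ((hg q j (mem_of_mem_chord h1).1 (mem_of_mem_chord h2).1).2 ?_).symm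
  have e : ∀ j k : ZMod 4, j = k + 1 ∨ j = k + 3 → j ≠ k ∧ j ≠ k + 2 := by decide
  rintro (⟨h, -⟩ | ⟨h, -⟩)
  · exact (e j k hj).1 h
  · exact (e j k hj).2 h

theorem eq_of_ne_of_ne {x y w : ZMod 2} (h1 : x ≠ y) (h2 : w ≠ y) : x = w := by
  decide +revert

/-- The steps on the way to `z` lead to the side of a chord that contains `z`. -/
theorem IsDistance.eq_of_lt (hD : IsDistance P z D) (hg : ∀ q j, q ∈ P → q + dir j ∈ P →
    (g q = g (q + dir j) ↔ ¬ InChord P p k q j)) {v : ℤ × ℤ} {j : ZMod 4}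
    (hv : v ∈ P) (hvj : v + dir j ∈ P) (hlt : D (v + dir j) < D v) (hc : InChord P p k v j) :
    g (v + dir j) = g z := by
  by_contra hne
  -- Otherwise the way from `v + dir j` to `z` recrosses the chord, at an edge from `w` to `w + dir
  -- i`. By the values of `g` it does so in the opposite sense, so `w + dir i` is on the side of
  -- `v`. Walking there directly along the chord saves both crossings and makes `D v` less than `D
  -- (v + dir j)`.
  obtain ⟨w, i, h1, h2, h3, h4, -, h6⟩ := hD.exists_cross (fun _ => True)
    (fun _ _ _ _ _ _ => trivial) hvj hne trivial
  have hvne : g v ≠ g (v + dir j) := fun h => (hg v j hv hvj).1 h hc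
  have hwc : InChord P p k w i := by
    by_contra h
    exact h3 (((hg w i h1 h2).2 h).trans h4)
  have e : k + 2 + 2 = k := by rw [add_assoc]; exact add_zero k
  rcases hc with ⟨rfl, hc⟩ | ⟨rfl, hc⟩ <;> rcases hwc with ⟨rfl, hw⟩ | ⟨rfl, hw⟩
  · exact h3 ((eq_on_chord hg hw).trans ((eq_on_chord hg hc).symm.trans
      (eq_of_ne_of_ne hvne (Ne.symm hne))))
  · have h7 := hD.le_of_chord (o := 0) (fun q hq => by
      rw [add_zero]
      exact (mem_of_mem_chord hq).1) hc hw
    have h8 := add_dir_add_dir w (j + 2)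
    rw [e] at h8
    rw [← h8, cellDist_add_right] at h6
    rw [h8] at h6
    simp only [add_zero] at h7
    omega
  · have h7 := hD.le_of_chord (o := dir i) (fun q hq => (mem_of_mem_chord hq).2) hc hw
    have h8 := add_dir_add_dir v (i + 2)
    rw [e] at h8
    rw [h8] at h7
    omega
  · exact hne ((eq_on_chord hg hc).trans ((eq_on_chord hg hw).symm.trans h4))

theorem IsDistance.side_step (hD : IsDistance P z D) (hg : ∀ q j, q ∈ P → q + dir j ∈ P →
    (g q = g (q + dir j) ↔ ¬ InChord P p k q j)) (v : ℤ × ℤ) (j : ZMod 4)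
    (hv : v ∈ P) (hvj : v + dir j ∈ P) (hlt : D (v + dir j) < D v) (h : g v = g z) :
    g (v + dir j) = g z := by
  by_cases hc : InChord P p k v j
  · exact hD.eq_of_lt hg hv hvj hlt hc
  · rw [← (hg v j hv hvj).2 hc, h]

/-- If two steps from `s` lead towards `z`, then the chord across the second step contains an edge
on the other side of the first chord. -/
theorem IsDistance.exists_mem_chord (hD : IsDistance P z D) (hsep : ChordsSeparate P)
    {s : ℤ × ℤ} {k j : ZMod 4} (hs : s ∈ P) (hk : s + dir k ∈ P) (hj : s + dir j ∈ P)
    (hkl : D (s + dir k) < D s) (hjl : D (s + dir j) < D s) (hnot : ¬ InChord P s j s k) :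
    ∃ g : ℤ × ℤ → ZMod 2, (∀ q i, q ∈ P → q + dir i ∈ P →
      (g q = g (q + dir i) ↔ ¬ InChord P s k q i)) ∧ ∃ w ∈ chord P s j, g w ≠ g s := by
  obtain ⟨g₁, hg₁⟩ := hsep s k hs hk
  obtain ⟨g₂, hg₂⟩ := hsep s j hs hj
  have hc₁ : InChord P s k s k := Or.inl ⟨rfl, self_mem_chord hs hk⟩
  have hc₂ : InChord P s j s j := Or.inl ⟨rfl, self_mem_chord hs hj⟩
  have e₁ := hD.eq_of_lt hg₁ hs hk hkl hc₁
  have e₂ := hD.eq_of_lt hg₂ hs hj hjl hc₂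
  have n₁ : g₁ s ≠ g₁ z := e₁ ▸ fun h => (hg₁ s k hs hk).1 h hc₁
  have n₂ : g₂ s ≠ g₂ z := e₂ ▸ fun h => (hg₂ s j hs hj).1 h hc₂
  -- After the first step the way to `z` stays beyond the first chord, by `side_step`. It still has
  -- to cross the second chord, since `s + dir k` is on the same side of that chord as `s`.
  obtain ⟨w, i, h1, h2, h3, h4, h5, -⟩ := hD.exists_cross (g := g₂) (fun v => g₁ v = g₁ z)
    (hD.side_step hg₁) hk (by rwa [← (hg₂ s k hs hk).2 hnot]) e₁
  have hwc : InChord P s j w i := by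
    by_contra h
    exact h3 (((hg₂ w i h1 h2).2 h).trans h4)
  refine ⟨g₁, hg₁, w, ?_, h5 ▸ n₁.symm⟩
  rcases hwc with ⟨rfl, hw⟩ | ⟨rfl, hw⟩
  · exact hw
  · exact absurd ((eq_on_chord hg₂ hw).symm.trans h4) n₂

theorem add_dir_notMem_chord (s : ℤ × ℤ) (k : ZMod 4) : s + dir k ∉ chord P s (k + 2) := by
  rintro ⟨t, h, -⟩
  rw [add_left_cancel_iff, Prod.ext_iff] at h
  rcases zmod_four_cases k with rfl | rfl | rfl | rfl
  · change (0 : ℤ) = t * 1 ∧ (1 : ℤ) = t * 0 at h; omega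
  · change (-1 : ℤ) = t * 0 ∧ (0 : ℤ) = t * 1 at h; omega
  · change (0 : ℤ) = t * (-1) ∧ (-1 : ℤ) = t * 0 at h; omega
  · change (1 : ℤ) = t * 0 ∧ (0 : ℤ) = t * (-1) at h; omega

theorem eq_of_mem_chord_of_mem_chord {s q : ℤ × ℤ} {k j : ZMod 4} (hj : j = k + 1 ∨ j = k + 3)
    (h1 : q ∈ chord P s k) (h2 : q ∈ chord P s j) : q = s := by
  obtain ⟨t, rfl, -⟩ := h1
  obtain ⟨t', h, -⟩ := h2
  have : t = 0 := by
    rw [add_left_cancel_iff, Prod.ext_iff] at h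
    simp only [Prod.smul_fst, Prod.smul_snd, smul_eq_mul] at h
    have e : ∀ k j : ZMod 4, j = k + 1 ∨ j = k + 3 →
        ((dir (k + 1)).1 = 0 ∧ (dir (j + 1)).2 = 0 ∧ (dir (k + 1)).2 ≠ 0) ∨
        ((dir (k + 1)).2 = 0 ∧ (dir (j + 1)).1 = 0 ∧ (dir (k + 1)).1 ≠ 0) := by decide
    rcases e k j hj with ⟨h1, h2, h3⟩ | ⟨h1, h2, h3⟩
    · rw [h2, mul_zero] at h
      exact (mul_eq_zero.1 h.2).resolve_right h3
    · rw [h2, mul_zero] at h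
      exact (mul_eq_zero.1 h.1).resolve_right h3
  rw [this, zero_smul, add_zero]

/-- Steps through opposite edges do not both lead towards `z`. -/
theorem IsDistance.not_collinear (hD : IsDistance P z D) (hsep : ChordsSeparate P)
    {s : ℤ × ℤ} {k : ZMod 4} (hs : s ∈ P) (hk : s + dir k ∈ P) (hj : s + dir (k + 2) ∈ P)
    (hkl : D (s + dir k) < D s) (hjl : D (s + dir (k + 2)) < D s) : False := by
  have e1 : ∀ k : ZMod 4, k ≠ k + 2 := by decide
  obtain ⟨g, hg, w, hw, hgw⟩ := hD.exists_mem_chord hsep hs hk hj hkl hjl (by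
    rintro (⟨h, -⟩ | ⟨-, h⟩)
    · exact e1 k h
    · exact add_dir_notMem_chord s k h)
  -- The two chords are parallel, so walking along the second never crosses the first.
  refine hgw (chord_induction (Φ := fun q => g q = g s) rfl (fun q i hi h1 h2 h3 => ?_) hw)
  rw [← h3]
  refine ((hg q i (mem_of_mem_chord h1).1 (mem_of_mem_chord h2).1).2 ?_).symm
  have e : ∀ i k : ZMod 4, i = k + 2 + 1 ∨ i = k + 2 + 3 → i ≠ k ∧ i ≠ k + 2 := by decide
  rintro (⟨h, -⟩ | ⟨h, -⟩)
  · exact (e i k hi).1 h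
  · exact (e i k hi).2 h

/-- If steps through two consecutive edges lead towards `z`, then they span a square of cells. -/
theorem IsDistance.orthogonal (hD : IsDistance P z D) (hsep : ChordsSeparate P)
    {s : ℤ × ℤ} {k j : ZMod 4} (hkj : j = k + 1 ∨ j = k + 3) (hs : s ∈ P) (hk : s + dir k ∈ P)
    (hj : s + dir j ∈ P) (hkl : D (s + dir k) < D s) (hjl : D (s + dir j) < D s) :
    s + dir k + dir j ∈ P := by
  by_contra hout
  have e1 : ∀ j k : ZMod 4, j = k + 1 ∨ j = k + 3 → k ≠ j ∧ k ≠ j + 2 := by decide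
  obtain ⟨g, hg, w, hw, hgw⟩ := hD.exists_mem_chord hsep hs hk hj hkl hjl (by
    rintro (⟨h, -⟩ | ⟨h, -⟩)
    · exact (e1 j k hkj).1 h
    · exact (e1 j k hkj).2 h)
  have hu : s + dir k ∉ chord P s j := fun h => hout (mem_of_mem_chord h).2
  -- Perpendicular chords can cross only between `s` and `s + dir k`, and the latter is not on the
  -- second chord because the fourth cell is missing.
  refine hgw (chord_induction (Φ := fun q => g q = g s) rfl (fun q i _ h1 h2 h3 => ?_) hw)
  rw [← h3]
  refine ((hg q i (mem_of_mem_chord h1).1 (mem_of_mem_chord h2).1).2 ?_).symm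
  rintro (⟨rfl, h⟩ | ⟨rfl, h⟩)
  · have := eq_of_mem_chord_of_mem_chord hkj h h1
    rw [this] at h2
    exact hu h2
  · have := eq_of_mem_chord_of_mem_chord hkj h h2
    have e2 := add_dir_add_dir q (k + 2)
    have e : k + 2 + 2 = k := by rw [add_assoc]; exact add_zero k
    rw [this, e] at e2
    rw [e2] at hu
    exact hu h1

/-- In a square of cells, opposite steps do not both lead towards `z`. -/
theorem IsDistance.not_antiparallel (hD : IsDistance P z D) (hsep : ChordsSeparate P)
    {s : ℤ × ℤ} {k j : ZMod 4} (hkj : j = k + 1 ∨ j = k + 3) (hs : s ∈ P) (hk : s + dir k ∈ P)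
    (hj : s + dir j ∈ P) (hjk : s + dir j + dir k ∈ P) (hkl : D (s + dir k) < D s)
    (hjl : D (s + dir j) < D (s + dir j + dir k)) : False := by
  obtain ⟨g, hg⟩ := hsep s k hs hk
  have hc : InChord P s k s k := Or.inl ⟨rfl, self_mem_chord hs hk⟩
  have hjc : s + dir j ∈ chord P s k := add_dir_mem_chord (self_mem_chord hs hk) hkj hj hjk
  -- Both steps cross the same chord, in opposite senses, yet both should end on the side of `z`.
  have e1 := hD.eq_of_lt hg hs hk hkl hc
  have e := add_dir_add_dir (s + dir j) k
  have e2 := hD.eq_of_lt hg (v := s + dir j + dir k) (j := k + 2) hjk (by rwa [e]) (by rwa [e])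
    (Or.inr ⟨rfl, by rwa [e]⟩)
  rw [e, eq_on_chord hg hjc, ← e1] at e2
  exact (hg s k hs hk).1 e2 hc

end Distance

/-! ### Polyominoes as graphs -/

theorem gridGraph_adj_iff {u v : ℤ × ℤ} : gridGraph.Adj u v ↔ ∃ k, v = u + dir k := by
  constructor
  · intro h
    change |u.1 - v.1| + |u.2 - v.2| = 1 at h
    have : (v.1 = u.1 ∧ v.2 = u.2 + 1) ∨ (v.1 = u.1 - 1 ∧ v.2 = u.2) ∨
        (v.1 = u.1 ∧ v.2 = u.2 - 1) ∨ (v.1 = u.1 + 1 ∧ v.2 = u.2) := by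
      rcases abs_cases (u.1 - v.1) with h1 | h1 <;> rcases abs_cases (u.2 - v.2) with h2 | h2 <;>
        omega
    rcases this with ⟨h1, h2⟩ | ⟨h1, h2⟩ | ⟨h1, h2⟩ | ⟨h1, h2⟩
    · exact ⟨0, Prod.ext (by rw [h1]; exact (add_zero _).symm) h2⟩
    · exact ⟨1, Prod.ext h1 (by rw [h2]; exact (add_zero _).symm)⟩
    · exact ⟨2, Prod.ext (by rw [h1]; exact (add_zero _).symm) h2⟩
    · exact ⟨3, Prod.ext h1 (by rw [h2]; exact (add_zero _).symm)⟩
  · rintro ⟨k, rfl⟩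
    change |u.1 - (u.1 + (dir k).1)| + |u.2 - (u.2 + (dir k).2)| = 1
    rw [sub_add_cancel_left, sub_add_cancel_left, abs_neg, abs_neg, abs_dir]

theorem gridGraph_adj_add_dir (u : ℤ × ℤ) (k : ZMod 4) : gridGraph.Adj u (u + dir k) :=
  gridGraph_adj_iff.2 ⟨k, rfl⟩

theorem gridGraph_adj_parity {u v : ℤ × ℤ} (h : gridGraph.Adj u v) :
    (u.1 + u.2 - (v.1 + v.2)) % 2 = 1 := by
  change |u.1 - v.1| + |u.2 - v.2| = 1 at h
  rcases abs_cases (u.1 - v.1) with h1 | h1 <;> rcases abs_cases (u.2 - v.2) with h2 | h2 <;> omega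

variable {P : Finset (ℤ × ℤ)}

theorem IsPolyomino.nonempty (hP : IsPolyomino P) : P.Nonempty := by
  have h : (gridGraph.induce (P : Set (ℤ × ℤ))).Connected := hP
  obtain ⟨⟨p, hp⟩⟩ := h.nonempty
  exact ⟨p, hp⟩

theorem IsPolyomino.connectedCells (hP : IsPolyomino P) : ConnectedCells P := by
  intro A hA p hp q hq
  obtain ⟨w⟩ := hP.preconnected ⟨p, hp⟩ ⟨q, hq⟩
  have key : ∀ u v : (P : Set (ℤ × ℤ)),
      (gridGraph.induce (P : Set (ℤ × ℤ))).Walk u v → A u = A v := by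
    intro u v w
    induction w with
    | nil => rfl
    | @cons u v _ h _ ih =>
      rw [← ih]
      obtain ⟨k, hk⟩ := gridGraph_adj_iff.1 (SimpleGraph.induce_adj.1 h)
      rw [hk]
      exact hA _ _ u.2 (hk ▸ v.2)
  exact key _ _ w

open scoped Classical in
theorem IsPolyomino.exists_isDistance (hP : IsPolyomino P) {z : ℤ × ℤ} (hz : z ∈ P) :
    ∃ D, IsDistance P z D := by
  let G := gridGraph.induce (P : Set (ℤ × ℤ))
  have hG : G.Connected := hP
  let z' : (P : Set (ℤ × ℤ)) := ⟨z, hz⟩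
  let D : ℤ × ℤ → ℕ := fun u => if h : u ∈ P then G.dist ⟨u, h⟩ z' else 0
  have hD : ∀ u (h : u ∈ P), D u = G.dist ⟨u, h⟩ z' := fun u h => dif_pos h
  -- The grid is bipartite: the parity of the length of a walk depends only on its ends. Hence
  -- adjacent cells have different distances to `z`.
  have hpar : ∀ u v : (P : Set (ℤ × ℤ)), ∀ w : G.Walk u v,
      (w.length : ℤ) % 2 = (u.1.1 + u.1.2 - (v.1.1 + v.1.2)) % 2 := by
    intro u v w
    induction w with
    | nil => simp
    | cons h _ ih =>
      have := gridGraph_adj_parity (SimpleGraph.induce_adj.1 h)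
      rw [SimpleGraph.Walk.length_cons]
      push_cast
      omega
  have hstep : ∀ u v : (P : Set (ℤ × ℤ)), u ≠ v → ∀ w : G.Walk u v,
      ∃ x, G.Adj u x ∧ G.dist x v < w.length := by
    rintro u v hne (_ | ⟨h, w⟩)
    · exact absurd rfl hne
    · exact ⟨_, h, Nat.lt_succ_of_le (SimpleGraph.dist_le w)⟩
  refine ⟨D, ?_, ?_, ?_, ?_⟩
  · rw [hD z hz]
    exact SimpleGraph.dist_self
  · intro p k h1 h2
    rw [hD p h1, hD _ h2]
    have hadj : G.Adj ⟨p, h1⟩ ⟨p + dir k, h2⟩ := gridGraph_adj_add_dir p k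
    have := hG.dist_triangle (u := ⟨p, h1⟩) (v := ⟨p + dir k, h2⟩) (w := z')
    rw [SimpleGraph.dist_eq_one_iff_adj.2 hadj] at this
    omega
  · intro p k h1 h2
    rw [hD p h1, hD _ h2]
    obtain ⟨w1, hw1⟩ := hG.exists_walk_length_eq_dist ⟨p, h1⟩ z'
    obtain ⟨w2, hw2⟩ := hG.exists_walk_length_eq_dist ⟨p + dir k, h2⟩ z'
    have e1 := hpar _ _ w1
    have e2 := hpar _ _ w2
    have e3 := gridGraph_adj_parity (gridGraph_adj_add_dir p k)
    rw [← hw1, ← hw2]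
    intro h
    rw [h] at e1
    simp only at e1 e2 e3
    omega
  · intro p h1 hne
    obtain ⟨w, hw⟩ := hG.exists_walk_length_eq_dist ⟨p, h1⟩ z'
    obtain ⟨v, h, hlt⟩ := hstep _ _ (fun h => hne (congrArg Subtype.val h)) w
    obtain ⟨k, hk⟩ := gridGraph_adj_iff.1 (SimpleGraph.induce_adj.1 h)
    have hk' : p + dir k ∈ P := hk ▸ v.2
    refine ⟨k, hk', ?_⟩
    have hv : v = ⟨p + dir k, hk'⟩ := Subtype.ext hk
    rwa [hD p h1, hD _ hk', ← hw, ← hv]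

/-! ### Layouts -/

/-- A folding that preserves the orientation: the corner `k` of the cell `p` is carried to the
corner `turn p + k` of a square of the box. -/
structure Layout (P : Finset (ℤ × ℤ)) (D : Fin 3 → ℕ) where
  /-- the square covered by a cell -/
  F : P ≃ BoxSquare D
  /-- the rotation of a cell -/
  turn : P → ZMod 4
  glued : ∀ (p q : P) k, (q : ℤ × ℤ) = p + dir k →
    (F p).Glued (turn p + k) (F q) (turn q + k + 2)

theorem cellCorner_dir (p : ℤ × ℤ) (k : ZMod 4) :
    cellCorner p k = cellCorner (p + dir k) (k + 3) ∧
      cellCorner p (k + 1) = cellCorner (p + dir k) (k + 2) := by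
  have h : ∀ k : ZMod 4, offX k = (dir k).1 + offX (k + 3) ∧ offY k = (dir k).2 + offY (k + 3) ∧
      offX (k + 1) = (dir k).1 + offX (k + 2) ∧ offY (k + 1) = (dir k).2 + offY (k + 2) := by decide
  obtain ⟨h1, h2, h3, h4⟩ := h k
  simp only [cellCorner, Prod.fst_add, Prod.snd_add, add_assoc, ← h1, ← h2, ← h3, ← h4, and_self]

/-! ### Orientation of a folding -/

section Folding

variable {D : Fin 3 → ℕ} (φ : Folding P D)

theorem Folding.place_eq {p q : P} {k : ZMod 4} (h : (q : ℤ × ℤ) = p + dir k) :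
    φ.place p k = φ.place q (k + 3) ∧ φ.place p (k + 1) = φ.place q (k + 2) := by
  have hadj : gridGraph.Adj (p : ℤ × ℤ) q := gridGraph_adj_iff.2 ⟨k, h⟩
  exact ⟨φ.attached p q hadj _ _ (h ▸ (cellCorner_dir p k).1),
    φ.attached p q hadj _ _ (h ▸ (cellCorner_dir p k).2)⟩

/-- Adjacent cells are carried to the box with the same orientation. -/
theorem Folding.not_opposite (hD : ∀ i, 0 < D i) {p q : P} {k : ZMod 4}
    (h : (q : ℤ × ℤ) = p + dir k) {a b : ZMod 4} (hp : ∀ k, φ.place p k = (φ.F p).corner (a + k))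
    (hq : ∀ k, φ.place q k = (φ.F q).corner (b - k)) : False := by
  obtain ⟨h1, h2⟩ := φ.place_eq h
  rw [hp, hq] at h1 h2
  have e1 : a + (k + 1) = a + k + 1 := (add_assoc _ _ _).symm
  have e2 : b - (k + 2) = b - (k + 3) + 1 := by ring
  rw [e1, e2] at h2
  -- With opposite orientations both squares would traverse the common edge in the same direction
  -- and so coincide.
  have := φ.F.injective (eq_of_edge hD h1 h2).1
  rw [← this] at h
  exact dir_ne_zero k (by simpa using h.symm)

/-- By `not_opposite` the kind of isometry is the same for adjacent cells, hence for all cells of a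
connected `P`. -/
theorem Folding.orientation (hD : ∀ i, 0 < D i) (hP : IsPolyomino P) :
    (∃ a : P → ZMod 4, ∀ p k, φ.place p k = (φ.F p).corner (a p + k)) ∨
      ∃ a : P → ZMod 4, ∀ p k, φ.place p k = (φ.F p).corner (a p - k) := by
  classical
  let Pos : P → Prop := fun p => ∃ a : ZMod 4, ∀ k, φ.place p k = (φ.F p).corner (a + k)
  have hneg : ∀ p, ¬ Pos p → ∃ a : ZMod 4, ∀ k, φ.place p k = (φ.F p).corner (a - k) := by
    intro p hp
    obtain ⟨a, h | h⟩ := φ.isometric p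
    · exact absurd ⟨a, h⟩ hp
    · exact ⟨a, h⟩
  let A : ℤ × ℤ → ZMod 2 := fun u => if ∃ h : u ∈ P, Pos ⟨u, h⟩ then 1 else 0
  have hA : ∀ u (h : u ∈ P), A u = 1 ↔ Pos ⟨u, h⟩ := by
    intro u h
    simp only [A, ite_eq_left_iff, zero_ne_one, imp_false, not_not]
    exact ⟨fun ⟨_, h⟩ => h, fun h' => ⟨h, h'⟩⟩
  have hstep : ∀ p q : P, ∀ k, (q : ℤ × ℤ) = p + dir k → Pos p → Pos q := by
    intro p q k h ⟨a, ha⟩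
    by_contra hq
    obtain ⟨b, hb⟩ := hneg q hq
    exact φ.not_opposite hD h ha hb
  have hconst := hP.connectedCells A (fun p k h1 h2 => by
    have h3 := hstep ⟨p, h1⟩ ⟨p + dir k, h2⟩ k rfl
    have h4 := hstep ⟨p + dir k, h2⟩ ⟨p, h1⟩ (k + 2) (add_dir_add_dir p k).symm
    rw [← hA, ← hA] at h3 h4
    generalize A p = x at *
    generalize A (p + dir k) = y at *
    clear * - h3 h4
    decide +revert)
  obtain ⟨p₀, hp₀⟩ := hP.nonempty
  by_cases h : Pos ⟨p₀, hp₀⟩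
  · have : ∀ p, Pos p := fun p => (hA _ p.2).1 ((hconst p p.2 p₀ hp₀).trans ((hA _ hp₀).2 h))
    choose a ha using this
    exact Or.inl ⟨a, ha⟩
  · have : ∀ p, ¬ Pos p := fun p hp => h ((hA _ hp₀).1 ((hconst p₀ hp₀ p p.2).trans ((hA _ p.2).2 hp)))
    choose a ha using fun p => hneg p (this p)
    exact Or.inr ⟨a, ha⟩

theorem swap_dir : ∀ k, (dir k).swap = dir (-k - 1) := by decide

theorem gridGraph_adj_swap (u v : ℤ × ℤ) : gridGraph.Adj u.swap v.swap ↔ gridGraph.Adj u v := by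
  change |u.2 - v.2| + |u.1 - v.1| = 1 ↔ |u.1 - v.1| + |u.2 - v.2| = 1
  rw [add_comm]

/-- Up to a reflection of the polyomino, a folding preserves the orientation. -/
theorem Folding.exists_layout (hD : ∀ i, 0 < D i) (hP : IsPolyomino P) :
    ∃ (P' : Finset (ℤ × ℤ)) (L : Layout P' D), IsPolyomino P' ∧ ∀ s t,
      gridGraph.Adj (L.F.symm s : ℤ × ℤ) (L.F.symm t : ℤ × ℤ) ↔
        gridGraph.Adj (φ.F.symm s : ℤ × ℤ) (φ.F.symm t : ℤ × ℤ) := by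
  rcases φ.orientation hD hP with ⟨a, ha⟩ | ⟨a, ha⟩
  · refine ⟨P, ⟨φ.F, a, fun p q k h => ?_⟩, hP, fun s t => Iff.rfl⟩
    obtain ⟨h1, h2⟩ := φ.place_eq h
    rw [ha, ha] at h1 h2
    have e1 : a q + (k + 3) = a q + k + 2 + 1 := by ring
    rw [e1] at h1
    rw [← add_assoc, ← add_assoc] at h2
    exact ⟨h1, h2⟩
  · let P' : Finset (ℤ × ℤ) := P.map (Equiv.prodComm ℤ ℤ).toEmbedding
    have hmem : ∀ u : ℤ × ℤ, u ∈ P ↔ (Equiv.prodComm ℤ ℤ) u ∈ P' := fun u => by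
      simp [P', Prod.swap]
    let σ : P ≃ P' := (Equiv.prodComm ℤ ℤ).subtypeEquiv hmem
    have hσ : ∀ p, (σ.symm p : ℤ × ℤ) = (p : ℤ × ℤ).swap := fun p => rfl
    refine ⟨P', ⟨σ.symm.trans φ.F, fun p => a (σ.symm p), fun p q k h => ?_⟩, ?_, fun s t => ?_⟩
    · have h' : (σ.symm q : ℤ × ℤ) = σ.symm p + dir (-k - 1) := by
        rw [hσ, hσ, h, Prod.swap_add, swap_dir]
      obtain ⟨h1, h2⟩ := φ.place_eq h'
      rw [ha, ha] at h1 h2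
      have e1 : a (σ.symm p) - (-k - 1) = a (σ.symm p) + k + 1 := by ring
      have e2 : a (σ.symm p) - (-k - 1 + 1) = a (σ.symm p) + k := by ring
      have e3 : a (σ.symm q) - (-k - 1 + 3) = a (σ.symm q) + k + 2 := by
        generalize a (σ.symm q) = x
        clear * -
        decide +revert
      have e4 : a (σ.symm q) - (-k - 1 + 2) = a (σ.symm q) + k + 2 + 1 := by
        generalize a (σ.symm q) = x
        clear * -
        decide +revert
      rw [e1, e3] at h1
      rw [e2, e4] at h2
      exact ⟨h2, h1⟩
    · have iso : gridGraph.induce (P : Set (ℤ × ℤ)) ≃g gridGraph.induce (P' : Set (ℤ × ℤ)) :=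
        ⟨σ, fun {u v} => gridGraph_adj_swap u v⟩
      exact iso.connected_iff.1 hP
    · change gridGraph.Adj (φ.F.symm s : ℤ × ℤ).swap (φ.F.symm t : ℤ × ℤ).swap ↔ _
      exact gridGraph_adj_swap _ _

end Folding

namespace Layout

variable {D : Fin 3 → ℕ} (L : Layout P D)

/-- The corner of a square of the box that is covered by a corner of a cell. -/
def flag : P × ZMod 4 ≃ BoxSquare D × ZMod 4 where
  toFun f := (L.F f.1, L.turn f.1 + f.2)
  invFun g := (L.F.symm g.1, g.2 - L.turn (L.F.symm g.1))
  left_inv f := by simp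
  right_inv g := by simp

theorem flag_apply (p : P) (k : ZMod 4) : L.flag (p, k) = (L.F p, L.turn p + k) := rfl

/-- The rotation of the corners of the cells about the vertices of the box. -/
noncomputable def rot (hD : ∀ i, 0 < D i) : Equiv.Perm (P × ZMod 4) :=
  L.flag.symm.permCongr (rotate hD)

theorem flag_rot (hD : ∀ i, 0 < D i) (f : P × ZMod 4) :
    L.flag (L.rot hD f) = rotate hD (L.flag f) := by
  simp [rot, Equiv.permCongr_apply]

theorem rot_eq_iff (hD : ∀ i, 0 < D i) {f g : P × ZMod 4} :
    L.rot hD f = g ↔ rotate hD (L.flag f) = L.flag g := by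
  rw [← flag_rot, L.flag.apply_eq_iff_eq]

/-- The surface of the box as a surface obtained from `P`. -/
noncomputable def cornerRotation (hD : ∀ i, 0 < D i) : CornerRotation P where
  rot := L.rot hD
  planar p q k h := by
    rw [rot_eq_iff, flag_apply, flag_apply, rotate_eq hD (L.glued p q k h)]
    refine Prod.ext rfl ?_
    simp only
    ring
  edge f := by
    have h : L.flag ((L.rot hD f).1, (L.rot hD f).2 - 1) = glue hD (L.flag f) := by
      have h1 := L.flag_rot hD f
      rw [← Prod.mk.eta (p := L.rot hD f), flag_apply] at h1
      have h2 : rotate hD (L.flag f) = ((glue hD (L.flag f)).1, (glue hD (L.flag f)).2 + 1) := rfl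
      rw [h2, Prod.mk.injEq] at h1
      rw [flag_apply]
      refine Prod.ext h1.1 ?_
      rw [← add_sub_assoc, h1.2, add_sub_cancel_right]
    rw [rot_eq_iff, h]
    change ((glue hD (glue hD (L.flag f))).1, (glue hD (glue hD (L.flag f))).2 + 1) = _
    rw [glue_glue, flag_apply]
    exact Prod.ext rfl (add_assoc _ _ _)
  three_or_four f := by
    simp only [rot_eq_iff, flag_rot]
    exact rotate_pow_eq hD (L.flag f)
  ne f := by
    rw [Ne, rot_eq_iff]
    exact rotate_ne hD _
  two_ne f := by
    rw [Ne, rot_eq_iff, flag_rot]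
    exact rotate_rotate_ne hD _

open scoped Classical in
theorem card_three (hD : ∀ i, 0 < D i) :
    24 ≤ (Finset.univ.filter (L.cornerRotation hD).Three).card := by
  obtain ⟨φ, hφ, h3⟩ := exists_injective_corner hD
  have h24 : (Finset.univ : Finset (Fin 3 × (Fin 3 → Bool))).card = 24 := by
    simp
  rw [← h24]
  refine Finset.card_le_card_of_injOn (fun x => L.flag.symm (φ x)) (fun x _ => ?_)
    (fun x _ y _ h => hφ (L.flag.symm.injective h))
  simp only [Finset.coe_filter, Finset.mem_univ, true_and, Set.mem_ofPred_eq]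
  change L.rot hD (L.rot hD (L.rot hD _)) = _
  rw [rot_eq_iff, flag_rot, flag_rot, Equiv.apply_symm_apply]
  exact h3 x

theorem chordsSeparate (L : Layout P D) (hD : ∀ i, 0 < D i) (hP : IsPolyomino P) : ChordsSeparate P :=
  (L.cornerRotation hD).chordsSeparate hP.nonempty hP.connectedCells (L.card_three hD)

/-- If the squares that follow each other at a vertex are covered by adjacent cells, then these cells
follow each other in the plane. -/
theorem eq_of_rot_eq (hD : ∀ i, 0 < D i) {f g : P × ZMod 4} (h : L.rot hD f = g)
    (hadj : gridGraph.Adj (f.1 : ℤ × ℤ) g.1) :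
    (g.1 : ℤ × ℤ) = f.1 + dir f.2 ∧ g.2 = f.2 + 3 := by
  obtain ⟨k, hk⟩ := gridGraph_adj_iff.1 hadj
  have h1 := L.glued _ _ k hk
  have h2 := glue_spec hD (L.flag f)
  have h3 := (L.flag_rot hD f).symm.trans (congrArg L.flag h)
  have h4 : (glue hD (L.flag f)).1 = L.F g.1 := congrArg Prod.fst h3
  rw [h4] at h2
  have h5 : k = f.2 := add_left_cancel (h1.unique_edge hD h2).1
  subst h5
  have h6 := (L.cornerRotation hD).planar _ _ _ hk
  have h7 := h.symm.trans h6
  exact ⟨hk, by rw [h7]⟩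

/-- Four consecutive squares at a vertex, covered by a path of four cells. -/
theorem square_of_rot (hD : ∀ i, 0 < D i) {f₀ f₁ f₂ f₃ : P × ZMod 4} (h0 : L.rot hD f₀ = f₁)
    (h1 : L.rot hD f₁ = f₂) (h2 : L.rot hD f₂ = f₃) (a0 : gridGraph.Adj (f₀.1 : ℤ × ℤ) f₁.1)
    (a1 : gridGraph.Adj (f₁.1 : ℤ × ℤ) f₂.1) (a2 : gridGraph.Adj (f₂.1 : ℤ × ℤ) f₃.1) :
    (f₁.1 : ℤ × ℤ) = f₀.1 + dir f₀.2 ∧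
      (f₂.1 : ℤ × ℤ) = f₀.1 + dir f₀.2 + dir (f₀.2 + 3) ∧
      (f₃.1 : ℤ × ℤ) = f₀.1 + dir (f₀.2 + 3) := by
  obtain ⟨e0, k0⟩ := L.eq_of_rot_eq hD h0 a0
  obtain ⟨e1, k1⟩ := L.eq_of_rot_eq hD h1 a1
  obtain ⟨e2, k2⟩ := L.eq_of_rot_eq hD h2 a2
  rw [k0] at e1
  rw [e0] at e1
  have hk : f₂.2 = f₀.2 + 2 := by
    rw [k1, k0]
    generalize f₀.2 = k
    clear * -
    decide +revert
  refine ⟨e0, e1, ?_⟩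
  rw [e2, e1, hk, add_right_comm, add_dir_add_dir]

theorem adj_of_rot (hD : ∀ i, 0 < D i) {f₀ f₁ f₂ f₃ : P × ZMod 4} (h0 : L.rot hD f₀ = f₁)
    (h1 : L.rot hD f₁ = f₂) (h2 : L.rot hD f₂ = f₃) (a0 : gridGraph.Adj (f₀.1 : ℤ × ℤ) f₁.1)
    (a1 : gridGraph.Adj (f₁.1 : ℤ × ℤ) f₂.1) (a2 : gridGraph.Adj (f₂.1 : ℤ × ℤ) f₃.1) :
    gridGraph.Adj (f₃.1 : ℤ × ℤ) f₀.1 := by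
  obtain ⟨-, -, e⟩ := L.square_of_rot hD h0 h1 h2 a0 a1 a2
  rw [e]
  exact (gridGraph_adj_add_dir _ _).symm

/-- Both senses are needed because a block may be listed with or against the rotation about its
centre. -/
theorem not_antiparallel (hD : ∀ i, 0 < D i) (hP : IsPolyomino P) {z : ℤ × ℤ} {d : ℤ × ℤ → ℕ}
    (hd : IsDistance P z d) {f₀ f₁ f₂ f₃ : P × ZMod 4} (h0 : L.rot hD f₀ = f₁)
    (h1 : L.rot hD f₁ = f₂) (h2 : L.rot hD f₂ = f₃) (a0 : gridGraph.Adj (f₀.1 : ℤ × ℤ) f₁.1)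
    (a1 : gridGraph.Adj (f₁.1 : ℤ × ℤ) f₂.1) (a2 : gridGraph.Adj (f₂.1 : ℤ × ℤ) f₃.1) :
    ¬ (d f₁.1 < d f₀.1 ∧ d f₃.1 < d f₂.1) ∧ ¬ (d f₀.1 < d f₁.1 ∧ d f₂.1 < d f₃.1) := by
  have hsep := L.chordsSeparate hD hP
  obtain ⟨e1, e2, e3⟩ := L.square_of_rot hD h0 h1 h2 a0 a1 a2
  have m0 := f₀.1.2
  have m1 := f₁.1.2
  have m2 := f₂.1.2
  have m3 := f₃.1.2
  constructor
  · rintro ⟨l1, l2⟩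
    rw [e1] at l1 m1
    rw [e2, add_right_comm] at l2 m2
    rw [e3] at l2 m3
    exact hd.not_antiparallel hsep (Or.inr rfl) m0 m1 m3 m2 l1 l2
  · rintro ⟨l1, l2⟩
    have e0 : (f₀.1 : ℤ × ℤ) = f₁.1 + dir (f₀.2 + 2) := by rw [e1, add_dir_add_dir]
    have e2' : (f₂.1 : ℤ × ℤ) = f₁.1 + dir (f₀.2 + 3) := by rw [e2, e1]
    have e3' : (f₃.1 : ℤ × ℤ) = f₁.1 + dir (f₀.2 + 3) + dir (f₀.2 + 2) := by
      rw [e3, e1, add_right_comm _ (dir (f₀.2 + 3)), add_dir_add_dir]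
    rw [e0] at l1 m0
    rw [e2'] at l2 m2
    rw [e3'] at l2 m3
    have ek : ∀ k : ZMod 4, k + 3 = k + 2 + 1 := by decide
    exact hd.not_antiparallel hsep (Or.inl (ek _)) m1 m0 m2 m3 l1 l2

/-- The fourth cell exists by `IsDistance.orthogonal`, and planarity of the rotation identifies it
with the cell of `f₂`. Nothing is required of `L.rot hD f₂`, so the case `f₂ = f₃` at a corner of
the box is included. -/
theorem orthogonal (hD : ∀ i, 0 < D i) (hP : IsPolyomino P) {z : ℤ × ℤ} {d : ℤ × ℤ → ℕ}
    (hd : IsDistance P z d) {f₀ f₁ f₂ f₃ : P × ZMod 4} (h0 : L.rot hD f₀ = f₁)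
    (h1 : L.rot hD f₁ = f₂) (h3 : L.rot hD f₃ = f₀) (a0 : gridGraph.Adj (f₀.1 : ℤ × ℤ) f₁.1)
    (a3 : gridGraph.Adj (f₀.1 : ℤ × ℤ) f₃.1) (l1 : d f₁.1 < d f₀.1) (l3 : d f₃.1 < d f₀.1) :
    gridGraph.Adj (f₁.1 : ℤ × ℤ) f₂.1 ∧ gridGraph.Adj (f₃.1 : ℤ × ℤ) f₂.1 := by
  have hsep := L.chordsSeparate hD hP
  obtain ⟨e0, k0⟩ := L.eq_of_rot_eq hD h0 a0
  obtain ⟨e3, k3⟩ := L.eq_of_rot_eq hD h3 a3.symm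
  have hk : f₃.2 + 2 = f₀.2 + 3 := by
    rw [k3]
    generalize f₃.2 = k
    clear * -
    decide +revert
  have e3' : (f₃.1 : ℤ × ℤ) = f₀.1 + dir (f₀.2 + 3) := by
    rw [← hk, e3, add_dir_add_dir]
  have m1 := f₁.1.2
  have m3 := f₃.1.2
  have hmem := hd.orthogonal hsep (k := f₀.2) (j := f₀.2 + 3) (Or.inr rfl) f₀.1.2 (e0 ▸ m1)
    (e3' ▸ m3) (e0 ▸ l1) (e3' ▸ l3)
  have h4 := (L.cornerRotation hD).planar f₁.1 ⟨_, hmem⟩ f₁.2 (by rw [k0, e0])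
  have h5 : f₂ = (⟨_, hmem⟩, f₁.2 + 3) := h1.symm.trans h4
  have h6 : (f₂.1 : ℤ × ℤ) = f₀.1 + dir f₀.2 + dir (f₀.2 + 3) := by rw [h5]
  rw [h6]
  constructor
  · rw [e0]
    exact gridGraph_adj_add_dir _ _
  · rw [e3', add_right_comm]
    exact gridGraph_adj_add_dir _ _

theorem exists_block (hD : ∀ i, 0 < D i) {s₀ s₁ s₂ s₃ : BoxSquare D} (h : s₀.Block s₁ s₂ s₃) :
    ∃ f₀ f₁ f₂ f₃ : P × ZMod 4, (f₀.1 = L.F.symm s₀ ∧ f₁.1 = L.F.symm s₁ ∧ f₂.1 = L.F.symm s₂ ∧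
      f₃.1 = L.F.symm s₃) ∧
      ((L.rot hD f₀ = f₁ ∧ L.rot hD f₁ = f₂ ∧ L.rot hD f₂ = f₃ ∧ L.rot hD f₃ = f₀) ∨
        (L.rot hD f₁ = f₀ ∧ L.rot hD f₂ = f₁ ∧ L.rot hD f₃ = f₂ ∧ L.rot hD f₀ = f₃)) := by
  obtain ⟨f₀, f₁, f₂, f₃, ⟨rfl, rfl, rfl, rfl⟩, h'⟩ := h.exists_rotate hD
  refine ⟨L.flag.symm f₀, L.flag.symm f₁, L.flag.symm f₂, L.flag.symm f₃, ⟨rfl, rfl, rfl, rfl⟩, ?_⟩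
  simpa only [rot_eq_iff, Equiv.apply_symm_apply] using h'

theorem exists_cornerTriple (hD : ∀ i, 0 < D i) {s₀ s₁ s₂ : BoxSquare D}
    (h : s₀.CornerTriple s₁ s₂) :
    ∃ f₀ f₁ f₂ : P × ZMod 4, (f₀.1 = L.F.symm s₀ ∧ f₁.1 = L.F.symm s₁ ∧ f₂.1 = L.F.symm s₂) ∧
      ((L.rot hD f₀ = f₁ ∧ L.rot hD f₁ = f₂ ∧ L.rot hD f₂ = f₀) ∨
        (L.rot hD f₁ = f₀ ∧ L.rot hD f₂ = f₁ ∧ L.rot hD f₀ = f₂)) := by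
  obtain ⟨f₀, f₁, f₂, ⟨rfl, rfl, rfl⟩, h'⟩ := h.exists_rotate hD
  refine ⟨L.flag.symm f₀, L.flag.symm f₁, L.flag.symm f₂, ⟨rfl, rfl, rfl⟩, ?_⟩
  simpa only [rot_eq_iff, Equiv.apply_symm_apply] using h'

theorem glued_of_adj {s t : BoxSquare D}
    (h : gridGraph.Adj (L.F.symm s : ℤ × ℤ) (L.F.symm t : ℤ × ℤ)) :
    ∃ k, (L.F.symm t : ℤ × ℤ) = L.F.symm s + dir k ∧
      s.Glued (L.turn (L.F.symm s) + k) t (L.turn (L.F.symm t) + k + 2) := by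
  obtain ⟨k, hk⟩ := gridGraph_adj_iff.1 h
  have := L.glued _ _ k hk
  rw [Equiv.apply_symm_apply, Equiv.apply_symm_apply] at this
  exact ⟨k, hk, this⟩

open scoped Classical in
/-- The truth assignment given by a layout and a distance function on its cells. -/
noncomputable def assignment (d : ℤ × ℤ → ℕ) : Assignment D where
  e := Sym2.lift ⟨fun s t => decide (gridGraph.Adj (L.F.symm s : ℤ × ℤ) (L.F.symm t : ℤ × ℤ)),
    fun _ _ => decide_eq_decide.2 (SimpleGraph.adj_comm _ _ _)⟩
  -- Corner `k` of the cell goes to corner `turn + k` of the square, so the dot, at corner `0` of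
  -- the square, is at corner `-turn` of the cell.
  o s k := decide (k = -L.turn (L.F.symm s))
  d s t := decide (gridGraph.Adj (L.F.symm s : ℤ × ℤ) (L.F.symm t : ℤ × ℤ) ∧
    d (L.F.symm t) < d (L.F.symm s))

theorem assignment_e {d : ℤ × ℤ → ℕ} {s t : BoxSquare D} : (L.assignment d).e s(s, t) = true ↔
    gridGraph.Adj (L.F.symm s : ℤ × ℤ) (L.F.symm t : ℤ × ℤ) := by
  simp [assignment]

theorem assignment_o {d : ℤ × ℤ → ℕ} {s : BoxSquare D} {k : ZMod 4} :
    (L.assignment d).o s k = true ↔ k = -L.turn (L.F.symm s) := by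
  simp [assignment]

theorem assignment_d {d : ℤ × ℤ → ℕ} {s t : BoxSquare D} : (L.assignment d).d s t = true ↔
    gridGraph.Adj (L.F.symm s : ℤ × ℤ) (L.F.symm t : ℤ × ℤ) ∧
      d (L.F.symm t) < d (L.F.symm s) := by
  simp [assignment]

/-! ### Verification of the constraints -/

theorem cutConstraints (hD : ∀ i, 0 < D i) (d : ℤ × ℤ → ℕ) :
    (L.assignment d).CutConstraints where
  corners s₀ s₁ s₂ _ := by
    simp only [assignment_e]
    rintro ⟨h1, h2, h3⟩
    -- Three pairwise adjacent cells would form an odd cycle in the grid.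
    have h1 := gridGraph_adj_parity h1
    have h2 := gridGraph_adj_parity h2
    have h3 := gridGraph_adj_parity h3
    omega
  necessity s₀ s₁ s₂ s₃ hb := by
    simp only [assignment_e]
    obtain ⟨f₀, f₁, f₂, f₃, ⟨e0, e1, e2, e3⟩, ⟨r0, r1, r2, r3⟩ | ⟨r0, r1, r2, r3⟩⟩ :=
      L.exists_block hD hb <;> rw [← e0, ← e1, ← e2, ← e3] <;> intro a0 a1 a2
    · exact L.adj_of_rot hD r0 r1 r2 a0 a1 a2
    · exact (L.adj_of_rot hD r2 r1 r0 a2.symm a1.symm a0.symm).symm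

theorem orientationConstraints (hD : ∀ i, 0 < D i) (d : ℤ × ℤ → ℕ) :
    (L.assignment d).OrientationConstraints where
  unique s := ⟨_, L.assignment_o.2 rfl, fun k hk => L.assignment_o.1 hk⟩
  relative s t r h k := by
    simp only [assignment_e, assignment_o]
    rintro hadj rfl
    obtain ⟨K, M, hg, rfl⟩ := h
    obtain ⟨j, -, hg'⟩ := L.glued_of_adj hadj
    -- The common edge is unique, so the relative orientation is the turn of the cell of `s` minus
    -- that of the cell of `t`.
    obtain ⟨rfl, rfl⟩ := hg.unique_edge hD hg'
    ring

theorem directionConstraints {z : BoxSquare D} {d : ℤ × ℤ → ℕ}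
    (hd : IsDistance P (L.F.symm z) d) : (L.assignment d).DirectionConstraints z where
  not_both s t _ := by
    simp only [assignment_d]
    omega
  directed s t _ := by
    simp only [assignment_d, assignment_e]
    intro h
    obtain ⟨k, hk⟩ := gridGraph_adj_iff.1 h
    have := hd.ne (L.F.symm s) k (L.F.symm s).2 (hk ▸ (L.F.symm t).2)
    rw [← hk] at this
    rcases lt_or_gt_of_ne this with hlt | hlt
    · exact Or.inr ⟨h.symm, hlt⟩
    · exact Or.inl ⟨h, hlt⟩
  preserved s t _ := by
    simp only [assignment_d, assignment_e]
    exact fun h => h.1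
  sink u _ := by
    simp only [assignment_d, hd.zero]
    omega
  not_sink v hv := by
    obtain ⟨k, hk, hlt⟩ := hd.exists_lt (L.F.symm v) (L.F.symm v).2
      (fun h => hv (L.F.symm.injective (Subtype.ext h)))
    have hglued := L.glued (L.F.symm v) ⟨_, hk⟩ k rfl
    rw [Equiv.apply_symm_apply] at hglued
    refine ⟨L.F ⟨_, hk⟩, ⟨_, _, hglued⟩, ?_⟩
    · rw [assignment_d, Equiv.symm_apply_apply]
      exact ⟨gridGraph_adj_add_dir _ _, hlt⟩

theorem patternConstraints (hD : ∀ i, 0 < D i) (hP : IsPolyomino P) {z : BoxSquare D}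
    {d : ℤ × ℤ → ℕ} (hd : IsDistance P (L.F.symm z) d) :
    (L.assignment d).PatternConstraints where
  collinear u s w := by
    rintro ⟨k, m, n, hu, hw⟩
    simp only [assignment_d]
    rintro ⟨⟨a1, l1⟩, a2, l2⟩
    obtain ⟨i, ei, gi⟩ := L.glued_of_adj a1
    obtain ⟨j, ej, gj⟩ := L.glued_of_adj a2
    have h1 := (hu.unique_edge hD gi).1
    have h2 := (hw.unique_edge hD gj).1
    rw [h1, add_assoc, add_left_cancel_iff] at h2
    rw [← h2] at ej
    have mu := (L.F.symm u).2
    have mw := (L.F.symm w).2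
    rw [ei] at l1 mu
    rw [ej] at l2 mw
    exact hd.not_collinear (L.chordsSeparate hD hP) (L.F.symm s).2 mu mw l1 l2
  antiparallel s₀ s₁ s₂ s₃ hb := by
    simp only [assignment_d, assignment_e]
    obtain ⟨f₀, f₁, f₂, f₃, ⟨e0, e1, e2, e3⟩, ⟨r0, r1, r2, r3⟩ | ⟨r0, r1, r2, r3⟩⟩ :=
      L.exists_block hD hb <;> rw [← e0, ← e1, ← e2, ← e3]
    · have key : gridGraph.Adj (f₀.1 : ℤ × ℤ) f₁.1 → gridGraph.Adj (f₁.1 : ℤ × ℤ) f₂.1 →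
          gridGraph.Adj (f₂.1 : ℤ × ℤ) f₃.1 → ¬ (d f₁.1 < d f₀.1 ∧ d f₃.1 < d f₂.1) :=
        fun a0 a1 a2 => (L.not_antiparallel hD hP hd r0 r1 r2 a0 a1 a2).1
      refine ⟨fun ⟨h1, h2, h3⟩ => key h1.1 h3 h2.1 ⟨h1.2, h2.2⟩, fun ⟨h1, h2, h3⟩ => ?_⟩
      -- The other joining edge is given here; with three sides of the block present, `adj_of_rot`
      -- supplies the one needed by `key`.
      exact key h1.1 (L.adj_of_rot hD r2 r3 r0 h2.1 h3 h1.1) h2.1 ⟨h1.2, h2.2⟩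
    · have key : gridGraph.Adj (f₀.1 : ℤ × ℤ) f₁.1 → gridGraph.Adj (f₁.1 : ℤ × ℤ) f₂.1 →
          gridGraph.Adj (f₂.1 : ℤ × ℤ) f₃.1 → ¬ (d f₁.1 < d f₀.1 ∧ d f₃.1 < d f₂.1) :=
        fun a0 a1 a2 h =>
          (L.not_antiparallel hD hP hd r2 r1 r0 a2.symm a1.symm a0.symm).2 ⟨h.2, h.1⟩
      refine ⟨fun ⟨h1, h2, h3⟩ => key h1.1 h3 h2.1 ⟨h1.2, h2.2⟩, fun ⟨h1, h2, h3⟩ => ?_⟩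
      exact key h1.1 (L.adj_of_rot hD r0 r3 r2 h1.1.symm h3.symm h2.1.symm).symm h2.1 ⟨h1.2, h2.2⟩
  orthogonal s₀ s₁ s₂ s₃ hb := by
    simp only [assignment_d, assignment_e]
    obtain ⟨f₀, f₁, f₂, f₃, ⟨e0, e1, e2, e3⟩, ⟨r0, r1, r2, r3⟩ | ⟨r0, r1, r2, r3⟩⟩ :=
      L.exists_block hD hb <;> rw [← e0, ← e1, ← e2, ← e3] <;> rintro ⟨a1, l1⟩ ⟨a3, l3⟩
    · exact L.orthogonal hD hP hd r0 r1 r3 a1 a3 l1 l3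
    · exact (L.orthogonal hD hP hd r3 r2 r0 a3 a1 l3 l1).symm
  orthogonal_corner s₀ s₁ s₂ ht := by
    simp only [assignment_d]
    obtain ⟨f₀, f₁, f₂, ⟨e0, e1, e2⟩, ⟨r0, r1, r2⟩ | ⟨r0, r1, r2⟩⟩ :=
      L.exists_cornerTriple hD ht <;> rw [← e0, ← e1, ← e2] <;> rintro ⟨⟨a1, l1⟩, a2, l2⟩
    -- With only three squares at the vertex, the fourth cell of the block would be the cell of `f₂`
    -- itself, which would then be adjacent to itself.
    · exact (L.orthogonal hD hP hd r0 r1 r2 a1 a2 l1 l2).2.ne rfl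
    · exact (L.orthogonal hD hP hd r2 r1 r0 a2 a1 l2 l1).2.ne rfl

end Layout

end BoxUnfolding

theorem mainTheorem5 (D : Fin 3 → ℕ) (hD : ∀ i, 0 < D i)
    (P : Finset (ℤ × ℤ)) (hP : BoxUnfolding.IsPolyomino P) (φ : BoxUnfolding.Folding P D)
    (z : BoxUnfolding.BoxSquare D) :
    ∃ A : BoxUnfolding.Assignment D,
      (∀ s t : BoxUnfolding.BoxSquare D, s.Adj t →
        (A.e s(s, t) = true ↔ s(s, t) ∉ φ.cutEdges)) ∧
      A.Satisfies z := by
  obtain ⟨P', L, hP', hadj⟩ := φ.exists_layout hD hP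
  obtain ⟨d, hd⟩ := hP'.exists_isDistance (L.F.symm z).2
  refine ⟨L.assignment d, fun s t hst => ?_, L.cutConstraints hD d, L.orientationConstraints hD d,
    L.directionConstraints hd, L.patternConstraints hD hP' hd⟩
  rw [L.assignment_e, hadj]
  constructor
  · rintro h ⟨s', t', heq, -, hn⟩
    rcases Sym2.eq_iff.1 heq with ⟨rfl, rfl⟩ | ⟨rfl, rfl⟩
    · exact hn h
    · exact hn h.symm
  · intro h
    by_contra hn
    exact h ⟨s, t, rfl, hst, hn⟩
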